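/- Let $R$ be a commutative ring, unadorned $\otimes=\otimes_R$, and let $H$ be a Hopf algebra over $R$ with bijective antipode. Let $A$ be a right $H$-comodule algebra, i.e. an $R$-algebra with a coassociative and counital coaction $\delta:A\to A\otimes H$, $a\mapsto a_{(0)}\otimes a_{(1)}$, which is an algebra homomorphism, and let $B=A^{co\,H}=\{a:\delta(a)=a\otimes 1\}$. Then $A^{op}$ is an $H^{op}$-comodule algebra with the same coaction, where $H^{op}$ has the opposite product and the same comultiplication. The extension $A/B$ is called $H$-Galois if $A\otimes_BA\to A\otimes H$, $a\otimes b\mapsto ab_{(0)}\otimes b_{(1)}$, is bijective. A generalised quotient of $H$ is a quotient $\pi_Q:H\to Q=H/I$ by a right ideal coideal $I$; the set $\mathsf{Quot}_{gen}(H)$ of these is ordered by $H/I\le H/J$ iff $J\subseteq I$, and is a complete lattice. Put $\phi(Q)=A^{co\,Q}=\{a\in A: a_{(0)}\otimes\pi_Q(a_{(1)})=a\otimes\pi_Q(1)\}$, an $R$-subalgebra of $A$ containing $B$, and, for an $R$-subalgebra $S\subseteq A$, $\psi(S)=\bigvee\{Q\in\mathsf{Quot}_{gen}(H):S\subseteq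 A^{co\,Q}\}$. We say that the Galois connection exists if there is an order-reversing map $\psi'$ from subalgebras of $A$ to $\mathsf{Quot}_{gen}(H)$ with $S\subseteq\phi\psi'(S)$ and $Q\le\psi'\phi(Q)$ for all $S$ and $Q$; then necessarily $\psi'=\psi$. Let $\psi^{op}$ denote the map $\psi$ of the $H^{op}$-comodule algebra $A^{op}$. A generalised quotient $Q$ is called right (left) admissible if $Q$ is flat over $R$ and $H$ is faithfully coflat as a right (left) $Q$-comodule, i.e. the cotensor functor $H\,\square_Q-$ (respectively $-\,\square_Q H$) preserves and reflects exact sequences of comodules. A subalgebra $S$ with $B\subseteq S\subseteq A$ is called right admissible if $A$ is faithfully flat as a right $S$-module, the map $A\otimes_SA\to A\otimes\psi(S)$, $a\otimes b\mapsto ab_{(0)}\otimes\pi_{\psi(S)}(b_{(1)})$, is bijective, and $\psi(S)$ is flat over $R$. It is called left admissible if $A$ is faithfully flat as a left $S$-module, the corresponding map $A^{op}\otimes_{S^{op}}A^{op}\to A^{op}\otimes\psi^{op}(S^{op})$ for the $H^{op}$-comodule algebra $A^{op}$ is bijective, and $\psi(S)$ is flat over $R$. In both cases, admissible means both left and right admissible.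 **Theorem.** Assume that $A/B$ is $H$-Galois, that $A^{op}/B^{op}$ is $H^{op}$-Galois, that $A$ is faithfully flat both as a left and as a right $B$-module, that $A$ is faithfully flat over $R$, and that the Galois connection exists. Then $\psi$ and $\phi$ restrict to mutually inverse bijections 1. between left admissible subalgebras $B\subseteq S\subseteq A$ and left admissible generalised quotients of $H$; 2. between right admissible subalgebras $B\subseteq S\subseteq A$ and right admissible generalised quotients of $H$; 3. between admissible subalgebras $B\subseteq S\subseteq A$ and admissible generalised quotients of $H$. In particular all these objects are closed: $\phi\psi(S)=S$ and $\psi\phi(Q)=Q$. -/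

import Mathlib

open scoped TensorProduct
open MulOpposite

universe u

noncomputable section

namespace HopfGalois

/-! ### Tensor products over a noncommutative ring, faithful flatness -/

section Balanced

/-- The right module structure of `A` over a subalgebra `S`, given by `a · s = a * s`. -/
instance subalgebraModuleRight {R A : Type*} [CommRing R] [Ring A] [Algebra R A]
    (S : Subalgebra R A) : Module (↥S)ᵐᵒᵖ A :=
  Module.compHom A (RingHom.op S.val.toRingHom)

theorem op_smul_eq_mul {R A : Type*} [CommRing R] [Ring A] [Algebra R A]
    (S : Subalgebra R A) (s : S) (a : A) : op s • a = a * (s : A) := rfl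

variable (R S M N : Type*) [CommRing R] [Ring S]
  [AddCommGroup M] [Module R M] [Module Sᵐᵒᵖ M]
  [AddCommGroup N] [Module R N] [Module S N]

/-- The relations `m · s ⊗ n = m ⊗ s · n`. -/
def balancedRel : Submodule R (M ⊗[R] N) :=
  Submodule.span R {x | ∃ (m : M) (s : S) (n : N), x = (op s • m) ⊗ₜ[R] n - m ⊗ₜ[R] (s • n)}

/-- `M ⊗_S N` for a right `S`-module `M` and a left `S`-module `N`, where `S` is a (possibly
noncommutative) `R`-algebra: the quotient of `M ⊗_R N` by the relations
`m · s ⊗ n = m ⊗ s · n`. -/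
abbrev BalancedTensor : Type _ := (M ⊗[R] N) ⧸ balancedRel R S M N

variable {R S N}

/-- `M ⊗_S f` for a map `f` of left `S`-modules. -/
def BalancedTensor.mapRight [Algebra R S] [IsScalarTower R S N]
    {N' : Type*} [AddCommGroup N'] [Module R N'] [Module S N'] [IsScalarTower R S N']
    (f : N →ₗ[S] N') : BalancedTensor R S M N →ₗ[R] BalancedTensor R S M N' :=
  Submodule.mapQ _ _ ((f.restrictScalars R).lTensor M) (by
    rw [balancedRel, Submodule.span_le]
    rintro _ ⟨m, s, n, rfl⟩
    exact Submodule.subset_span ⟨m, s, f n, by simp⟩)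

variable {M} (N)

/-- `g ⊗_S N` for a map `g` of right `S`-modules. -/
def BalancedTensor.mapLeft [Algebra R S] [IsScalarTower R Sᵐᵒᵖ M]
    {M' : Type*} [AddCommGroup M'] [Module R M'] [Module Sᵐᵒᵖ M'] [IsScalarTower R Sᵐᵒᵖ M']
    (g : M →ₗ[Sᵐᵒᵖ] M') : BalancedTensor R S M N →ₗ[R] BalancedTensor R S M' N :=
  Submodule.mapQ _ _ ((g.restrictScalars R).rTensor N) (by
    rw [balancedRel, Submodule.span_le]
    rintro _ ⟨m, s, n, rfl⟩
    exact Submodule.subset_span ⟨g m, s, n, by simp⟩)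

end Balanced

section FaithfullyFlat

variable (R S M : Type u) [CommRing R] [Ring S] [Algebra R S] [AddCommGroup M] [Module R M]

/-- The right `S`-module `M` is faithfully flat: a sequence of left `S`-modules is exact if and
only if it is exact after applying `M ⊗_S -`. -/
def IsRightFaithfullyFlat [Module Sᵐᵒᵖ M] : Prop :=
  ∀ (X Y Z : Type u) [AddCommGroup X] [AddCommGroup Y] [AddCommGroup Z]
    [Module R X] [Module R Y] [Module R Z] [Module S X] [Module S Y] [Module S Z]
    [IsScalarTower R S X] [IsScalarTower R S Y] [IsScalarTower R S Z]
    (f : X →ₗ[S] Y) (g : Y →ₗ[S] Z),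
    Function.Exact f g ↔
      Function.Exact (BalancedTensor.mapRight (R := R) M f) (BalancedTensor.mapRight (R := R) M g)

/-- The left `S`-module `M` is faithfully flat: a sequence of right `S`-modules is exact if and
only if it is exact after applying `- ⊗_S M`. -/
def IsLeftFaithfullyFlat [Module S M] : Prop :=
  ∀ (X Y Z : Type u) [AddCommGroup X] [AddCommGroup Y] [AddCommGroup Z]
    [Module R X] [Module R Y] [Module R Z] [Module Sᵐᵒᵖ X] [Module Sᵐᵒᵖ Y] [Module Sᵐᵒᵖ Z]
    [IsScalarTower R Sᵐᵒᵖ X] [IsScalarTower R Sᵐᵒᵖ Y] [IsScalarTower R Sᵐᵒᵖ Z]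
    (f : X →ₗ[Sᵐᵒᵖ] Y) (g : Y →ₗ[Sᵐᵒᵖ] Z),
    Function.Exact f g ↔
      Function.Exact (BalancedTensor.mapLeft (R := R) M f) (BalancedTensor.mapLeft (R := R) M g)

end FaithfullyFlat

/-! ### Comodules, cotensor products, faithful coflatness -/

section Comodules

variable {R C M N : Type*} [CommRing R] [AddCommGroup C] [Module R C] [Coalgebra R C]
  [AddCommGroup M] [Module R M] [AddCommGroup N] [Module R N]

/-- `δ : M → M ⊗ C` is a coassociative and counital right coaction of the coalgebra `C`. -/
structure IsRightCoaction (δ : M →ₗ[R] M ⊗[R] C) : Prop where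
  coassoc : (TensorProduct.assoc R M C C).toLinearMap ∘ₗ δ.rTensor C ∘ₗ δ =
    (Coalgebra.comul (R := R) (A := C)).lTensor M ∘ₗ δ
  counit : (Coalgebra.counit (R := R) (A := C)).lTensor M ∘ₗ δ = (TensorProduct.mk R M R).flip 1

/-- `ρ : N → C ⊗ N` is a coassociative and counital left coaction of the coalgebra `C`. -/
structure IsLeftCoaction (ρ : N →ₗ[R] C ⊗[R] N) : Prop where
  coassoc : (TensorProduct.assoc R C C N).toLinearMap ∘ₗ
    (Coalgebra.comul (R := R) (A := C)).rTensor N ∘ₗ ρ = ρ.lTensor C ∘ₗ ρ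
  counit : (Coalgebra.counit (R := R) (A := C)).rTensor N ∘ₗ ρ = TensorProduct.mk R R N 1

/-- The cotensor product `M □_C N`: the equaliser of `δ ⊗ N` and `M ⊗ ρ` in `M ⊗ N`. -/
def cotensor (δ : M →ₗ[R] M ⊗[R] C) (ρ : N →ₗ[R] C ⊗[R] N) : Submodule R (M ⊗[R] N) :=
  LinearMap.eqLocus ((TensorProduct.assoc R M C N).toLinearMap ∘ₗ δ.rTensor N) (ρ.lTensor M)

/-- `M □_C f` for a map `f` of left `C`-comodules. -/
def cotensorMapRight (δ : M →ₗ[R] M ⊗[R] C) {N' : Type*} [AddCommGroup N'] [Module R N']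
    {ρ : N →ₗ[R] C ⊗[R] N} {ρ' : N' →ₗ[R] C ⊗[R] N'} (f : N →ₗ[R] N')
    (hf : ρ' ∘ₗ f = f.lTensor C ∘ₗ ρ) : cotensor δ ρ →ₗ[R] cotensor δ ρ' :=
  (f.lTensor M).restrict (by
    intro x hx
    have hx' : TensorProduct.assoc R M C N (δ.rTensor N x) = ρ.lTensor M x := hx
    change TensorProduct.assoc R M C N' (δ.rTensor N' (f.lTensor M x)) =
      ρ'.lTensor M (f.lTensor M x)
    rw [← LinearMap.lTensor_comp_apply, hf, LinearMap.lTensor_comp_apply, ← hx',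
      ← LinearMap.comp_apply (δ.rTensor N'), LinearMap.rTensor_comp_lTensor,
      ← LinearMap.lTensor_comp_rTensor, LinearMap.comp_apply]
    generalize δ.rTensor N x = y
    induction y with
    | zero => simp
    | add a b ha hb => simp only [map_add, ha, hb]
    | tmul a n =>
      induction a with
      | zero => simp
      | add a b ha hb => simp only [map_add, TensorProduct.add_tmul, ha, hb]
      | tmul m c => simp)

/-- `g □_C N` for a map `g` of right `C`-comodules. -/
def cotensorMapLeft (ρ : N →ₗ[R] C ⊗[R] N) {M' : Type*} [AddCommGroup M'] [Module R M']
    {δ : M →ₗ[R] M ⊗[R] C} {δ' : M' →ₗ[R] M' ⊗[R] C} (g : M →ₗ[R] M')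
    (hg : δ' ∘ₗ g = g.rTensor C ∘ₗ δ) : cotensor δ ρ →ₗ[R] cotensor δ' ρ :=
  (g.rTensor N).restrict (by
    intro x hx
    have hx' : TensorProduct.assoc R M C N (δ.rTensor N x) = ρ.lTensor M x := hx
    change TensorProduct.assoc R M' C N (δ'.rTensor N (g.rTensor N x)) =
      ρ.lTensor M' (g.rTensor N x)
    rw [← LinearMap.rTensor_comp_apply, hg, LinearMap.rTensor_comp_apply,
      ← LinearMap.comp_apply (ρ.lTensor M'), LinearMap.lTensor_comp_rTensor,
      ← LinearMap.rTensor_comp_lTensor, LinearMap.comp_apply, ← hx']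
    generalize δ.rTensor N x = y
    induction y with
    | zero => simp
    | add a b ha hb => simp only [map_add, ha, hb]
    | tmul a n =>
      induction a with
      | zero => simp
      | add a b ha hb => simp only [map_add, TensorProduct.add_tmul, ha, hb]
      | tmul m c => simp)

end Comodules

section FaithfullyCoflat

variable {R C M : Type u} [CommRing R] [AddCommGroup C] [Module R C] [Coalgebra R C]
  [AddCommGroup M] [Module R M]

/-- The right `C`-comodule `(M, δ)` is faithfully coflat: a sequence of left `C`-comodules is
exact if and only if it is exact after applying `M □_C -`. -/
def IsRightFaithfullyCoflat (δ : M →ₗ[R] M ⊗[R] C) : Prop :=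
  ∀ (X Y Z : Type u) [AddCommGroup X] [AddCommGroup Y] [AddCommGroup Z]
    [Module R X] [Module R Y] [Module R Z]
    (ρX : X →ₗ[R] C ⊗[R] X) (ρY : Y →ₗ[R] C ⊗[R] Y) (ρZ : Z →ₗ[R] C ⊗[R] Z),
    IsLeftCoaction ρX → IsLeftCoaction ρY → IsLeftCoaction ρZ →
    ∀ (f : X →ₗ[R] Y) (g : Y →ₗ[R] Z)
      (hf : ρY ∘ₗ f = f.lTensor C ∘ₗ ρX) (hg : ρZ ∘ₗ g = g.lTensor C ∘ₗ ρY),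
      Function.Exact f g ↔
        Function.Exact (cotensorMapRight δ f hf) (cotensorMapRight δ g hg)

/-- The left `C`-comodule `(M, ρ)` is faithfully coflat: a sequence of right `C`-comodules is
exact if and only if it is exact after applying `- □_C M`. -/
def IsLeftFaithfullyCoflat (ρ : M →ₗ[R] C ⊗[R] M) : Prop :=
  ∀ (X Y Z : Type u) [AddCommGroup X] [AddCommGroup Y] [AddCommGroup Z]
    [Module R X] [Module R Y] [Module R Z]
    (δX : X →ₗ[R] X ⊗[R] C) (δY : Y →ₗ[R] Y ⊗[R] C) (δZ : Z →ₗ[R] Z ⊗[R] C),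
    IsRightCoaction δX → IsRightCoaction δY → IsRightCoaction δZ →
    ∀ (f : X →ₗ[R] Y) (g : Y →ₗ[R] Z)
      (hf : δY ∘ₗ f = f.rTensor C ∘ₗ δX) (hg : δZ ∘ₗ g = g.rTensor C ∘ₗ δY),
      Function.Exact f g ↔
        Function.Exact (cotensorMapLeft ρ f hf) (cotensorMapLeft ρ g hg)

end FaithfullyCoflat

/-! ### Generalised quotients -/

section GenQuot

/-- A generalised quotient `H ⧸ ideal` of `H`, i.e. a quotient by a right ideal coideal, recorded
by its kernel. (Only the algebra and the coalgebra structure of `H` enter, so that this applies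
verbatim to the opposite Hopf algebra `Hᵐᵒᵖ`: opposite product, same comultiplication.) -/
@[ext]
structure GenQuot (R H : Type*) [CommRing R] [Ring H] [Algebra R H] [Coalgebra R H] where
  /-- the kernel of the quotient map -/
  ideal : Submodule R H
  isCoideal : ideal.IsCoideal
  mul_mem : ∀ x ∈ ideal, ∀ h : H, x * h ∈ ideal

namespace GenQuot

variable {R H : Type*} [CommRing R] [Ring H] [Algebra R H] [Coalgebra R H]

instance (Q : GenQuot R H) : Q.ideal.IsCoideal := Q.isCoideal

/-- Larger quotients have smaller kernels. -/
instance : PartialOrder (GenQuot R H) where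
  le Q₁ Q₂ := Q₂.ideal ≤ Q₁.ideal
  le_refl _ := le_refl (α := Submodule R H) _
  le_trans _ _ _ h₁ h₂ := le_trans (α := Submodule R H) h₂ h₁
  le_antisymm _ _ h₁ h₂ := GenQuot.ext (le_antisymm (α := Submodule R H) h₂ h₁)

theorem le_def (Q₁ Q₂ : GenQuot R H) : Q₁ ≤ Q₂ ↔ Q₂.ideal ≤ Q₁.ideal := Iff.rfl

/-- The supremum of a set of generalised quotients: its kernel is the sum of all right ideal
coideals contained in every kernel of the set. -/
instance : SupSet (GenQuot R H) where
  sSup T :=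
    { ideal := ⨆ (J : GenQuot R H) (_ : ∀ Q ∈ T, J.ideal ≤ Q.ideal), J.ideal
      isCoideal := by
        set P : Submodule R H :=
          ⨆ (J : GenQuot R H) (_ : ∀ Q ∈ T, J.ideal ≤ Q.ideal), J.ideal with hP
        have hle : ∀ J : GenQuot R H, (∀ Q ∈ T, J.ideal ≤ Q.ideal) → J.ideal ≤ P :=
          fun J hJ => le_iSup₂_of_le J hJ le_rfl
        have key : P ≤ LinearMap.ker (Coalgebra.counit (R := R) (A := H)) ⊓
            LinearMap.ker (TensorProduct.map P.mkQ P.mkQ ∘ₗ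
              Coalgebra.comul (R := R) (A := H)) := by
          conv_lhs => rw [hP]
          refine iSup₂_le fun J hJ x hx => ⟨?_, ?_⟩
          · exact Submodule.IsCoideal.counit_eq_zero hx
          · have h0 := Submodule.IsCoideal.map_mkQ_comul_eq_zero (I := J.ideal) hx
            have hf : P.mkQ = (Submodule.factor (hle J hJ)) ∘ₗ J.ideal.mkQ := by
              ext; rfl
            change TensorProduct.map P.mkQ P.mkQ (Coalgebra.comul x) = 0
            rw [hf, TensorProduct.map_comp,
              LinearMap.comp_apply, h0, map_zero]
        exact ⟨fun x hx => (key hx).1, fun x hx => (key hx).2⟩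
      mul_mem := by
        intro x hx h
        have key : (⨆ (J : GenQuot R H) (_ : ∀ Q ∈ T, J.ideal ≤ Q.ideal), J.ideal) ≤
            Submodule.comap (LinearMap.mulRight R h)
              (⨆ (J : GenQuot R H) (_ : ∀ Q ∈ T, J.ideal ≤ Q.ideal), J.ideal) := by
          refine iSup₂_le fun J hJ y hy => ?_
          exact (le_iSup₂_of_le (f := fun (J : GenQuot R H)
            (_ : ∀ Q ∈ T, J.ideal ≤ Q.ideal) => J.ideal)
            J hJ le_rfl) (J.mul_mem y hy h)
        exact key hx }

theorem isLUB_sSup (T : Set (GenQuot R H)) : IsLUB T (sSup T) := by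
  refine ⟨fun Q hQ => ?_, fun Q' hQ' => ?_⟩
  · exact (GenQuot.le_def _ _).2 (iSup₂_le fun J hJ => hJ Q hQ)
  · exact le_iSup₂_of_le (f := fun (J : GenQuot R H)
      (_ : ∀ Q ∈ T, J.ideal ≤ Q.ideal) => J.ideal)
      Q' (fun Q hQ => hQ' hQ) le_rfl

/-- The right `H`-module structure of `Q`: right multiplication by `h`. -/
def mulRight (Q : GenQuot R H) (h : H) : (H ⧸ Q.ideal) →ₗ[R] (H ⧸ Q.ideal) :=
  Submodule.mapQ _ _ (LinearMap.mulRight R h) fun x hx => Q.mul_mem x hx h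

theorem lTensor_mkQ_mul {A : Type*} [Ring A] [Algebra R A] (Q : GenQuot R H)
    {x x' : A ⊗[R] H} (hx : Q.ideal.mkQ.lTensor A x = Q.ideal.mkQ.lTensor A x')
    (y : A ⊗[R] H) :
    Q.ideal.mkQ.lTensor A (x * y) = Q.ideal.mkQ.lTensor A (x' * y) := by
  have key : ∀ (c : A) (h : H) (z : A ⊗[R] H), Q.ideal.mkQ.lTensor A (z * (c ⊗ₜ[R] h)) =
      TensorProduct.map (LinearMap.mulRight R c) (Q.mulRight h) (Q.ideal.mkQ.lTensor A z) := by
    intro c h z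
    induction z with
    | zero => simp
    | add a b ha hb => simp only [add_mul, map_add, ha, hb]
    | tmul a k =>
      have hk : Q.mulRight h (Q.ideal.mkQ k) = Q.ideal.mkQ (k * h) := rfl
      simp only [Algebra.TensorProduct.tmul_mul_tmul, LinearMap.lTensor_tmul,
        TensorProduct.map_tmul, LinearMap.mulRight_apply, hk]
  induction y with
  | zero => simp
  | add a b ha hb => simp only [mul_add, map_add, ha, hb]
  | tmul c h => rw [key, key, hx]

end GenQuot

variable {R H : Type u} [CommRing R] [Ring H] [Algebra R H] [Coalgebra R H]

/-- `Q` is right admissible: `Q` is `R`-flat, and `H`, with the right `Q`-coaction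
`h ↦ h₍₁₎ ⊗ π(h₍₂₎)`, is faithfully coflat over `Q`. -/
def GenQuot.IsRightAdmissible (Q : GenQuot R H) : Prop :=
  Module.Flat R (H ⧸ Q.ideal) ∧
    IsRightFaithfullyCoflat (Q.ideal.mkQ.lTensor H ∘ₗ Coalgebra.comul (R := R) (A := H))

/-- `Q` is left admissible: `Q` is `R`-flat, and `H`, with the left `Q`-coaction
`h ↦ π(h₍₁₎) ⊗ h₍₂₎`, is faithfully coflat over `Q`. -/
def GenQuot.IsLeftAdmissible (Q : GenQuot R H) : Prop :=
  Module.Flat R (H ⧸ Q.ideal) ∧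
    IsLeftFaithfullyCoflat (Q.ideal.mkQ.rTensor H ∘ₗ Coalgebra.comul (R := R) (A := H))

end GenQuot

/-! ### Comodule algebras: coinvariants, canonical maps, the Galois connection -/

section ComoduleAlgebra

variable {R H A : Type*} [CommRing R] [Ring H] [Algebra R H] [Ring A] [Algebra R A]

/-- The subalgebra `A^{co H} = {a | δ a = a ⊗ 1}`. -/
def coinvariants (δ : A →ₐ[R] A ⊗[R] H) : Subalgebra R A :=
  AlgHom.equalizer δ Algebra.TensorProduct.includeLeft

/-- The coaction of the opposite algebra `Hᵐᵒᵖ` on `Aᵐᵒᵖ`, `a ↦ a₍₀₎ ⊗ a₍₁₎`. -/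
def opCoaction (δ : A →ₐ[R] A ⊗[R] H) : Aᵐᵒᵖ →ₐ[R] Aᵐᵒᵖ ⊗[R] Hᵐᵒᵖ :=
  (Algebra.TensorProduct.opAlgEquiv R R A H).symm.toAlgHom.comp (AlgHom.op δ)

/-- For a linear map `d : A → A ⊗ Q` which is left linear over the subalgebra `S`, the map
`A ⊗_S A → A ⊗ Q`, `a ⊗ b ↦ a d(b)`. -/
def canonicalMap {Q : Type*} [AddCommGroup Q] [Module R Q] (d : A →ₗ[R] A ⊗[R] Q)
    (S : Subalgebra R A) (hd : ∀ s ∈ S, ∀ b, d (s * b) = s • d b) :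
    BalancedTensor R S A A →ₗ[R] A ⊗[R] Q :=
  (balancedRel R S A A).liftQ
    (TensorProduct.lift (LinearMap.mk₂ R (fun a b => a • d b)
      (fun _ _ _ => add_smul _ _ _) (fun _ _ _ => smul_assoc _ _ _)
      (fun _ _ _ => by rw [map_add, smul_add])
      (fun _ _ _ => by rw [map_smul, smul_comm]))) (by
    rw [balancedRel, Submodule.span_le]
    rintro _ ⟨m, s, n, rfl⟩
    have h : d (s • n) = (s : A) • d n := hd s s.2 n
    simp only [SetLike.mem_coe, LinearMap.mem_ker, map_sub, TensorProduct.lift.tmul,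
      LinearMap.mk₂_apply, h, op_smul_eq_mul, mul_smul, sub_self])

theorem coaction_mul_of_mem (δ : A →ₐ[R] A ⊗[R] H) :
    ∀ s ∈ coinvariants δ, ∀ b, δ.toLinearMap (s * b) = s • δ.toLinearMap b := by
  intro s hs b
  have hs' : δ s = s ⊗ₜ[R] 1 := hs
  simp only [AlgHom.toLinearMap_apply, map_mul, hs']
  generalize δ b = y
  induction y with
  | zero => simp
  | add a b ha hb => simp only [mul_add, smul_add, ha, hb]
  | tmul a h => simp [TensorProduct.smul_tmul']

/-- `A / A^{co H}` is `H`-Galois: `A ⊗_{A^{co H}} A → A ⊗ H`, `a ⊗ b ↦ a b₍₀₎ ⊗ b₍₁₎`, is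
bijective. -/
def IsHopfGalois (δ : A →ₐ[R] A ⊗[R] H) : Prop :=
  Function.Bijective (canonicalMap δ.toLinearMap (coinvariants δ) (coaction_mul_of_mem δ))

variable [Coalgebra R H]

/-- The induced `Q`-coaction `a ↦ a₍₀₎ ⊗ π(a₍₁₎)` on `A`. -/
def quotCoaction (δ : A →ₐ[R] A ⊗[R] H) (Q : GenQuot R H) : A →ₗ[R] A ⊗[R] (H ⧸ Q.ideal) :=
  Q.ideal.mkQ.lTensor A ∘ₗ δ.toLinearMap

/-- `φ(Q) = A^{co Q} = {a | a₍₀₎ ⊗ π(a₍₁₎) = a ⊗ π(1)}`. -/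
def phi (δ : A →ₐ[R] A ⊗[R] H) (Q : GenQuot R H) : Subalgebra R A where
  carrier := {a | quotCoaction δ Q a = a ⊗ₜ[R] Q.ideal.mkQ 1}
  algebraMap_mem' r := by
    simp [quotCoaction, Algebra.TensorProduct.algebraMap_apply]
  add_mem' {a b} ha hb := by
    have ha' : quotCoaction δ Q a = a ⊗ₜ[R] Q.ideal.mkQ 1 := ha
    have hb' : quotCoaction δ Q b = b ⊗ₜ[R] Q.ideal.mkQ 1 := hb
    change quotCoaction δ Q (a + b) = (a + b) ⊗ₜ[R] Q.ideal.mkQ 1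
    rw [map_add, ha', hb', TensorProduct.add_tmul]
  mul_mem' {a b} ha hb := by
    have ha' : Q.ideal.mkQ.lTensor A (δ a) = Q.ideal.mkQ.lTensor A (a ⊗ₜ[R] (1 : H)) := ha
    have hb' : Q.ideal.mkQ.lTensor A (δ b) = b ⊗ₜ[R] Q.ideal.mkQ 1 := hb
    have hs : ∀ y : A ⊗[R] H, Q.ideal.mkQ.lTensor A ((a ⊗ₜ[R] (1 : H)) * y) =
        a • Q.ideal.mkQ.lTensor A y := by
      intro y
      induction y with
      | zero => simp
      | add a b ha hb => simp only [mul_add, map_add, smul_add, ha, hb]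
      | tmul a h => simp [TensorProduct.smul_tmul']
    change Q.ideal.mkQ.lTensor A (δ (a * b)) = (a * b) ⊗ₜ[R] Q.ideal.mkQ 1
    rw [map_mul, Q.lTensor_mkQ_mul ha', hs, hb', TensorProduct.smul_tmul', smul_eq_mul]

theorem quotCoaction_mul_of_mem (δ : A →ₐ[R] A ⊗[R] H) (Q : GenQuot R H) {S : Subalgebra R A}
    (hS : S ≤ phi δ Q) :
    ∀ s ∈ S, ∀ b, quotCoaction δ Q (s * b) = s • quotCoaction δ Q b := by
  intro s hs b
  have ha' : Q.ideal.mkQ.lTensor A (δ s) = Q.ideal.mkQ.lTensor A (s ⊗ₜ[R] (1 : H)) := hS hs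
  change Q.ideal.mkQ.lTensor A (δ (s * b)) = s • Q.ideal.mkQ.lTensor A (δ b)
  rw [map_mul, Q.lTensor_mkQ_mul ha']
  generalize δ b = y
  induction y with
  | zero => simp
  | add a b ha hb => simp only [mul_add, map_add, smul_add, ha, hb]
  | tmul a h => simp [TensorProduct.smul_tmul']

/-- `ψ(S) = ⋁ {Q | S ⊆ A^{co Q}}`. -/
def psi (δ : A →ₐ[R] A ⊗[R] H) (S : Subalgebra R A) : GenQuot R H :=
  sSup {Q | S ≤ phi δ Q}

/-- There is an antitone Galois connection between subalgebras of `A` and generalised quotients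
of `H` one of whose maps is `φ`. (The other map is then unique, and equal to `psi δ`.) -/
def GaloisConnectionExists (δ : A →ₐ[R] A ⊗[R] H) : Prop :=
  ∃ ψ : Subalgebra R A → GenQuot R H, Antitone (phi δ) ∧ Antitone ψ ∧
    (∀ S, S ≤ phi δ (ψ S)) ∧ (∀ Q, Q ≤ ψ (phi δ Q))

/-- `can_S : A ⊗_S A → A ⊗ ψ(S)`, `a ⊗ b ↦ a b₍₀₎ ⊗ π(b₍₁₎)`, is well defined (which means
`S ⊆ A^{co ψ(S)}`, automatic when the Galois connection exists) and bijective. -/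
def CanBijective (δ : A →ₐ[R] A ⊗[R] H) (S : Subalgebra R A) : Prop :=
  ∃ hS : S ≤ phi δ (psi δ S), Function.Bijective
    (canonicalMap (quotCoaction δ (psi δ S)) S (quotCoaction_mul_of_mem δ (psi δ S) hS))

end ComoduleAlgebra

section Admissible

variable {R H A : Type u} [CommRing R] [Ring H] [Algebra R H] [Coalgebra R H]
  [Ring A] [Algebra R A]

/-- Right admissible subalgebras `A^{co H} ⊆ S ⊆ A`. -/
structure IsRightAdmissible (δ : A →ₐ[R] A ⊗[R] H) (S : Subalgebra R A) : Prop where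
  coinvariants_le : coinvariants δ ≤ S
  faithfullyFlat : IsRightFaithfullyFlat R S A
  can_bijective : CanBijective δ S
  flat : Module.Flat R (H ⧸ (psi δ S).ideal)

/-- Left admissible subalgebras `A^{co H} ⊆ S ⊆ A`; here the canonical map is that of
`S^op ⊆ A^op` for the coaction of `H^op`. -/
structure IsLeftAdmissible (δ : A →ₐ[R] A ⊗[R] H) (S : Subalgebra R A) : Prop where
  coinvariants_le : coinvariants δ ≤ S
  faithfullyFlat : IsLeftFaithfullyFlat R S A
  can_bijective : CanBijective (opCoaction δ) S.op
  flat : Module.Flat R (H ⧸ (psi δ S).ideal)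

/-- `ψ` and `φ` restrict to mutually inverse bijections between the set `s` of subalgebras and
the set `t` of generalised quotients. -/
def RestrictsToBijection (δ : A →ₐ[R] A ⊗[R] H) (s : Set (Subalgebra R A))
    (t : Set (GenQuot R H)) : Prop :=
  Set.BijOn (psi δ) s t ∧ Set.BijOn (phi δ) t s ∧ Set.InvOn (phi δ) (psi δ) s t

end Admissible

end HopfGalois

end

open HopfGalois

/-!
Write `S = φ(Q) = A^{co Q}` and let `□` be the cotensor product. If `A` is faithfully flat over `S`
and `A ⊗_S A ≅ A ⊗ C` for a coalgebra `C`, then `A ⊗ (C □_Q X) ≅ A ⊗_S (A □_Q X)`, so a `Q`-comodule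
`C` is faithfully coflat as soon as `A` is. Applied once to `C = H` over `B`, once to `C = Q` over
`S`, and using that `Q` is always faithfully coflat over itself, this turns right admissibility of a
subalgebra into right admissibility of the corresponding quotient.

Conversely, if `H` is faithfully coflat over `Q`, then so is `A`, and exactness of a sequence of
Hopf modules can be tested on coinvariants. The sequences induced from `S`-modules and the Hopf
module `A ⊗ Q` then show that `A` is faithfully flat over `S` and that `A ⊗_S A → A ⊗ Q` is
bijective.

For such `Q` we have `ψφ(Q) = Q`: suppose `A^{co Q} ⊆ A^{co P}`. For `x` in the kernel of `H → Q`,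
the element `1 ⊗ x` comes from some `z ∈ A ⊗ A` which vanishes in `A ⊗_S A`, because
`A ⊗_S A → A ⊗ Q` is injective. Hence `1 ⊗ x` dies in `A ⊗ P` as well, and so `P ≤ Q`.

The left-sided case is the right-sided one for the `Hᵒᵖ`-comodule algebra `Aᵒᵖ`, generalised
quotients of `H` and of `Hᵒᵖ` being matched by the antipode.
-/

noncomputable section

namespace HopfGalois

/-! ### Balanced tensor products -/

namespace BalancedTensor

section General

variable {R S M N P : Type*} [CommRing R] [Ring S]
  [AddCommGroup M] [Module R M] [Module Sᵐᵒᵖ M]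
  [AddCommGroup N] [Module R N] [Module S N] [AddCommGroup P] [Module R P]

variable (R S) in
/-- The class of `m ⊗ n` in `M ⊗_S N`. -/
def tmul (m : M) (n : N) : BalancedTensor R S M N :=
  (balancedRel R S M N).mkQ (m ⊗ₜ[R] n)

theorem mkQ_tmul (m : M) (n : N) :
    (balancedRel R S M N).mkQ (m ⊗ₜ[R] n) = tmul R S m n := rfl

theorem op_smul_tmul (m : M) (s : S) (n : N) :
    tmul R S (op s • m) n = tmul R S m (s • n) := by
  rw [← sub_eq_zero, ← mkQ_tmul, ← mkQ_tmul, ← map_sub]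
  exact (Submodule.Quotient.mk_eq_zero _).2 (Submodule.subset_span ⟨m, s, n, rfl⟩)

theorem tmul_add (m : M) (n n' : N) : tmul R S m (n + n') = tmul R S m n + tmul R S m n' := by
  simp only [tmul, TensorProduct.tmul_add, map_add]

theorem add_tmul (m m' : M) (n : N) : tmul R S (m + m') n = tmul R S m n + tmul R S m' n := by
  simp only [tmul, TensorProduct.add_tmul, map_add]

variable (R S N) in
/-- `n ↦ m ⊗ n` as a linear map. -/
def mkRight (m : M) : N →ₗ[R] BalancedTensor R S M N :=
  (balancedRel R S M N).mkQ ∘ₗ TensorProduct.mk R M N m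

@[simp]
theorem mkRight_apply (m : M) (n : N) : mkRight R S N m n = tmul R S m n := rfl

theorem tmul_zero (m : M) : tmul R S m (0 : N) = 0 := (mkRight R S N m).map_zero

theorem induction_on {p : BalancedTensor R S M N → Prop} (z : BalancedTensor R S M N)
    (zero : p 0) (tmul : ∀ m n, p (tmul R S m n)) (add : ∀ x y, p x → p y → p (x + y)) : p z := by
  obtain ⟨z, rfl⟩ := Submodule.mkQ_surjective _ z
  induction z with
  | zero => simpa using zero
  | tmul m n => exact tmul m n
  | add x y hx hy => rw [map_add]; exact add _ _ hx hy

theorem linearMap_ext {f g : BalancedTensor R S M N →ₗ[R] P}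
    (h : ∀ m n, f (tmul R S m n) = g (tmul R S m n)) : f = g :=
  Submodule.linearMap_qext _ (TensorProduct.ext' h)

/-- Linear maps out of `M ⊗_S N` from balanced bilinear maps. -/
def lift (f : M →ₗ[R] N →ₗ[R] P) (hf : ∀ m (s : S) n, f (op s • m) n = f m (s • n)) :
    BalancedTensor R S M N →ₗ[R] P :=
  (balancedRel R S M N).liftQ (TensorProduct.lift f) (by
    rw [balancedRel, Submodule.span_le]
    rintro _ ⟨m, s, n, rfl⟩
    simp [hf])

@[simp]
theorem lift_tmul (f : M →ₗ[R] N →ₗ[R] P) (hf : ∀ m (s : S) n, f (op s • m) n = f m (s • n))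
    (m : M) (n : N) : lift f hf (tmul R S m n) = f m n := by
  simp [lift, tmul]

end General

section MapRight

variable {R S M : Type*} [CommRing R] [Ring S] [Algebra R S]
  [AddCommGroup M] [Module R M] [Module Sᵐᵒᵖ M]
  {N N' N'' : Type*} [AddCommGroup N] [Module R N] [Module S N] [IsScalarTower R S N]
  [AddCommGroup N'] [Module R N'] [Module S N'] [IsScalarTower R S N']
  [AddCommGroup N''] [Module R N''] [Module S N''] [IsScalarTower R S N'']

@[simp]
theorem mapRight_tmul (f : N →ₗ[S] N') (m : M) (n : N) :
    mapRight (R := R) M f (tmul R S m n) = tmul R S m (f n) := rfl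

theorem mapRight_comp_apply (f : N →ₗ[S] N') (g : N' →ₗ[S] N'') (z : BalancedTensor R S M N) :
    mapRight (R := R) M (g ∘ₗ f) z = mapRight M g (mapRight M f z) := by
  induction z using induction_on with
  | zero => simp
  | tmul m n => simp
  | add x y hx hy => simp only [map_add, hx, hy]

theorem mapRight_zero_apply (z : BalancedTensor R S M N) :
    mapRight (R := R) M (0 : N →ₗ[S] N') z = 0 := by
  induction z using induction_on with
  | zero => simp
  | tmul m n => rw [mapRight_tmul, LinearMap.zero_apply, tmul_zero]
  | add x y hx hy => simp only [map_add, hx, hy, add_zero]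

theorem mapRight_surjective {f : N →ₗ[S] N'} (hf : Function.Surjective f) :
    Function.Surjective (mapRight (R := R) M f) := by
  intro z
  induction z using induction_on with
  | zero => exact ⟨0, map_zero _⟩
  | tmul m n =>
    obtain ⟨n, rfl⟩ := hf n
    exact ⟨tmul R S m n, rfl⟩
  | add x y hx hy =>
    obtain ⟨x, rfl⟩ := hx
    obtain ⟨y, rfl⟩ := hy
    exact ⟨x + y, map_add _ _ _⟩

theorem mapRight_sub_apply (f g : N →ₗ[S] N') (z : BalancedTensor R S M N) :
    mapRight (R := R) M (f - g) z = mapRight M f z - mapRight M g z := by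
  induction z using induction_on with
  | zero => simp
  | tmul m n =>
    rw [mapRight_tmul, mapRight_tmul, mapRight_tmul, LinearMap.sub_apply, sub_eq_add_neg,
      tmul_add, sub_eq_add_neg, ← mkRight_apply (n := - g n), map_neg, mkRight_apply]
  | add x y hx hy => simp only [map_add, hx, hy]; abel

theorem mapRight_exact {f : N →ₗ[S] N'} {g : N' →ₗ[S] N''} (hfg : Function.Exact f g)
    (hg : Function.Surjective g) :
    Function.Exact (mapRight (R := R) M f) (mapRight (R := R) M g) := by
  intro z
  constructor
  · intro hz
    obtain ⟨z, rfl⟩ := Submodule.mkQ_surjective _ z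
    have hz' : (g.restrictScalars R).lTensor M z ∈ balancedRel R S M N'' :=
      (Submodule.Quotient.mk_eq_zero _).1 hz
    have hle : balancedRel R S M N'' ≤
        (balancedRel R S M N').map ((g.restrictScalars R).lTensor M) := by
      refine Submodule.span_le.2 ?_
      rintro _ ⟨m, s, n, rfl⟩
      obtain ⟨n, rfl⟩ := hg n
      exact ⟨_, Submodule.subset_span ⟨m, s, n, rfl⟩, by simp⟩
    obtain ⟨w, hw, hwz⟩ := hle hz'
    have hex : Function.Exact ((f.restrictScalars R).lTensor M)
        ((g.restrictScalars R).lTensor M) := lTensor_exact M hfg hg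
    obtain ⟨y, hy⟩ := (hex (z - w)).1 (by rw [map_sub, hwz, sub_self])
    refine ⟨(balancedRel R S M N).mkQ y, ?_⟩
    change (balancedRel R S M N').mkQ ((f.restrictScalars R).lTensor M y) = _
    rw [hy, map_sub, sub_eq_self]
    exact (Submodule.Quotient.mk_eq_zero _).2 hw
  · rintro ⟨y, rfl⟩
    rw [← mapRight_comp_apply, hfg.linearMap_comp_eq_zero, mapRight_zero_apply]

end MapRight

section ActionLeft

variable {R A V : Type*} [CommRing R] [Ring A] [Algebra R A] (S : Subalgebra R A)
  [AddCommGroup V] [Module R V] [Module S V]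

variable (V) in
/-- Left multiplication by an element on `A ⊗_S V`. -/
def lmul (a : A) : Module.End R (BalancedTensor R S A V) :=
  Submodule.mapQ _ _ ((LinearMap.mulLeft R a).rTensor V) (by
    rw [balancedRel, Submodule.span_le]
    rintro _ ⟨m, s, n, rfl⟩
    refine Submodule.subset_span ⟨a * m, s, n, ?_⟩
    simp [op_smul_eq_mul, mul_assoc])

theorem lmul_tmul (a b : A) (v : V) : lmul V S a (tmul R S b v) = tmul R S (a * b) v := rfl

variable (V) in
/-- Left multiplication on `A ⊗_S V`, as an algebra homomorphism. -/
def lmulHom : A →ₐ[R] Module.End R (BalancedTensor R S A V) :=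
  AlgHom.ofLinearMap
    { toFun := lmul V S
      map_add' a a' := linearMap_ext fun b v => by
        simp only [LinearMap.add_apply, lmul_tmul, add_mul, add_tmul]
      map_smul' c a := linearMap_ext fun b v => by
        simp only [RingHom.id_apply, LinearMap.smul_apply, lmul_tmul]
        simp only [tmul, smul_mul_assoc, ← TensorProduct.smul_tmul', map_smul] }
    (linearMap_ext fun b v => by
      simp only [LinearMap.coe_mk, AddHom.coe_mk, lmul_tmul, one_mul, Module.End.one_apply])
    (fun a a' => linearMap_ext fun b v => by
      simp only [LinearMap.coe_mk, AddHom.coe_mk, lmul_tmul, mul_assoc, Module.End.mul_apply])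

instance moduleLeft : Module A (BalancedTensor R S A V) :=
  Module.compHom _ (lmulHom V S).toRingHom

variable {S}

@[simp]
theorem smul_tmul (a b : A) (v : V) : a • tmul R S b v = tmul R S (a * b) v := rfl

instance isScalarTowerLeft : IsScalarTower R A (BalancedTensor R S A V) where
  smul_assoc r a z := by
    change lmulHom V S (r • a) z = r • lmulHom V S a z
    rw [map_smul, LinearMap.smul_apply]

theorem tmul_eq_smul (a : A) (v : V) : tmul R S a v = a • tmul R S 1 v := by simp

theorem mapRight_smul [IsScalarTower R S V] {V' : Type*} [AddCommGroup V'] [Module R V']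
    [Module S V'] [IsScalarTower R S V'] (f : V →ₗ[S] V') (a : A)
    (z : BalancedTensor R S A V) :
    mapRight (R := R) A f (a • z) = a • mapRight (R := R) A f z := by
  induction z using induction_on with
  | zero => simp
  | tmul m n => simp
  | add x y hx hy => simp only [map_add, smul_add, hx, hy]

end ActionLeft

end BalancedTensor

/-! ### Consequences of faithful flatness -/

section FaithfullyFlat

variable {R S M : Type u} [CommRing R] [Ring S] [Algebra R S] [AddCommGroup M] [Module R M]
  [Module Sᵐᵒᵖ M]

theorem IsRightFaithfullyFlat.exact_iff (h : IsRightFaithfullyFlat R S M)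
    {X Y Z : Type u} [AddCommGroup X] [AddCommGroup Y] [AddCommGroup Z]
    [Module R X] [Module R Y] [Module R Z] [Module S X] [Module S Y] [Module S Z]
    [IsScalarTower R S X] [IsScalarTower R S Y] [IsScalarTower R S Z]
    (f : X →ₗ[S] Y) (g : Y →ₗ[S] Z) :
    Function.Exact f g ↔ Function.Exact (BalancedTensor.mapRight (R := R) M f)
      (BalancedTensor.mapRight (R := R) M g) :=
  h X Y Z f g

theorem IsRightFaithfullyFlat.mapRight_injective (h : IsRightFaithfullyFlat R S M)
    {X Y : Type u} [AddCommGroup X] [AddCommGroup Y] [Module R X] [Module R Y] [Module S X]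
    [Module S Y] [IsScalarTower R S X] [IsScalarTower R S Y] {f : X →ₗ[S] Y}
    (hf : Function.Injective f) : Function.Injective (BalancedTensor.mapRight (R := R) M f) := by
  have exact_zero : Function.Exact (0 : (PUnit : Type u) →ₗ[S] X) f := by
    intro x
    constructor
    · intro hx
      exact ⟨0, by rw [map_zero, hf (hx.trans (map_zero f).symm)]⟩
    · rintro ⟨y, rfl⟩
      simp
  have exact_mapRight := (h _ _ _ _ _).1 exact_zero
  refine (injective_iff_map_eq_zero _).2 fun z hz => ?_
  obtain ⟨y, rfl⟩ := (exact_mapRight z).1 hz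
  exact BalancedTensor.mapRight_zero_apply y

theorem IsRightFaithfullyFlat.eq_zero_of_one_tmul_eq_zero {A : Type u} [Ring A] [Algebra R A]
    {S : Subalgebra R A} (h : IsRightFaithfullyFlat R S A)
    {Y : Type u} [AddCommGroup Y] [Module R Y] [Module S Y] [IsScalarTower R S Y] {y : Y}
    (hy : BalancedTensor.tmul R S (1 : A) y = 0) : y = 0 := by
  let N : Submodule S Y := Submodule.span S {y}
  have eq_zero : ∀ z : BalancedTensor R S A N, z = 0 := by
    intro z
    apply h.mapRight_injective (f := N.subtype) Subtype.val_injective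
    rw [map_zero]
    induction z using BalancedTensor.induction_on with
    | zero => simp
    | tmul a n =>
      obtain ⟨n, hn⟩ := n
      obtain ⟨s, rfl⟩ := Submodule.mem_span_singleton.1 hn
      rw [BalancedTensor.mapRight_tmul, Submodule.subtype_apply, BalancedTensor.tmul_eq_smul,
        ← BalancedTensor.op_smul_tmul, op_smul_eq_mul, one_mul, BalancedTensor.tmul_eq_smul, hy,
        smul_zero, smul_zero]
    | add x y hx hy => simp only [map_add, hx, hy, add_zero]
  have exact_id : Function.Exact (LinearMap.id : N →ₗ[S] N) (LinearMap.id : N →ₗ[S] N) := by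
    refine (h _ _ _ _ _).2 fun z => ?_
    exact ⟨fun _ => ⟨0, by rw [eq_zero z, map_zero]⟩, fun _ => eq_zero _⟩
  exact congrArg Subtype.val
    ((exact_id ⟨y, Submodule.mem_span_singleton_self y⟩).2 ⟨_, rfl⟩)

theorem IsRightFaithfullyFlat.mem_of_one_tmul_eq_tmul_one {A : Type u} [Ring A] [Algebra R A]
    {S : Subalgebra R A} (h : IsRightFaithfullyFlat R S A) {a : A}
    (ha : BalancedTensor.tmul R S (1 : A) a = BalancedTensor.tmul R S a (1 : A)) : a ∈ S := by
  let N : Submodule S A := Submodule.span S {1}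
  have one_tmul_mkQ : BalancedTensor.tmul R S (1 : A) (N.mkQ a) = 0 := by
    have := congrArg (BalancedTensor.mapRight (R := R) A N.mkQ) ha
    rw [BalancedTensor.mapRight_tmul, BalancedTensor.mapRight_tmul] at this
    rw [this, show N.mkQ (1 : A) = 0 from
      (Submodule.Quotient.mk_eq_zero _).2 (Submodule.mem_span_singleton_self 1),
      BalancedTensor.tmul_zero]
  obtain ⟨s, rfl⟩ := Submodule.mem_span_singleton.1
    ((Submodule.Quotient.mk_eq_zero _).1 (h.eq_zero_of_one_tmul_eq_zero one_tmul_mkQ))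
  rw [Subalgebra.smul_def, smul_eq_mul, mul_one]
  exact s.2

end FaithfullyFlat

/-! ### Comparing exactness of sequences embedded in a common one -/

section Embeddings

variable {R : Type*} [CommRing R] {U₁ U₂ U₃ V₁ V₂ V₃ W₁ W₂ W₃ : Type*}
  [AddCommGroup U₁] [AddCommGroup U₂] [AddCommGroup U₃]
  [AddCommGroup V₁] [AddCommGroup V₂] [AddCommGroup V₃]
  [AddCommGroup W₁] [AddCommGroup W₂] [AddCommGroup W₃]
  [Module R U₁] [Module R U₂] [Module R U₃] [Module R V₁] [Module R V₂] [Module R V₃]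
  [Module R W₁] [Module R W₂] [Module R W₃]

theorem exact_of_range_eq {f : U₁ →ₗ[R] U₂} {g : U₂ →ₗ[R] U₃} {f' : V₁ →ₗ[R] V₂}
    {g' : V₂ →ₗ[R] V₃} {a : W₁ →ₗ[R] W₂} {b : W₂ →ₗ[R] W₃}
    {j₁ : U₁ →ₗ[R] W₁} {j₂ : U₂ →ₗ[R] W₂} {j₃ : U₃ →ₗ[R] W₃}
    {k₁ : V₁ →ₗ[R] W₁} {k₂ : V₂ →ₗ[R] W₂} {k₃ : V₃ →ₗ[R] W₃}
    (hj₂ : Function.Injective j₂) (hj₃ : Function.Injective j₃)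
    (hk₂ : Function.Injective k₂) (hk₃ : Function.Injective k₃)
    (h₁ : LinearMap.range j₁ = LinearMap.range k₁) (h₂ : LinearMap.range j₂ = LinearMap.range k₂)
    (hf : ∀ x, j₂ (f x) = a (j₁ x)) (hg : ∀ x, j₃ (g x) = b (j₂ x))
    (hf' : ∀ x, k₂ (f' x) = a (k₁ x)) (hg' : ∀ x, k₃ (g' x) = b (k₂ x))
    (h : Function.Exact f g) : Function.Exact f' g' := by
  intro y
  obtain ⟨x, hx⟩ : k₂ y ∈ LinearMap.range j₂ := h₂ ▸ ⟨y, rfl⟩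
  have e : g' y = 0 ↔ g x = 0 := by
    rw [← hk₃.eq_iff, ← hj₃.eq_iff, hg', hg, hx, map_zero, map_zero]
  rw [e, h x]
  constructor
  · rintro ⟨u, rfl⟩
    obtain ⟨v, hv⟩ : j₁ u ∈ LinearMap.range k₁ := h₁ ▸ ⟨u, rfl⟩
    exact ⟨v, hk₂ (by rw [hf', hv, ← hf, hx])⟩
  · rintro ⟨v, rfl⟩
    obtain ⟨u, hu⟩ : k₁ v ∈ LinearMap.range j₁ := h₁ ▸ ⟨v, rfl⟩
    exact ⟨u, hj₂ (by rw [hf, hu, ← hf', hx])⟩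

theorem exact_iff_of_range_eq {f : U₁ →ₗ[R] U₂} {g : U₂ →ₗ[R] U₃} {f' : V₁ →ₗ[R] V₂}
    {g' : V₂ →ₗ[R] V₃} (a : W₁ →ₗ[R] W₂) (b : W₂ →ₗ[R] W₃)
    {j₁ : U₁ →ₗ[R] W₁} {j₂ : U₂ →ₗ[R] W₂} {j₃ : U₃ →ₗ[R] W₃}
    {k₁ : V₁ →ₗ[R] W₁} {k₂ : V₂ →ₗ[R] W₂} {k₃ : V₃ →ₗ[R] W₃}
    (hj₂ : Function.Injective j₂) (hj₃ : Function.Injective j₃)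
    (hk₂ : Function.Injective k₂) (hk₃ : Function.Injective k₃)
    (h₁ : LinearMap.range j₁ = LinearMap.range k₁) (h₂ : LinearMap.range j₂ = LinearMap.range k₂)
    (hf : ∀ x, j₂ (f x) = a (j₁ x)) (hg : ∀ x, j₃ (g x) = b (j₂ x))
    (hf' : ∀ x, k₂ (f' x) = a (k₁ x)) (hg' : ∀ x, k₃ (g' x) = b (k₂ x)) :
    Function.Exact f g ↔ Function.Exact f' g' :=
  ⟨exact_of_range_eq hj₂ hj₃ hk₂ hk₃ h₁ h₂ hf hg hf' hg',
    exact_of_range_eq hk₂ hk₃ hj₂ hj₃ h₁.symm h₂.symm hf' hg' hf hg⟩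

end Embeddings

/-! ### Associativity of balanced tensor products with a module over the base -/

namespace BalancedTensor

variable {R A : Type*} [CommRing R] [Ring A] [Algebra R A] {S : Subalgebra R A} {M X : Type*}
  [AddCommGroup M] [Module R M] [Module Sᵐᵒᵖ M]
  [AddCommGroup X] [Module R X]

theorem smul_tmul_left (s : S) (a : A) (x : X) : s • (a ⊗ₜ[R] x) = (s • a) ⊗ₜ[R] x := rfl

variable (R S M X) in
/-- `M ⊗_S (A ⊗ X) → (M ⊗_S A) ⊗ X`. -/
def assocHom : BalancedTensor R S M (A ⊗[R] X) →ₗ[R] BalancedTensor R S M A ⊗[R] X :=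
  lift (LinearMap.rTensorHom X ∘ₗ (TensorProduct.mk R M A).compr₂ (balancedRel R S M A).mkQ) (by
    intro m s n
    induction n with
    | zero => simp
    | tmul n x =>
      simp only [LinearMap.comp_apply, LinearMap.coe_rTensorHom, smul_tmul_left,
        LinearMap.rTensor_tmul, LinearMap.compr₂_apply, TensorProduct.mk_apply, mkQ_tmul,
        op_smul_tmul]
    | add x y hx hy => simp only [map_add, smul_add, hx, hy])

@[simp]
theorem assocHom_tmul (m : M) (n : A) (x : X) :
    assocHom R S M X (tmul R S m (n ⊗ₜ x)) = tmul R S m n ⊗ₜ x := by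
  simp only [assocHom, lift_tmul]
  rfl

variable (R S M X) in
/-- `(M ⊗_S A) ⊗ X → M ⊗_S (A ⊗ X)`. -/
def assocInv : BalancedTensor R S M A ⊗[R] X →ₗ[R] BalancedTensor R S M (A ⊗[R] X) :=
  TensorProduct.lift (lift
    (LinearMap.mk₂ R (fun m n => mkRight R S (A ⊗[R] X) m ∘ₗ TensorProduct.mk R A X n)
      (fun m m' n => by ext x; simp [add_tmul])
      (fun c m n => by
        ext x
        simp only [LinearMap.comp_apply, mkRight_apply, LinearMap.smul_apply, tmul,
          ← TensorProduct.smul_tmul', map_smul])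
      (fun m n n' => by ext x; simp [tmul_add])
      (fun c m n => by ext x; simp))
    (by
      intro m s n
      ext x
      simp [op_smul_tmul, smul_tmul_left]))

@[simp]
theorem assocInv_tmul (m : M) (n : A) (x : X) :
    assocInv R S M X (tmul R S m n ⊗ₜ x) = tmul R S m (n ⊗ₜ x) := by
  simp [assocInv]

theorem assocInv_assocHom (z : BalancedTensor R S M (A ⊗[R] X)) :
    assocInv R S M X (assocHom R S M X z) = z := by
  induction z using induction_on with
  | zero => simp
  | tmul m n =>
    induction n with
    | zero => simp [tmul_zero]
    | tmul n x => simp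
    | add x y hx hy => simp only [tmul_add, map_add, hx, hy]
  | add x y hx hy => simp only [map_add, hx, hy]

theorem assocHom_assocInv (z : BalancedTensor R S M A ⊗[R] X) :
    assocHom R S M X (assocInv R S M X z) = z := by
  induction z with
  | zero => simp
  | tmul m x =>
    induction m using induction_on with
    | zero => simp
    | tmul m n => simp
    | add x y hx hy => simp only [TensorProduct.add_tmul, map_add, hx, hy]
  | add x y hx hy => simp only [map_add, hx, hy]

variable (R S M X) in
/-- `M ⊗_S (A ⊗ X) ≃ (M ⊗_S A) ⊗ X`. -/
def assocEquiv : BalancedTensor R S M (A ⊗[R] X) ≃ₗ[R] BalancedTensor R S M A ⊗[R] X :=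
  LinearEquiv.ofLinearMap (assocHom R S M X) (assocInv R S M X)
    (LinearMap.ext assocHom_assocInv) (LinearMap.ext assocInv_assocHom)

end BalancedTensor

/-! ### Cotensor products over Galois-type extensions -/

theorem canonicalMap_tmul {R A Q : Type*} [CommRing R] [Ring A] [Algebra R A]
    [AddCommGroup Q] [Module R Q] (d : A →ₗ[R] A ⊗[R] Q)
    (S : Subalgebra R A) (hd : ∀ s ∈ S, ∀ b, d (s * b) = s • d b) (a b : A) :
    canonicalMap d S hd (BalancedTensor.tmul R S a b) = a • d b := by
  simp [canonicalMap, BalancedTensor.tmul]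

section CotensorDiff

variable {R M N C : Type*} [CommRing R] [AddCommGroup M] [Module R M] [AddCommGroup N]
  [Module R N] [AddCommGroup C] [Module R C]

/-- The map `M ⊗ N → M ⊗ (C ⊗ N)` whose kernel is the cotensor product `M □_C N`. -/
def cotensorDiff (δ : M →ₗ[R] M ⊗[R] C) (ρ : N →ₗ[R] C ⊗[R] N) :
    M ⊗[R] N →ₗ[R] M ⊗[R] (C ⊗[R] N) :=
  (TensorProduct.assoc R M C N).toLinearMap ∘ₗ δ.rTensor N - ρ.lTensor M

theorem mem_cotensor_iff_cotensorDiff_eq_zero {δ : M →ₗ[R] M ⊗[R] C} {ρ : N →ₗ[R] C ⊗[R] N}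
    {z : M ⊗[R] N} : z ∈ cotensor δ ρ ↔ cotensorDiff δ ρ z = 0 :=
  sub_eq_zero.symm

theorem exact_cotensor_subtype (δ : M →ₗ[R] M ⊗[R] C) (ρ : N →ₗ[R] C ⊗[R] N) :
    Function.Exact (cotensor δ ρ).subtype (cotensorDiff δ ρ) := fun z => by
  rw [← mem_cotensor_iff_cotensorDiff_eq_zero, ← LinearMap.coe_range, Submodule.range_subtype,
    SetLike.mem_coe]

variable (A : Type*) [AddCommGroup A] [Module R A]

theorem lTensor_cotensor_subtype_injective [Module.Flat R A] (δ : M →ₗ[R] M ⊗[R] C)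
    (ρ : N →ₗ[R] C ⊗[R] N) : Function.Injective ((cotensor δ ρ).subtype.lTensor A) :=
  Module.Flat.lTensor_preserves_injective_linearMap _ Subtype.val_injective

theorem lTensor_cotensorMapRight (δ : M →ₗ[R] M ⊗[R] C) {N' : Type*} [AddCommGroup N']
    [Module R N'] {ρ : N →ₗ[R] C ⊗[R] N} {ρ' : N' →ₗ[R] C ⊗[R] N'} (f : N →ₗ[R] N')
    (hf : ρ' ∘ₗ f = f.lTensor C ∘ₗ ρ) (z : A ⊗[R] cotensor δ ρ) :
    (cotensor δ ρ').subtype.lTensor A ((cotensorMapRight δ f hf).lTensor A z) =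
      (f.lTensor M).lTensor A ((cotensor δ ρ).subtype.lTensor A z) := by
  rw [← LinearMap.lTensor_comp_apply, ← LinearMap.lTensor_comp_apply]
  rfl

end CotensorDiff

section Over

variable {R A Q X Y : Type*} [CommRing R] [Ring A] [Algebra R A]
  [AddCommGroup Q] [Module R Q] [AddCommGroup X] [Module R X] [AddCommGroup Y] [Module R Y]

/-- `A ⊗ f` as a map of modules over a subalgebra of `A`. -/
def lTensorOver (S : Subalgebra R A) (f : X →ₗ[R] Y) : A ⊗[R] X →ₗ[S] A ⊗[R] Y where
  toFun := f.lTensor A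
  map_add' := map_add _
  map_smul' s z := (TensorProduct.AlgebraTensorModule.lTensor A A f).map_smul (s : A) z

@[simp]
theorem lTensorOver_apply (S : Subalgebra R A) (f : X →ₗ[R] Y) (z : A ⊗[R] X) :
    lTensorOver S f z = f.lTensor A z := rfl

theorem rTensor_smul_of_mem {S : Subalgebra R A} {d : A →ₗ[R] A ⊗[R] Q}
    (hd : ∀ s ∈ S, ∀ b, d (s * b) = s • d b) (s : S) (z : A ⊗[R] X) :
    d.rTensor X (s • z) = (s : A) • d.rTensor X z := by
  induction z with
  | zero => simp
  | tmul a x =>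
    rw [BalancedTensor.smul_tmul_left, LinearMap.rTensor_tmul, LinearMap.rTensor_tmul,
      Subalgebra.smul_def, smul_eq_mul, hd s s.2, TensorProduct.smul_tmul']
  | add x y hx hy => simp only [smul_add, map_add, hx, hy]

variable (X) in
/-- `d ⊗ X`, for `d : A → A ⊗ Q` linear over a subalgebra of `A`, as a linear map over it. -/
def rTensorOver {S : Subalgebra R A} {d : A →ₗ[R] A ⊗[R] Q}
    (hd : ∀ s ∈ S, ∀ b, d (s * b) = s • d b) : A ⊗[R] X →ₗ[S] A ⊗[R] (Q ⊗[R] X) where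
  toFun z := TensorProduct.assoc R A Q X (d.rTensor X z)
  map_add' x y := by rw [map_add, map_add]
  map_smul' s z := by
    rw [rTensor_smul_of_mem hd]
    exact (TensorProduct.AlgebraTensorModule.assoc R R A A Q X).map_smul (s : A) _

@[simp]
theorem rTensorOver_apply {S : Subalgebra R A} {d : A →ₗ[R] A ⊗[R] Q}
    (hd : ∀ s ∈ S, ∀ b, d (s * b) = s • d b) (z : A ⊗[R] X) :
    rTensorOver X hd z = TensorProduct.assoc R A Q X (d.rTensor X z) := rfl

variable {S : Subalgebra R A} {d : A →ₗ[R] A ⊗[R] Q} (hd : ∀ s ∈ S, ∀ b, d (s * b) = s • d b)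

/-- The map `cotensorDiff d ρ` as a map of modules over the subalgebra `S`. -/
def cotensorDiffOver (ρ : X →ₗ[R] Q ⊗[R] X) : A ⊗[R] X →ₗ[S] A ⊗[R] (Q ⊗[R] X) :=
  rTensorOver X hd - lTensorOver S ρ

theorem cotensorDiffOver_apply (ρ : X →ₗ[R] Q ⊗[R] X) (z : A ⊗[R] X) :
    cotensorDiffOver hd ρ z = cotensorDiff d ρ z := rfl

/-- The cotensor product `A □_Q X` as a module over the subalgebra `S`. -/
def cotensorOver (ρ : X →ₗ[R] Q ⊗[R] X) : Submodule S (A ⊗[R] X) where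
  __ := cotensor d ρ
  smul_mem' s z hz := by
    change s • z ∈ cotensor d ρ
    replace hz : cotensorDiff d ρ z = 0 := mem_cotensor_iff_cotensorDiff_eq_zero.1 hz
    rw [mem_cotensor_iff_cotensorDiff_eq_zero, ← cotensorDiffOver_apply hd, map_smul,
      cotensorDiffOver_apply, hz, smul_zero]

/-- The map `A □_Q f` as a map of modules over the subalgebra `S`. -/
def cotensorMapOver {ρX : X →ₗ[R] Q ⊗[R] X} {ρY : Y →ₗ[R] Q ⊗[R] Y} (f : X →ₗ[R] Y)
    (hf : ρY ∘ₗ f = f.lTensor Q ∘ₗ ρX) : cotensorOver hd ρX →ₗ[S] cotensorOver hd ρY :=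
  (lTensorOver S f).restrict fun z hz => (cotensorMapRight d f hf ⟨z, hz⟩).2

theorem exact_cotensorOver_subtype (ρ : X →ₗ[R] Q ⊗[R] X) :
    Function.Exact (cotensorOver hd ρ).subtype (cotensorDiffOver hd ρ) :=
  exact_cotensor_subtype d ρ

end Over

section CanTensor

variable {R A Q C : Type*} [CommRing R] [Ring A] [Algebra R A]
  [AddCommGroup Q] [Module R Q] [AddCommGroup C] [Module R C]
  {S : Subalgebra R A} {d : A →ₗ[R] A ⊗[R] C} (hd : ∀ s ∈ S, ∀ b, d (s * b) = s • d b)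
  {X Y : Type*} [AddCommGroup X] [Module R X] [AddCommGroup Y] [Module R Y]

variable (X) in
/-- `A ⊗_S (A ⊗ X) → A ⊗ (C ⊗ X)`, `a ⊗ b ⊗ x ↦ a d(b) ⊗ x`. -/
def canTensor : BalancedTensor R S A (A ⊗[R] X) →ₗ[R] A ⊗[R] (C ⊗[R] X) :=
  (TensorProduct.assoc R A C X).toLinearMap ∘ₗ (canonicalMap d S hd).rTensor X ∘ₗ
    BalancedTensor.assocHom R S A X

theorem canTensor_tmul (a b : A) (x : X) :
    canTensor hd X (BalancedTensor.tmul R S a (b ⊗ₜ x)) =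
      TensorProduct.assoc R A C X ((a • d b) ⊗ₜ x) := by
  simp only [canTensor, LinearMap.comp_apply, BalancedTensor.assocHom_tmul,
    LinearMap.rTensor_tmul, canonicalMap_tmul, LinearEquiv.coe_coe]

theorem canTensor_bijective (h : Function.Bijective (canonicalMap d S hd)) :
    Function.Bijective (canTensor hd X) :=
  ((BalancedTensor.assocEquiv R S A X).trans
    ((LinearEquiv.rTensor X (LinearEquiv.ofBijective _ h)).trans
      (TensorProduct.assoc R A C X))).bijective

theorem canTensor_mapRight_lTensorOver (f : X →ₗ[R] Y) (z : BalancedTensor R S A (A ⊗[R] X)) :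
    canTensor hd Y (BalancedTensor.mapRight (R := R) A (lTensorOver S f) z) =
      (f.lTensor C).lTensor A (canTensor hd X z) := by
  induction z using BalancedTensor.induction_on with
  | zero => simp
  | add x y hx hy => simp only [map_add, hx, hy]
  | tmul a n =>
    induction n with
    | zero => simp [BalancedTensor.tmul_zero]
    | add x y hx hy => simp only [map_add, BalancedTensor.tmul_add] at hx hy ⊢; rw [hx, hy]
    | tmul b x =>
      rw [BalancedTensor.mapRight_tmul, lTensorOver_apply, LinearMap.lTensor_tmul,
        canTensor_tmul, canTensor_tmul]
      generalize a • d b = y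
      induction y with
      | zero => simp
      | add x y hx hy => simp only [map_add, TensorProduct.add_tmul, hx, hy]
      | tmul a c => simp

theorem canTensor_tmul_assoc (a : A) (y : A ⊗[R] Q) (x : X) :
    canTensor hd (Q ⊗[R] X) (BalancedTensor.tmul R S a (TensorProduct.assoc R A Q X (y ⊗ₜ x))) =
      a • (TensorProduct.assoc R C Q X).toLinearMap.lTensor A
        (TensorProduct.assoc R A (C ⊗[R] Q) X
          (TensorProduct.assoc R A C Q (d.rTensor Q y) ⊗ₜ x)) := by
  induction y with
  | zero => simp [BalancedTensor.tmul_zero]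
  | add y z hy hz =>
    simp only [TensorProduct.add_tmul, map_add, BalancedTensor.tmul_add, smul_add, hy, hz]
  | tmul b q =>
    rw [TensorProduct.assoc_tmul, canTensor_tmul, LinearMap.rTensor_tmul]
    generalize d b = w
    induction w with
    | zero => simp
    | add y z hy hz => simp only [TensorProduct.add_tmul, map_add, smul_add, hy, hz]
    | tmul b' c => simp [TensorProduct.smul_tmul']

variable {δQ : A →ₗ[R] A ⊗[R] Q} (hδQ : ∀ s ∈ S, ∀ b, δQ (s * b) = s • δQ b)
  {ρC : C →ₗ[R] C ⊗[R] Q}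
  (hρ : (TensorProduct.assoc R A C Q).toLinearMap ∘ₗ d.rTensor Q ∘ₗ δQ = ρC.lTensor A ∘ₗ d)

include hρ

theorem canTensor_mapRight_rTensorOver (z : BalancedTensor R S A (A ⊗[R] X)) :
    canTensor hd (Q ⊗[R] X) (BalancedTensor.mapRight (R := R) A (rTensorOver X hδQ) z) =
      ((TensorProduct.assoc R C Q X).toLinearMap ∘ₗ ρC.rTensor X).lTensor A
        (canTensor hd X z) := by
  induction z using BalancedTensor.induction_on with
  | zero => simp
  | add x y hx hy => simp only [map_add, hx, hy]
  | tmul a n =>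
    induction n with
    | zero => simp [BalancedTensor.tmul_zero]
    | add x y hx hy => simp only [map_add, BalancedTensor.tmul_add] at hx hy ⊢; rw [hx, hy]
    | tmul b x =>
      have hb : TensorProduct.assoc R A C Q (d.rTensor Q (δQ b)) = ρC.lTensor A (d b) :=
        LinearMap.congr_fun hρ b
      rw [BalancedTensor.mapRight_tmul, rTensorOver_apply, LinearMap.rTensor_tmul,
        canTensor_tmul_assoc, hb, canTensor_tmul]
      generalize d b = w
      induction w with
      | zero => simp
      | add y z hy hz => simp only [TensorProduct.add_tmul, map_add, smul_add, hy, hz]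
      | tmul b' c =>
        simp only [LinearMap.lTensor_tmul, TensorProduct.assoc_tmul, TensorProduct.smul_tmul',
          LinearMap.comp_apply, LinearMap.rTensor_tmul]

theorem canTensor_cotensorDiffOver (ρ : X →ₗ[R] Q ⊗[R] X)
    (z : BalancedTensor R S A (A ⊗[R] X)) :
    canTensor hd (Q ⊗[R] X) (BalancedTensor.mapRight (R := R) A (cotensorDiffOver hδQ ρ) z) =
      (cotensorDiff ρC ρ).lTensor A (canTensor hd X z) := by
  rw [cotensorDiffOver, BalancedTensor.mapRight_sub_apply, map_sub,
    canTensor_mapRight_rTensorOver hd hδQ hρ, canTensor_mapRight_lTensorOver, cotensorDiff,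
    LinearMap.lTensor_sub, LinearMap.sub_apply]

end CanTensor

section CotensorGalois

variable {R A Q C : Type u} [CommRing R] [Ring A] [Algebra R A]
  [AddCommGroup Q] [Module R Q] [AddCommGroup C] [Module R C]
  {S : Subalgebra R A} {d : A →ₗ[R] A ⊗[R] C} (hd : ∀ s ∈ S, ∀ b, d (s * b) = s • d b)
  {δQ : A →ₗ[R] A ⊗[R] Q} (hδQ : ∀ s ∈ S, ∀ b, δQ (s * b) = s • δQ b)
  {ρC : C →ₗ[R] C ⊗[R] Q}
  (hρ : (TensorProduct.assoc R A C Q).toLinearMap ∘ₗ d.rTensor Q ∘ₗ δQ = ρC.lTensor A ∘ₗ d)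
  {X Y Z : Type u} [AddCommGroup X] [Module R X] [AddCommGroup Y] [Module R Y]
  [AddCommGroup Z] [Module R Z]

/-- The embedding of `A ⊗_S (A □_Q X)` into `A ⊗ (C ⊗ X)`. -/
def cotensorEmb (ρ : X →ₗ[R] Q ⊗[R] X) :
    BalancedTensor R S A (cotensorOver hδQ ρ) →ₗ[R] A ⊗[R] (C ⊗[R] X) :=
  canTensor hd X ∘ₗ BalancedTensor.mapRight (R := R) A (cotensorOver hδQ ρ).subtype

theorem cotensorEmb_injective (hS : IsRightFaithfullyFlat R S A)
    (h : Function.Bijective (canonicalMap d S hd)) (ρ : X →ₗ[R] Q ⊗[R] X) :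
    Function.Injective (cotensorEmb hd hδQ ρ) :=
  (canTensor_bijective hd h).1.comp (hS.mapRight_injective Subtype.val_injective)

theorem cotensorEmb_mapRight {ρX : X →ₗ[R] Q ⊗[R] X} {ρY : Y →ₗ[R] Q ⊗[R] Y} (f : X →ₗ[R] Y)
    (hf : ρY ∘ₗ f = f.lTensor Q ∘ₗ ρX) (z : BalancedTensor R S A (cotensorOver hδQ ρX)) :
    cotensorEmb hd hδQ ρY (BalancedTensor.mapRight (R := R) A (cotensorMapOver hδQ f hf) z) =
      (f.lTensor C).lTensor A (cotensorEmb hd hδQ ρX z) := by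
  refine Eq.trans ?_ (canTensor_mapRight_lTensorOver hd f _)
  rw [← BalancedTensor.mapRight_comp_apply, cotensorEmb, LinearMap.comp_apply,
    ← BalancedTensor.mapRight_comp_apply]
  rfl

theorem canTensor_mem_range_cotensorEmb (hS : IsRightFaithfullyFlat R S A)
    (h : Function.Bijective (canonicalMap d S hd)) (ρ : X →ₗ[R] Q ⊗[R] X)
    (z : BalancedTensor R S A (A ⊗[R] X)) :
    canTensor hd X z ∈ LinearMap.range (cotensorEmb hd hδQ ρ) ↔
      BalancedTensor.mapRight (R := R) A (cotensorDiffOver hδQ ρ) z = 0 := by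
  have hexact := (hS.exact_iff (X := cotensorOver hδQ ρ) (cotensorOver hδQ ρ).subtype
    (cotensorDiffOver hδQ ρ)).1 (exact_cotensorOver_subtype hδQ ρ)
  refine Iff.trans ?_ (hexact z).symm
  exact exists_congr fun y => (canTensor_bijective hd h).1.eq_iff

include hρ in
theorem range_cotensorEmb [Module.Flat R A] (hS : IsRightFaithfullyFlat R S A)
    (h : Function.Bijective (canonicalMap d S hd)) (ρ : X →ₗ[R] Q ⊗[R] X) :
    LinearMap.range (cotensorEmb hd hδQ ρ) =
      LinearMap.range ((cotensor ρC ρ).subtype.lTensor A) := by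
  have hexact := Module.Flat.lTensor_exact A (exact_cotensor_subtype ρC ρ)
  ext w
  obtain ⟨z, rfl⟩ := (canTensor_bijective hd h).2 w
  rw [canTensor_mem_range_cotensorEmb hd hδQ hS h]
  refine Iff.trans ?_ (hexact _)
  rw [← canTensor_cotensorDiffOver hd hδQ hρ, ← (canTensor_bijective hd h).1.eq_iff, map_zero]

include hd hδQ hρ in
theorem cotensor_exact_iff [Module.FaithfullyFlat R A] (hS : IsRightFaithfullyFlat R S A)
    (h : Function.Bijective (canonicalMap d S hd))
    {ρX : X →ₗ[R] Q ⊗[R] X} {ρY : Y →ₗ[R] Q ⊗[R] Y} {ρZ : Z →ₗ[R] Q ⊗[R] Z}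
    (f : X →ₗ[R] Y) (g : Y →ₗ[R] Z)
    (hf : ρY ∘ₗ f = f.lTensor Q ∘ₗ ρX) (hg : ρZ ∘ₗ g = g.lTensor Q ∘ₗ ρY) :
    Function.Exact (cotensorMapRight δQ f hf) (cotensorMapRight δQ g hg) ↔
      Function.Exact (cotensorMapRight ρC f hf) (cotensorMapRight ρC g hg) := by
  have hOver : Function.Exact (cotensorMapRight δQ f hf) (cotensorMapRight δQ g hg) ↔
      Function.Exact (cotensorMapOver hδQ f hf) (cotensorMapOver hδQ g hg) := Iff.rfl
  have hBalanced := hS.exact_iff (X := cotensorOver hδQ ρX) (Y := cotensorOver hδQ ρY)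
    (Z := cotensorOver hδQ ρZ) (cotensorMapOver hδQ f hf) (cotensorMapOver hδQ g hg)
  have hFlat := Module.FaithfullyFlat.lTensor_exact_iff_exact R A
    (cotensorMapRight ρC f hf) (cotensorMapRight ρC g hg)
  rw [hOver, hBalanced, ← hFlat]
  exact exact_iff_of_range_eq ((f.lTensor C).lTensor A) ((g.lTensor C).lTensor A)
    (cotensorEmb_injective hd hδQ hS h ρY) (cotensorEmb_injective hd hδQ hS h ρZ)
    (lTensor_cotensor_subtype_injective A ρC ρY) (lTensor_cotensor_subtype_injective A ρC ρZ)
    (range_cotensorEmb hd hδQ hρ hS h ρX) (range_cotensorEmb hd hδQ hρ hS h ρY)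
    (cotensorEmb_mapRight hd hδQ f hf) (cotensorEmb_mapRight hd hδQ g hg)
    (lTensor_cotensorMapRight A ρC f hf) (lTensor_cotensorMapRight A ρC g hg)

end CotensorGalois

/-! ### Twisted coactions -/

section Twist

variable {R X Y C C' M M' : Type*} [CommRing R] [AddCommGroup X] [Module R X] [AddCommGroup Y]
  [Module R Y] [AddCommGroup C] [Module R C] [AddCommGroup C'] [Module R C'] [AddCommGroup M]
  [Module R M] [AddCommGroup M'] [Module R M']

variable (X) in
/-- The flip `x ⊗ m ↦ w(m) ⊗ x`, exchanging the two sides on which a coalgebra coacts. -/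
def flipMap (w : M →ₗ[R] M') : X ⊗[R] M →ₗ[R] M' ⊗[R] X :=
  (TensorProduct.comm R X M').toLinearMap ∘ₗ w.lTensor X

@[simp]
theorem flipMap_tmul (w : M →ₗ[R] M') (x : X) (m : M) : flipMap X w (x ⊗ₜ m) = w m ⊗ₜ x := rfl

theorem lTensor_flipMap (w : M →ₗ[R] M') (f : X →ₗ[R] Y) (z : X ⊗[R] M) :
    f.lTensor M' (flipMap X w z) = flipMap Y w (f.rTensor M z) := by
  induction z with
  | zero => simp
  | add x y hx hy => simp only [map_add, hx, hy]
  | tmul x m => simp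

variable (X) in
/-- `flipMap` for an isomorphism. -/
def flipEquiv (w : M ≃ₗ[R] M') : X ⊗[R] M ≃ₗ[R] M' ⊗[R] X :=
  w.lTensor X ≪≫ₗ TensorProduct.comm R X M'

theorem flipMap_injective (w : M ≃ₗ[R] M') : Function.Injective (flipMap X w.toLinearMap) :=
  (flipEquiv X w).injective

variable (X) in
/-- The reversal `x ⊗ (c ⊗ m) ↦ w(m) ⊗ (σ(c) ⊗ x)` of a threefold tensor product. -/
def reverseMap (σ : C →ₗ[R] C') (w : M →ₗ[R] M') :
    X ⊗[R] (C ⊗[R] M) →ₗ[R] M' ⊗[R] (C' ⊗[R] X) :=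
  (flipMap X σ).lTensor M' ∘ₗ flipMap (X ⊗[R] C) w ∘ₗ
    (TensorProduct.assoc R X C M).symm.toLinearMap

@[simp]
theorem reverseMap_tmul (σ : C →ₗ[R] C') (w : M →ₗ[R] M') (x : X) (c : C) (m : M) :
    reverseMap X σ w (x ⊗ₜ (c ⊗ₜ m)) = w m ⊗ₜ (σ c ⊗ₜ x) := rfl

theorem reverseMap_injective (e : C ≃ₗ[R] C') (w : M ≃ₗ[R] M') :
    Function.Injective (reverseMap X e.toLinearMap w.toLinearMap) :=
  ((TensorProduct.assoc R X C M).symm ≪≫ₗ flipEquiv (X ⊗[R] C) w ≪≫ₗ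
    (flipEquiv X e).lTensor M').injective

/-- The left coaction `x ↦ σ(x₍₁₎) ⊗ x₍₀₎` obtained from a right coaction `d`. -/
def twist (σ : C →ₗ[R] C') (d : X →ₗ[R] X ⊗[R] C) : X →ₗ[R] C' ⊗[R] X :=
  flipMap X σ ∘ₗ d

theorem twist_apply (σ : C →ₗ[R] C') (d : X →ₗ[R] X ⊗[R] C) (x : X) :
    twist σ d x = flipMap X σ (d x) := rfl

theorem assoc_rTensor_flipMap {σ : C →ₗ[R] C'} {w : M →ₗ[R] M'} {r : M →ₗ[R] C ⊗[R] M}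
    {d' : M' →ₗ[R] M' ⊗[R] C'}
    (hw : ∀ m, d' (w m) = TensorProduct.comm R C' M' (TensorProduct.map σ w (r m)))
    (z : X ⊗[R] M) :
    TensorProduct.assoc R M' C' X (d'.rTensor X (flipMap X w z)) =
      reverseMap X σ w (r.lTensor X z) := by
  induction z with
  | zero => simp
  | add x y hx hy => simp only [map_add, hx, hy]
  | tmul x m =>
    simp only [flipMap_tmul, LinearMap.rTensor_tmul, LinearMap.lTensor_tmul, hw]
    generalize r m = y
    induction y with
    | zero => simp
    | add x y hx hy => simp only [map_add, TensorProduct.add_tmul, TensorProduct.tmul_add, hx, hy]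
    | tmul a b => simp

theorem lTensor_twist_flipMap (σ : C →ₗ[R] C') (w : M →ₗ[R] M') (d : X →ₗ[R] X ⊗[R] C)
    (z : X ⊗[R] M) :
    (twist σ d).lTensor M' (flipMap X w z) =
      reverseMap X σ w (TensorProduct.assoc R X C M (d.rTensor M z)) := by
  induction z with
  | zero => simp
  | add x y hx hy => simp only [map_add, hx, hy]
  | tmul x m => simp [twist_apply, reverseMap]

end Twist

section AntiCoalgHom

variable {R C C' X : Type*} [CommRing R] [AddCommGroup C] [Module R C] [Coalgebra R C]
  [AddCommGroup C'] [Module R C'] [Coalgebra R C'] [AddCommGroup X] [Module R X]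

/-- `σ` is an anti-homomorphism of coalgebras. -/
structure IsAntiCoalgHom (σ : C →ₗ[R] C') : Prop where
  counit : ∀ c, Coalgebra.counit (R := R) (σ c) = Coalgebra.counit c
  comul : ∀ c, Coalgebra.comul (R := R) (σ c) =
    TensorProduct.comm R C' C' (TensorProduct.map σ σ (Coalgebra.comul c))

theorem IsAntiCoalgHom.symm {e : C ≃ₗ[R] C'} (he : IsAntiCoalgHom e.toLinearMap) :
    IsAntiCoalgHom e.symm.toLinearMap where
  counit c := by
    rw [← he.counit, LinearEquiv.coe_coe, LinearEquiv.coe_coe, e.apply_symm_apply]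
  comul c := by
    have hc := he.comul (e.symm c)
    rw [LinearEquiv.coe_coe, e.apply_symm_apply] at hc
    rw [hc, LinearEquiv.coe_coe]
    generalize Coalgebra.comul (R := R) (e.symm c) = y
    induction y with
    | zero => simp
    | add x y hx hy => simp only [map_add, ← hx, ← hy]
    | tmul a b => simp

theorem IsRightCoaction.rTensor_apply {d : X →ₗ[R] X ⊗[R] C} (hd : IsRightCoaction d) (x : X) :
    d.rTensor C (d x) =
      (TensorProduct.assoc R X C C).symm ((Coalgebra.comul (R := R)).lTensor X (d x)) := by
  rw [LinearEquiv.eq_symm_apply]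
  exact LinearMap.congr_fun hd.coassoc x

theorem IsRightCoaction.lTensor_counit_apply {d : X →ₗ[R] X ⊗[R] C} (hd : IsRightCoaction d)
    (x : X) : (Coalgebra.counit (R := R)).lTensor X (d x) = x ⊗ₜ 1 :=
  LinearMap.congr_fun hd.counit x

theorem IsAntiCoalgHom.rTensor_counit_flipMap {σ : C →ₗ[R] C'} (hσ : IsAntiCoalgHom σ)
    (y : X ⊗[R] C) :
    (Coalgebra.counit (R := R)).rTensor X (flipMap X σ y) =
      TensorProduct.comm R X R ((Coalgebra.counit (R := R)).lTensor X y) := by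
  induction y with
  | zero => simp
  | add x y hx hy => simp only [map_add, hx, hy]
  | tmul x c => simp [hσ.counit]

theorem IsRightCoaction.isLeftCoaction_twist {σ : C →ₗ[R] C'} (hσ : IsAntiCoalgHom σ)
    {d : X →ₗ[R] X ⊗[R] C} (hd : IsRightCoaction d) : IsLeftCoaction (twist σ d) where
  coassoc := LinearMap.ext fun x => by
    simp only [LinearMap.comp_apply, twist_apply, LinearEquiv.coe_coe,
      assoc_rTensor_flipMap hσ.comul, lTensor_twist_flipMap]
    exact congrArg _ (LinearMap.congr_fun hd.coassoc x).symm
  counit := LinearMap.ext fun x => by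
    simp only [LinearMap.comp_apply, twist_apply, hσ.rTensor_counit_flipMap,
      hd.lTensor_counit_apply]
    rfl

theorem isLeftCoaction_twist_iff {e : C ≃ₗ[R] C'} (he : IsAntiCoalgHom e.toLinearMap)
    {d : X →ₗ[R] X ⊗[R] C} : IsLeftCoaction (twist e.toLinearMap d) ↔ IsRightCoaction d := by
  refine ⟨fun h => ⟨LinearMap.ext fun x => ?_, LinearMap.ext fun x => ?_⟩,
    fun hd => hd.isLeftCoaction_twist he⟩
  · have hx := LinearMap.congr_fun h.coassoc x
    simp only [LinearMap.comp_apply, twist_apply, LinearEquiv.coe_coe,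
      assoc_rTensor_flipMap he.comul, lTensor_twist_flipMap] at hx
    exact (reverseMap_injective e e hx).symm
  · have hx := LinearMap.congr_fun h.counit x
    simp only [LinearMap.comp_apply, twist_apply, he.rTensor_counit_flipMap] at hx
    exact (TensorProduct.comm R X R).injective hx

end AntiCoalgHom

/-- `σ` behaves like the inverse of the antipode of a Hopf algebra. -/
structure IsSkewAntipode {R H : Type*} [CommRing R] [Ring H] [Bialgebra R H]
    (σ : H →ₗ[R] H) : Prop extends IsAntiCoalgHom σ where
  map_one : σ 1 = 1
  map_mul : ∀ g h, σ (g * h) = σ h * σ g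
  mul_rTensor_comm : ∀ h, LinearMap.mul' R H (σ.rTensor H
    (TensorProduct.comm R H H (Coalgebra.comul h))) = algebraMap R H (Coalgebra.counit h)
  mul_lTensor_comm : ∀ h, LinearMap.mul' R H (σ.lTensor H
    (TensorProduct.comm R H H (Coalgebra.comul h))) = algebraMap R H (Coalgebra.counit h)

section SkewAntipode

variable {R H A : Type*} [CommRing R] [Ring H] [Bialgebra R H] [Ring A] [Algebra R A]
  {σ : H →ₗ[R] H} {δ : A →ₐ[R] A ⊗[R] H}

theorem twist_toLinearMap_apply (σ : H →ₗ[R] H) (δ : A →ₐ[R] A ⊗[R] H) (a : A) :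
    twist σ δ.toLinearMap a = TensorProduct.comm R A H (σ.lTensor A (δ a)) := rfl

theorem twist_mul_coaction (hσ : IsSkewAntipode σ) (hδ : IsRightCoaction δ.toLinearMap)
    {F : H ⊗[R] A →ₗ[R] A ⊗[R] H} (hF : ∀ h a, F (h ⊗ₜ a) = (1 ⊗ₜ h) * δ a) (a : A) :
    F (twist σ δ.toLinearMap a) = a ⊗ₜ 1 := by
  let contract : (A ⊗[R] H) ⊗[R] H →ₗ[R] A ⊗[R] H :=
    (LinearMap.mul' R H ∘ₗ σ.rTensor H ∘ₗ (TensorProduct.comm R H H).toLinearMap).lTensor A ∘ₗ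
      (TensorProduct.assoc R A H H).toLinearMap
  have F_eq_contract : ∀ x : A ⊗[R] H, F (TensorProduct.comm R A H (σ.lTensor A x)) =
      contract (δ.toLinearMap.rTensor H x) := by
    intro x
    induction x with
    | zero => simp
    | add x y hx hy => simp only [map_add, hx, hy]
    | tmul a h =>
      rw [LinearMap.lTensor_tmul, TensorProduct.comm_tmul, hF, LinearMap.rTensor_tmul,
        AlgHom.toLinearMap_apply]
      generalize δ a = y
      induction y with
      | zero => simp
      | add x y hx hy => simp only [map_add, mul_add, TensorProduct.add_tmul, hx, hy]
      | tmul b k => simp [contract]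
  have contract_comul : ∀ x : A ⊗[R] H, contract ((TensorProduct.assoc R A H H).symm
      ((Coalgebra.comul (R := R)).lTensor A x)) =
      (Algebra.linearMap R H).lTensor A ((Coalgebra.counit (R := R)).lTensor A x) := by
    intro x
    induction x with
    | zero => simp
    | add x y hx hy => simp only [map_add, hx, hy]
    | tmul a h => simp [contract, hσ.mul_rTensor_comm]
  rw [twist_toLinearMap_apply, F_eq_contract, ← AlgHom.toLinearMap_apply, hδ.rTensor_apply,
    contract_comul, hδ.lTensor_counit_apply]
  simp

theorem coaction_mul_twist (hσ : IsSkewAntipode σ) (hδ : IsRightCoaction δ.toLinearMap)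
    {F : A ⊗[R] H →ₗ[R] H ⊗[R] A}
    (hF : ∀ a h, F (a ⊗ₜ h) = (h ⊗ₜ 1) * twist σ δ.toLinearMap a) (b : A) :
    F (δ b) = 1 ⊗ₜ b := by
  let contract : (A ⊗[R] H) ⊗[R] H →ₗ[R] H ⊗[R] A :=
    (TensorProduct.comm R A H).toLinearMap ∘ₗ
    (LinearMap.mul' R H ∘ₗ σ.lTensor H ∘ₗ (TensorProduct.comm R H H).toLinearMap).lTensor A ∘ₗ
      (TensorProduct.assoc R A H H).toLinearMap
  have F_eq_contract : ∀ x : A ⊗[R] H, F x = contract (δ.toLinearMap.rTensor H x) := by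
    intro x
    induction x with
    | zero => simp
    | add x y hx hy => simp only [map_add, hx, hy]
    | tmul a h =>
      rw [hF, LinearMap.rTensor_tmul, AlgHom.toLinearMap_apply, twist_toLinearMap_apply]
      generalize δ a = y
      induction y with
      | zero => simp
      | add x y hx hy => simp only [map_add, mul_add, TensorProduct.add_tmul, hx, hy]
      | tmul b k => simp [contract]
  have contract_comul : ∀ x : A ⊗[R] H, contract ((TensorProduct.assoc R A H H).symm
      ((Coalgebra.comul (R := R)).lTensor A x)) = TensorProduct.comm R A H
      ((Algebra.linearMap R H).lTensor A ((Coalgebra.counit (R := R)).lTensor A x)) := by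
    intro x
    induction x with
    | zero => simp
    | add x y hx hy => simp only [map_add, hx, hy]
    | tmul a h => simp [contract, hσ.mul_lTensor_comm]
  rw [F_eq_contract, ← AlgHom.toLinearMap_apply, hδ.rTensor_apply,
    contract_comul, hδ.lTensor_counit_apply]
  simp

theorem twist_of_mem_coinvariants (hσ : IsSkewAntipode σ) {b : A} (hb : b ∈ coinvariants δ) :
    twist σ δ.toLinearMap b = 1 ⊗ₜ b := by
  have hb' : δ b = b ⊗ₜ[R] 1 := hb
  rw [twist_toLinearMap_apply, hb']
  simp [hσ.map_one]

end SkewAntipode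

/-! ### Diagonal actions -/

section Diagonal

variable {R H A : Type*} [CommRing R] [Ring H] [Bialgebra R H] [Ring A] [Algebra R A]
  {X M : Type*} [AddCommGroup X] [Module R X] [AddCommGroup M] [Module R M]

/-- A right action of `H` on `X`. -/
structure IsRightAction (r : H →ₗ[R] Module.End R X) : Prop where
  map_one : r 1 = 1
  map_mul : ∀ g h, r (g * h) = r h * r g

/-- The action of `H ⊗ A` on `X ⊗ M`. -/
def tensorAct (r : H →ₗ[R] Module.End R X) (α : A →ₐ[R] Module.End R M) :
    H ⊗[R] A →ₗ[R] Module.End R (X ⊗[R] M) :=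
  TensorProduct.homTensorHomMap (RingHom.id R) X M X M ∘ₗ TensorProduct.map r α.toLinearMap

@[simp]
theorem tensorAct_tmul_tmul (r : H →ₗ[R] Module.End R X) (α : A →ₐ[R] Module.End R M)
    (h : H) (a : A) (x : X) (m : M) :
    tensorAct r α (h ⊗ₜ a) (x ⊗ₜ m) = r h x ⊗ₜ α a m := rfl

variable {σ : H →ₗ[R] H} (hσ : IsSkewAntipode σ) (δ : A →ₐ[R] A ⊗[R] H)
  {r : H →ₗ[R] Module.End R X} (hr : IsRightAction r) (α : A →ₐ[R] Module.End R M)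

include hσ hr in
theorem tensorAct_twist_mul (a b : A) : tensorAct r α (twist σ δ.toLinearMap (a * b)) =
    tensorAct r α (twist σ δ.toLinearMap a) * tensorAct r α (twist σ δ.toLinearMap b) := by
  simp only [twist_toLinearMap_apply, map_mul]
  generalize δ a = x
  generalize δ b = y
  induction x with
  | zero => simp
  | add x x' hx hx' => simp only [add_mul, map_add, hx, hx']
  | tmul a h =>
    induction y with
    | zero => simp
    | add y y' hy hy' => simp only [mul_add, map_add, hy, hy']
    | tmul b k =>
      apply TensorProduct.ext'
      intro x m
      simp [hσ.map_mul, hr.map_mul]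

/-- The diagonal action of `A` on `X ⊗ M`, `a (x ⊗ m) = x σ(a₍₁₎) ⊗ a₍₀₎ m`. -/
def diag : A →ₐ[R] Module.End R (X ⊗[R] M) :=
  AlgHom.ofLinearMap (tensorAct r α ∘ₗ twist σ δ.toLinearMap)
    (by
      apply TensorProduct.ext'
      intro x m
      simp [twist_toLinearMap_apply, Algebra.TensorProduct.one_def, hσ.map_one, hr.map_one])
    (tensorAct_twist_mul hσ δ hr α)

theorem diag_apply (a : A) : diag hσ δ hr α a = tensorAct r α (twist σ δ.toLinearMap a) := rfl

theorem diag_of_mem_coinvariants {b : A} (hb : b ∈ coinvariants δ) (x : X) (m : M) :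
    diag hσ δ hr α b (x ⊗ₜ m) = x ⊗ₜ α b m := by
  rw [diag_apply, twist_of_mem_coinvariants hσ hb, tensorAct_tmul_tmul, hr.map_one]
  rfl

theorem lTensor_diag {N : Type*} [AddCommGroup N] [Module R N] (β : A →ₐ[R] Module.End R N)
    (f : M →ₗ[R] N) (hf : ∀ a m, f (α a m) = β a (f m)) (a : A) (z : X ⊗[R] M) :
    f.lTensor X (diag hσ δ hr α a z) = diag hσ δ hr β a (f.lTensor X z) := by
  rw [diag_apply, diag_apply]
  generalize twist σ δ.toLinearMap a = w
  induction w with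
  | zero => simp
  | add x y hx hy => simp only [map_add, LinearMap.add_apply, hx, hy]
  | tmul h a =>
    induction z with
    | zero => simp
    | add x y hx hy => simp only [map_add, hx, hy]
    | tmul x m => simp [hf]

end Diagonal

section MulRight

variable {R H : Type*} [CommRing R] [Ring H] [Algebra R H] [Coalgebra R H]

/-- The right action of `H` on a generalised quotient. -/
def GenQuot.act (Q : GenQuot R H) : H →ₗ[R] Module.End R (H ⧸ Q.ideal) where
  toFun := Q.mulRight
  map_add' g h := Submodule.linearMap_qext _ (LinearMap.ext fun x => by
    change Q.ideal.mkQ (x * (g + h)) = Q.ideal.mkQ (x * g) + Q.ideal.mkQ (x * h)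
    rw [mul_add, map_add])
  map_smul' c h := Submodule.linearMap_qext _ (LinearMap.ext fun x => by
    change Q.ideal.mkQ (x * (c • h)) = c • Q.ideal.mkQ (x * h)
    rw [mul_smul_comm, map_smul])

theorem GenQuot.act_mkQ (Q : GenQuot R H) (h x : H) :
    Q.act h (Q.ideal.mkQ x) = Q.ideal.mkQ (x * h) := rfl

end MulRight

theorem GenQuot.isRightAction {R H : Type*} [CommRing R] [Ring H] [Bialgebra R H]
    (Q : GenQuot R H) : IsRightAction Q.act where
  map_one := Submodule.linearMap_qext _ (LinearMap.ext fun x => by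
    change Q.ideal.mkQ (x * 1) = Q.ideal.mkQ x
    rw [mul_one])
  map_mul g h := Submodule.linearMap_qext _ (LinearMap.ext fun x => by
    change Q.ideal.mkQ (x * (g * h)) = Q.ideal.mkQ (x * g * h)
    rw [mul_assoc])

theorem isRightAction_mul_flip {R H : Type*} [CommRing R] [Ring H] [Bialgebra R H] :
    IsRightAction (LinearMap.mul R H).flip where
  map_one := LinearMap.ext fun x => mul_one x
  map_mul g h := LinearMap.ext fun x => (mul_assoc x g h).symm

/-! ### Hopf modules -/

section HopfModule

variable {R H A : Type*} [CommRing R] [Ring H] [Bialgebra R H] [Ring A] [Algebra R A]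
  {M : Type*} [AddCommGroup M] [Module R M]
  {σ : H →ₗ[R] H} (hσ : IsSkewAntipode σ) (δ : A →ₐ[R] A ⊗[R] H) (Q : GenQuot R H)
  (α : A →ₐ[R] Module.End R M)

/-- The coaction `lam` of `Q` on the `A`-module `M` is compatible with the action of `A`. -/
structure IsHopfModule (lam : M →ₗ[R] (H ⧸ Q.ideal) ⊗[R] M) : Prop where
  coaction : IsLeftCoaction lam
  map_act : ∀ a m, lam (α a m) = diag hσ δ Q.isRightAction α a (lam m)

theorem GenQuot.comul_act (Q : GenQuot R H) (h : H) (q : H ⧸ Q.ideal) :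
    Coalgebra.comul (R := R) (Q.act h q) =
      TensorProduct.homTensorHomMap (RingHom.id R) _ _ _ _ (TensorProduct.map Q.act Q.act
        (Coalgebra.comul (R := R) h)) (Coalgebra.comul (R := R) q) := by
  obtain ⟨x, rfl⟩ := Q.ideal.mkQ_surjective q
  rw [Q.act_mkQ]
  change TensorProduct.map Q.ideal.mkQ Q.ideal.mkQ (Coalgebra.comul (R := R) (x * h)) =
    TensorProduct.homTensorHomMap (RingHom.id R) _ _ _ _ (TensorProduct.map Q.act Q.act
        (Coalgebra.comul (R := R) h)) (TensorProduct.map Q.ideal.mkQ Q.ideal.mkQ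
          (Coalgebra.comul (R := R) x))
  rw [Bialgebra.comul_mul]
  generalize Coalgebra.comul (R := R) x = y
  generalize Coalgebra.comul (R := R) h = z
  induction y with
  | zero => simp
  | add y y' hy hy' => simp only [add_mul, map_add, hy, hy']
  | tmul y y' =>
    induction z with
    | zero => simp
    | add z z' hz hz' => simp only [mul_add, map_add, LinearMap.add_apply, hz, hz']
    | tmul z z' =>
      simp only [Algebra.TensorProduct.tmul_mul_tmul, TensorProduct.map_tmul,
        TensorProduct.homTensorHomMap_apply, Q.act_mkQ]

theorem GenQuot.counit_act (Q : GenQuot R H) (h : H) (q : H ⧸ Q.ideal) :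
    Coalgebra.counit (R := R) (Q.act h q) =
      Coalgebra.counit (R := R) q * Coalgebra.counit (R := R) h := by
  obtain ⟨x, rfl⟩ := Q.ideal.mkQ_surjective q
  exact Bialgebra.counit_mul x h

theorem counit_rTensor_diag (hδ : IsRightCoaction δ.toLinearMap) (a : A)
    (z : (H ⧸ Q.ideal) ⊗[R] M) :
    (Coalgebra.counit (R := R)).rTensor M (diag hσ δ Q.isRightAction α a z) =
      (α a).lTensor R ((Coalgebra.counit (R := R)).rTensor M z) := by
  induction z with
  | zero => simp
  | add x y hx hy => simp only [map_add, hx, hy]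
  | tmul q m =>
    have counit_tensorAct : ∀ w : H ⊗[R] A, (Coalgebra.counit (R := R)).rTensor M
        (tensorAct Q.act α w (q ⊗ₜ m)) = Coalgebra.counit (R := R) q •
          (α.toLinearMap.flip m).lTensor R ((Coalgebra.counit (R := R)).rTensor A w) := by
      intro w
      induction w with
      | zero => simp
      | add x y hx hy => simp only [map_add, LinearMap.add_apply, smul_add, hx, hy]
      | tmul h a => simp [Q.counit_act, TensorProduct.smul_tmul']
    have counit_twist : (Coalgebra.counit (R := R)).rTensor A (twist σ δ.toLinearMap a) = 1 ⊗ₜ a :=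
      LinearMap.congr_fun (hδ.isLeftCoaction_twist hσ.toIsAntiCoalgHom).counit a
    rw [diag_apply, counit_tensorAct, counit_twist]
    simp [TensorProduct.smul_tmul']

/-- The action of `H ⊗ (H ⊗ A)` on `X ⊗ (X ⊗ M)`. -/
def tensorActTwo {X : Type*} [AddCommGroup X] [Module R X] (r : H →ₗ[R] Module.End R X) :
    H ⊗[R] (H ⊗[R] A) →ₗ[R] Module.End R (X ⊗[R] (X ⊗[R] M)) :=
  TensorProduct.homTensorHomMap (RingHom.id R) X (X ⊗[R] M) X (X ⊗[R] M) ∘ₗ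
    TensorProduct.map r (tensorAct r α)

@[simp]
theorem tensorActTwo_tmul_tmul {X : Type*} [AddCommGroup X] [Module R X]
    (r : H →ₗ[R] Module.End R X) (h : H) (v : H ⊗[R] A) (x : X) (z : X ⊗[R] M) :
    tensorActTwo α r (h ⊗ₜ v) (x ⊗ₜ z) = r h x ⊗ₜ tensorAct r α v z := rfl

theorem comul_rTensor_tensorAct (w : H ⊗[R] A) (z : (H ⧸ Q.ideal) ⊗[R] M) :
    TensorProduct.assoc R _ _ M ((Coalgebra.comul (R := R)).rTensor M (tensorAct Q.act α w z)) =
      tensorActTwo α Q.act (TensorProduct.assoc R H H A ((Coalgebra.comul (R := R)).rTensor A w))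
        (TensorProduct.assoc R _ _ M ((Coalgebra.comul (R := R)).rTensor M z)) := by
  induction w with
  | zero => simp
  | add x y hx hy => simp only [map_add, LinearMap.add_apply, hx, hy]
  | tmul h a =>
    induction z with
    | zero => simp
    | add x y hx hy => simp only [map_add, hx, hy]
    | tmul q m =>
      simp only [tensorAct_tmul_tmul, LinearMap.rTensor_tmul, Q.comul_act]
      generalize Coalgebra.comul (R := R) h = u
      generalize Coalgebra.comul (R := R) q = v
      induction u with
      | zero => simp
      | add x y hx hy =>
        simp only [map_add, TensorProduct.add_tmul, LinearMap.add_apply, hx, hy]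
      | tmul g k =>
        induction v with
        | zero => simp
        | add x y hx hy => simp only [map_add, TensorProduct.add_tmul, hx, hy]
        | tmul p q => simp

theorem tensorAct_diag (w : H ⊗[R] A) :
    tensorAct Q.act (diag hσ δ Q.isRightAction α) w =
      tensorActTwo α Q.act ((twist σ δ.toLinearMap).lTensor H w) := by
  induction w with
  | zero => simp
  | add x y hx hy => simp only [map_add, hx, hy]
  | tmul h a => rfl

theorem comul_rTensor_diag (hδ : IsRightCoaction δ.toLinearMap) (a : A)
    (z : (H ⧸ Q.ideal) ⊗[R] M) :
    TensorProduct.assoc R _ _ M ((Coalgebra.comul (R := R)).rTensor M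
      (diag hσ δ Q.isRightAction α a z)) =
      diag hσ δ Q.isRightAction (diag hσ δ Q.isRightAction α) a
        (TensorProduct.assoc R _ _ M ((Coalgebra.comul (R := R)).rTensor M z)) := by
  have coassoc : TensorProduct.assoc R H H A ((Coalgebra.comul (R := R)).rTensor A
      (twist σ δ.toLinearMap a)) =
      (twist σ δ.toLinearMap).lTensor H (twist σ δ.toLinearMap a) :=
    LinearMap.congr_fun (hδ.isLeftCoaction_twist hσ.toIsAntiCoalgHom).coassoc a
  rw [diag_apply, comul_rTensor_tensorAct, coassoc, diag_apply, tensorAct_diag]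

theorem isHopfModule_of_generators (hδ : IsRightCoaction δ.toLinearMap)
    {lam : M →ₗ[R] (H ⧸ Q.ideal) ⊗[R] M}
    (h : ∀ a m, lam (α a m) = diag hσ δ Q.isRightAction α a (lam m)) (Z : Set M)
    (hZ : ∀ p : Submodule R M, (∀ a, ∀ m ∈ p, α a m ∈ p) → Z ⊆ p → p = ⊤)
    (hcoassoc : ∀ m ∈ Z, TensorProduct.assoc R _ _ M
      ((Coalgebra.comul (R := R)).rTensor M (lam m)) = lam.lTensor _ (lam m))
    (hcounit : ∀ m ∈ Z, (Coalgebra.counit (R := R)).rTensor M (lam m) = 1 ⊗ₜ m) :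
    IsHopfModule hσ δ Q α lam where
  map_act := h
  coaction :=
    { coassoc := by
        refine LinearMap.eqLocus_eq_top.1 (hZ _ ?_ hcoassoc)
        intro a m hm
        have hm' : TensorProduct.assoc R _ _ M
          ((Coalgebra.comul (R := R)).rTensor M (lam m)) = lam.lTensor _ (lam m) := hm
        change TensorProduct.assoc R _ _ M
          ((Coalgebra.comul (R := R)).rTensor M (lam (α a m))) = lam.lTensor _ (lam (α a m))
        rw [h, comul_rTensor_diag hσ δ Q α hδ, hm', lTensor_diag hσ δ _ α _ lam h]
      counit := by
        refine LinearMap.eqLocus_eq_top.1 (hZ _ ?_ hcounit)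
        intro a m hm
        have hm' : (Coalgebra.counit (R := R)).rTensor M (lam m) = 1 ⊗ₜ m := hm
        change (Coalgebra.counit (R := R)).rTensor M (lam (α a m)) = 1 ⊗ₜ α a m
        rw [h, counit_rTensor_diag hσ δ Q α hδ, hm', LinearMap.lTensor_tmul] }

end HopfModule

section GaloisMap

variable {R H A : Type*} [CommRing R] [Ring H] [Bialgebra R H] [Ring A] [Algebra R A]
  {σ : H →ₗ[R] H} (hσ : IsSkewAntipode σ) (δ : A →ₐ[R] A ⊗[R] H)
  {N : Type*} [AddCommGroup N] [Module R N] [Module A N] [IsScalarTower R A N]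

theorem diag_mul_flip_one_tmul (a : A) (n : N) :
    diag hσ δ isRightAction_mul_flip (Algebra.lsmul R R N) a ((1 : H) ⊗ₜ n) =
      ((Algebra.lsmul R R N).toLinearMap.flip n).lTensor H (twist σ δ.toLinearMap a) := by
  rw [diag_apply]
  generalize twist σ δ.toLinearMap a = w
  induction w with
  | zero => simp
  | add x y hx hy => simp only [map_add, LinearMap.add_apply, hx, hy]
  | tmul h a => simp

theorem diag_mul_flip_mul (a : A) (h : H) (y : H ⊗[R] A) :
    diag hσ δ isRightAction_mul_flip (Algebra.lsmul R R A) a ((h ⊗ₜ 1) * y) =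
      (h ⊗ₜ 1) * diag hσ δ isRightAction_mul_flip (Algebra.lsmul R R A) a y := by
  rw [diag_apply]
  generalize twist σ δ.toLinearMap a = w
  induction w with
  | zero => simp
  | add x y hx hy => simp only [map_add, LinearMap.add_apply, mul_add, hx, hy]
  | tmul k a =>
    induction y with
    | zero => simp
    | add x y hx hy => simp only [map_add, mul_add, hx, hy]
    | tmul g b => simp [mul_assoc]

theorem twist_eq_diag (a : A) : twist σ δ.toLinearMap a =
    diag hσ δ isRightAction_mul_flip (Algebra.lsmul R R A) a ((1 : H) ⊗ₜ 1) := by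
  rw [diag_mul_flip_one_tmul]
  generalize twist σ δ.toLinearMap a = w
  induction w with
  | zero => simp
  | add x y hx hy => simp only [map_add, ← hx, ← hy]
  | tmul h a => simp

/-- `A ⊗ H → H ⊗ A`, `a ⊗ h ↦ h σ(a₍₁₎) ⊗ a₍₀₎`. -/
def flipTwist (σ : H →ₗ[R] H) (δ : A →ₐ[R] A ⊗[R] H) : A ⊗[R] H →ₗ[R] H ⊗[R] A :=
  TensorProduct.lift (LinearMap.mk₂ R (fun a h => (h ⊗ₜ 1) * twist σ δ.toLinearMap a)
    (fun _ _ _ => by rw [map_add, mul_add])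
    (fun _ _ _ => by rw [map_smul, mul_smul_comm])
    (fun _ _ _ => by rw [TensorProduct.add_tmul, add_mul])
    (fun _ _ _ => by rw [← TensorProduct.smul_tmul', smul_mul_assoc]))

@[simp]
theorem flipTwist_tmul (a : A) (h : H) :
    flipTwist σ δ (a ⊗ₜ h) = (h ⊗ₜ 1) * twist σ δ.toLinearMap a := by
  simp [flipTwist]

theorem flipTwist_smul (a : A) (w : A ⊗[R] H) : flipTwist σ δ (a • w) =
    diag hσ δ isRightAction_mul_flip (Algebra.lsmul R R A) a (flipTwist σ δ w) := by
  induction w with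
  | zero => simp
  | add x y hx hy => simp only [smul_add, map_add, hx, hy]
  | tmul b h =>
    rw [TensorProduct.smul_tmul', smul_eq_mul, flipTwist_tmul, flipTwist_tmul, diag_mul_flip_mul,
      twist_eq_diag hσ δ (a * b), twist_eq_diag hσ δ b, map_mul, Module.End.mul_apply]

theorem flipTwist_smul_coaction (hδ : IsRightCoaction δ.toLinearMap) (a b : A) :
    flipTwist σ δ (a • δ b) =
      diag hσ δ isRightAction_mul_flip (Algebra.lsmul R R A) a (1 ⊗ₜ b) := by
  rw [flipTwist_smul hσ, coaction_mul_twist hσ hδ (flipTwist_tmul δ)]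

variable (N) in
/-- `A ⊗_B N → H ⊗ N`, `a ⊗ n ↦ σ(a₍₁₎) ⊗ a₍₀₎ n`. -/
def galoisMap : BalancedTensor R (coinvariants δ) A N →ₗ[R] H ⊗[R] N :=
  BalancedTensor.lift
    (LinearMap.lcomp R (H ⊗[R] N) (TensorProduct.mk R H N 1) ∘ₗ
      (diag hσ δ isRightAction_mul_flip (Algebra.lsmul R R N)).toLinearMap)
    (fun a b n => by
      change diag hσ δ isRightAction_mul_flip (Algebra.lsmul R R N) (a * (b : A)) (1 ⊗ₜ n) =
        diag hσ δ isRightAction_mul_flip (Algebra.lsmul R R N) a (1 ⊗ₜ ((b : A) • n))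
      rw [map_mul, Module.End.mul_apply, diag_of_mem_coinvariants hσ δ _ _ b.2]
      rfl)

theorem galoisMap_tmul (a : A) (n : N) :
    galoisMap hσ δ N (BalancedTensor.tmul R _ a n) =
      diag hσ δ isRightAction_mul_flip (Algebra.lsmul R R N) a (1 ⊗ₜ n) :=
  BalancedTensor.lift_tmul _ _ _ _

theorem galoisMap_mapRight {N' : Type*} [AddCommGroup N'] [Module R N'] [Module A N']
    [IsScalarTower R A N'] (f : N →ₗ[A] N') (z : BalancedTensor R (coinvariants δ) A N) :
    galoisMap hσ δ N' (BalancedTensor.mapRight (R := R) A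
      (f.restrictScalars (coinvariants δ)) z) =
      (f.restrictScalars R).lTensor H (galoisMap hσ δ N z) := by
  induction z using BalancedTensor.induction_on with
  | zero => simp
  | add x y hx hy => simp only [map_add, hx, hy]
  | tmul a n =>
    rw [BalancedTensor.mapRight_tmul, galoisMap_tmul, galoisMap_tmul,
      lTensor_diag hσ δ _ _ (Algebra.lsmul R R N') (f.restrictScalars R) (fun a m => by simp)]
    rfl

/-- Right multiplication `a ↦ a n`. -/
def smulRightOver (S : Subalgebra R A) (n : N) : A →ₗ[S] N :=
  (LinearMap.toSpanSingleton A N n).restrictScalars S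

@[simp]
theorem smulRightOver_apply {R A N : Type*} [CommRing R] [Ring A] [Algebra R A] [AddCommGroup N]
    [Module A N] (S : Subalgebra R A) (n : N) (a : A) :
    smulRightOver S n a = a • n := rfl

theorem galoisMap_smulRightOver (hδ : IsRightCoaction δ.toLinearMap)
    (z : BalancedTensor R (coinvariants δ) A A) (n : N) :
    galoisMap hσ δ N (BalancedTensor.mapRight (R := R) A (smulRightOver (coinvariants δ) n) z) =
      ((Algebra.lsmul R R N).toLinearMap.flip n).lTensor H (flipTwist σ δ
        (canonicalMap δ.toLinearMap (coinvariants δ) (coaction_mul_of_mem δ) z)) := by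
  have e : galoisMap hσ δ A z = flipTwist σ δ
        (canonicalMap δ.toLinearMap (coinvariants δ) (coaction_mul_of_mem δ) z) := by
    induction z using BalancedTensor.induction_on with
    | zero => simp
    | add x y hx hy => simp only [map_add, hx, hy]
    | tmul a b =>
      rw [galoisMap_tmul, canonicalMap_tmul, AlgHom.toLinearMap_apply,
        flipTwist_smul_coaction hσ δ hδ]
  rw [← e]
  exact galoisMap_mapRight hσ δ (LinearMap.toSpanSingleton A N n) z

theorem galoisMap_surjective (hδ : IsRightCoaction δ.toLinearMap) (hG : IsHopfGalois δ) :
    Function.Surjective (galoisMap hσ δ N) := by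
  intro w
  induction w with
  | zero => exact ⟨0, map_zero _⟩
  | add x y hx hy =>
    obtain ⟨x, rfl⟩ := hx
    obtain ⟨y, rfl⟩ := hy
    exact ⟨x + y, map_add _ _ _⟩
  | tmul h n =>
    obtain ⟨z, hz⟩ := hG.2 (1 ⊗ₜ h)
    refine ⟨BalancedTensor.mapRight (R := R) A (smulRightOver (coinvariants δ) n) z, ?_⟩
    rw [galoisMap_smulRightOver hσ δ hδ, hz, flipTwist_tmul, twist_toLinearMap_apply, map_one,
      Algebra.TensorProduct.one_def]
    simp [hσ.map_one]

theorem canonicalMap_smulRightOver (z : BalancedTensor R (coinvariants δ) A A) (a : A) :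
    canonicalMap δ.toLinearMap (coinvariants δ) (coaction_mul_of_mem δ)
      (BalancedTensor.mapRight (R := R) A (smulRightOver (coinvariants δ) a) z) =
    canonicalMap δ.toLinearMap (coinvariants δ) (coaction_mul_of_mem δ) z * δ a := by
  induction z using BalancedTensor.induction_on with
  | zero => simp
  | add x y hx hy => simp only [map_add, add_mul, hx, hy]
  | tmul b c =>
    rw [BalancedTensor.mapRight_tmul, canonicalMap_tmul, canonicalMap_tmul, smulRightOver_apply,
      smul_eq_mul, AlgHom.toLinearMap_apply, map_mul, AlgHom.toLinearMap_apply]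
    exact (smul_mul_assoc b (δ c) (δ a)).symm

variable (N) in
/-- The pairing `(z, n) ↦ z n` of `A ⊗_S A` and an `A`-module `N` with values in `A ⊗_S N`. -/
def smulPairing (S : Subalgebra R A) :
    BalancedTensor R S A A →ₗ[R] N →ₗ[R] BalancedTensor R S A N :=
  LinearMap.mk₂ R (fun z n => BalancedTensor.mapRight (R := R) A (smulRightOver S n) z)
    (fun _ _ _ => map_add _ _ _) (fun _ _ _ => map_smul _ _ _)
    (fun z n n' => by
      induction z using BalancedTensor.induction_on with
      | zero => simp
      | add x y hx hy => simp only [map_add, hx, hy]; abel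
      | tmul a b => simp [BalancedTensor.tmul_add])
    (fun c z n => by
      induction z using BalancedTensor.induction_on with
      | zero => simp
      | add x y hx hy => simp only [map_add, hx, hy, smul_add]
      | tmul a b =>
        rw [BalancedTensor.mapRight_tmul, BalancedTensor.mapRight_tmul, smulRightOver_apply,
          smulRightOver_apply, smul_comm, ← BalancedTensor.mkRight_apply, map_smul]
        rfl)

variable {δ} (N) in
/-- The inverse `h ⊗ n ↦ can⁻¹(1 ⊗ h) n` of `galoisMap`. -/
def galoisInv (hG : IsHopfGalois δ) : H ⊗[R] N →ₗ[R] BalancedTensor R (coinvariants δ) A N :=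
  TensorProduct.lift (smulPairing N (coinvariants δ) ∘ₗ
    (LinearEquiv.ofBijective _ hG).symm.toLinearMap ∘ₗ TensorProduct.mk R A H 1)

theorem galoisInv_tmul (hG : IsHopfGalois δ) (h : H) (n : N) :
    galoisInv N hG (h ⊗ₜ n) = BalancedTensor.mapRight (R := R) A
      (smulRightOver (coinvariants δ) n) ((LinearEquiv.ofBijective _ hG).symm (1 ⊗ₜ h)) := by
  simp [galoisInv, smulPairing]

theorem galoisInv_lTensor_flip (hG : IsHopfGalois δ) (n : N) (w : H ⊗[R] A) :
    galoisInv N hG (((Algebra.lsmul R R N).toLinearMap.flip n).lTensor H w) =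
      BalancedTensor.mapRight (R := R) A (smulRightOver (coinvariants δ) n)
        (galoisInv A hG w) := by
  induction w with
  | zero => simp
  | add x y hx hy => simp only [map_add, hx, hy]
  | tmul h a =>
    rw [LinearMap.lTensor_tmul, galoisInv_tmul, galoisInv_tmul,
      ← BalancedTensor.mapRight_comp_apply]
    congr 2
    ext b
    simp [mul_smul]

include hσ in
theorem galoisInv_twist (hδ : IsRightCoaction δ.toLinearMap) (hG : IsHopfGalois δ) (a : A) :
    galoisInv A hG (twist σ δ.toLinearMap a) = BalancedTensor.tmul R (coinvariants δ) a 1 := by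
  apply hG.1
  rw [canonicalMap_tmul, AlgHom.toLinearMap_apply, map_one]
  refine (twist_mul_coaction hσ hδ
    (F := (LinearEquiv.ofBijective _ hG).toLinearMap ∘ₗ galoisInv A hG) ?_ a).trans ?_
  · intro h a
    rw [LinearMap.comp_apply, galoisInv_tmul]
    refine (canonicalMap_smulRightOver δ _ a).trans ?_
    congr 1
    exact (LinearEquiv.ofBijective _ hG).apply_symm_apply _
  · rw [Algebra.TensorProduct.one_def, TensorProduct.smul_tmul', smul_eq_mul, mul_one]

theorem galoisMap_injective (hδ : IsRightCoaction δ.toLinearMap) (hG : IsHopfGalois δ) :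
    Function.Injective (galoisMap hσ δ N) := by
  refine Function.LeftInverse.injective (g := galoisInv N hG) fun z => ?_
  induction z using BalancedTensor.induction_on with
  | zero => simp
  | add x y hx hy => simp only [map_add, hx, hy]
  | tmul a n =>
    rw [galoisMap_tmul, diag_mul_flip_one_tmul, galoisInv_lTensor_flip,
      galoisInv_twist hσ δ hδ hG]
    simp

end GaloisMap

/-! ### Coinvariants of Hopf modules -/

section Coinvariants

variable {R H A : Type*} [CommRing R] [Ring H] [Bialgebra R H] [Ring A] [Algebra R A]
  {σ : H →ₗ[R] H} (hσ : IsSkewAntipode σ) (δ : A →ₐ[R] A ⊗[R] H) (Q : GenQuot R H)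
  {M : Type*} [AddCommGroup M] [Module R M]

theorem diag_mkQ_one_tmul (α : A →ₐ[R] Module.End R M) (a : A) (m : M) :
    diag hσ δ Q.isRightAction α a (Q.ideal.mkQ 1 ⊗ₜ m) =
      TensorProduct.map Q.ideal.mkQ (α.toLinearMap.flip m) (twist σ δ.toLinearMap a) := by
  rw [diag_apply]
  generalize twist σ δ.toLinearMap a = w
  induction w with
  | zero => simp
  | add x y hx hy => simp only [map_add, LinearMap.add_apply, hx, hy]
  | tmul h a => rw [tensorAct_tmul_tmul, Q.act_mkQ, one_mul]; rfl

theorem lTensor_flip_diag_mkQ_one (α : A →ₐ[R] Module.End R M) (m : M) (w : H ⊗[R] A) :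
    ((diag hσ δ Q.isRightAction α).toLinearMap.flip (Q.ideal.mkQ 1 ⊗ₜ m)).lTensor H w =
      (TensorProduct.map Q.ideal.mkQ (α.toLinearMap.flip m)).lTensor H
        ((twist σ δ.toLinearMap).lTensor H w) := by
  induction w with
  | zero => simp
  | add x y hx hy => simp only [map_add, hx, hy]
  | tmul h b =>
    simp only [LinearMap.lTensor_tmul]
    rw [← diag_mkQ_one_tmul hσ δ Q α b m]
    rfl

theorem assoc_rTensor_quotComul_lTensor (f : A →ₗ[R] M) (w : H ⊗[R] A) :
    TensorProduct.assoc R H (H ⧸ Q.ideal) M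
      ((Q.ideal.mkQ.lTensor H ∘ₗ Coalgebra.comul (R := R) (A := H)).rTensor M (f.lTensor H w)) =
      (TensorProduct.map Q.ideal.mkQ f).lTensor H
        (TensorProduct.assoc R H H A ((Coalgebra.comul (R := R)).rTensor A w)) := by
  induction w with
  | zero => simp
  | add x y hx hy => simp only [map_add, hx, hy]
  | tmul h b =>
    simp only [LinearMap.lTensor_tmul, LinearMap.rTensor_tmul, LinearMap.comp_apply]
    generalize Coalgebra.comul (R := R) h = y
    induction y with
    | zero => simp
    | add x y hx hy => simp only [map_add, TensorProduct.add_tmul, hx, hy]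
    | tmul h k => simp

variable {Q} [Module A M] [IsScalarTower R A M]

/-- The coinvariants of a Hopf module, as a module over the coinvariants of `A`. -/
def hopfCoinvariants {lam : M →ₗ[R] (H ⧸ Q.ideal) ⊗[R] M}
    (hlam : IsHopfModule hσ δ Q (Algebra.lsmul R R M) lam) : Submodule (coinvariants δ) M where
  carrier := {m | lam m = Q.ideal.mkQ 1 ⊗ₜ m}
  zero_mem' := by simp
  add_mem' {m m'} hm hm' := by
    rw [Set.mem_ofPred_eq] at hm hm' ⊢
    rw [map_add, hm, hm', TensorProduct.tmul_add]
  smul_mem' b m hm := by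
    rw [Set.mem_ofPred_eq] at hm ⊢
    have := hlam.map_act b m
    rw [hm, diag_of_mem_coinvariants hσ δ _ _ b.2] at this
    exact this

theorem mem_hopfCoinvariants {lam : M →ₗ[R] (H ⧸ Q.ideal) ⊗[R] M}
    (hlam : IsHopfModule hσ δ Q (Algebra.lsmul R R M) lam) {m : M} :
    m ∈ hopfCoinvariants hσ δ hlam ↔ lam m = Q.ideal.mkQ 1 ⊗ₜ m := Iff.rfl

/-- The embedding of `A ⊗_B M^{co Q}` into `H ⊗ M`. -/
def hopfEmb {lam : M →ₗ[R] (H ⧸ Q.ideal) ⊗[R] M}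
    (hlam : IsHopfModule hσ δ Q (Algebra.lsmul R R M) lam) :
    BalancedTensor R (coinvariants δ) A (hopfCoinvariants hσ δ hlam) →ₗ[R] H ⊗[R] M :=
  galoisMap hσ δ M ∘ₗ BalancedTensor.mapRight (R := R) A (hopfCoinvariants hσ δ hlam).subtype

theorem hopfEmb_apply {lam : M →ₗ[R] (H ⧸ Q.ideal) ⊗[R] M}
    (hlam : IsHopfModule hσ δ Q (Algebra.lsmul R R M) lam)
    (z : BalancedTensor R (coinvariants δ) A (hopfCoinvariants hσ δ hlam)) :
    hopfEmb hσ δ hlam z = galoisMap hσ δ M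
      (BalancedTensor.mapRight (R := R) A (hopfCoinvariants hσ δ hlam).subtype z) := rfl

section Map

variable {M₁ M₂ M₃ : Type*} [AddCommGroup M₁] [AddCommGroup M₂] [AddCommGroup M₃]
  [Module R M₁] [Module R M₂] [Module R M₃] [Module A M₁] [Module A M₂] [Module A M₃]
  [IsScalarTower R A M₁] [IsScalarTower R A M₂] [IsScalarTower R A M₃]
  {lam₁ : M₁ →ₗ[R] (H ⧸ Q.ideal) ⊗[R] M₁} {lam₂ : M₂ →ₗ[R] (H ⧸ Q.ideal) ⊗[R] M₂}
  {lam₃ : M₃ →ₗ[R] (H ⧸ Q.ideal) ⊗[R] M₃}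
  (h₁ : IsHopfModule hσ δ Q (Algebra.lsmul R R M₁) lam₁)
  (h₂ : IsHopfModule hσ δ Q (Algebra.lsmul R R M₂) lam₂)
  (h₃ : IsHopfModule hσ δ Q (Algebra.lsmul R R M₃) lam₃)
  (f : M₁ →ₗ[A] M₂) (g : M₂ →ₗ[A] M₃)
  (hf : ∀ m, lam₂ (f m) = (f.restrictScalars R).lTensor _ (lam₁ m))
  (hg : ∀ m, lam₃ (g m) = (g.restrictScalars R).lTensor _ (lam₂ m))

/-- The restriction of a morphism of Hopf modules to the coinvariants. -/
def hopfCoinvariantsMap : hopfCoinvariants hσ δ h₁ →ₗ[coinvariants δ] hopfCoinvariants hσ δ h₂ :=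
  (f.restrictScalars (coinvariants δ)).restrict fun m hm => by
    rw [mem_hopfCoinvariants] at hm ⊢
    rw [LinearMap.restrictScalars_apply, hf, hm]
    rfl

theorem exact_hopfCoinvariantsMap_iff :
    Function.Exact (hopfCoinvariantsMap hσ δ h₁ h₂ f hf) (hopfCoinvariantsMap hσ δ h₂ h₃ g hg) ↔
      ∀ y, lam₂ y = Q.ideal.mkQ 1 ⊗ₜ y →
        (g y = 0 ↔ ∃ x, lam₁ x = Q.ideal.mkQ 1 ⊗ₜ x ∧ f x = y) := by
  have map_eq_zero_iff (y : hopfCoinvariants hσ δ h₂) :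
      hopfCoinvariantsMap hσ δ h₂ h₃ g hg y = 0 ↔ g y.1 = 0 := by
    rw [Subtype.ext_iff]; rfl
  have mem_range_map_iff (y : hopfCoinvariants hσ δ h₂) :
      y ∈ Set.range (hopfCoinvariantsMap hσ δ h₁ h₂ f hf) ↔
        ∃ x, lam₁ x = Q.ideal.mkQ 1 ⊗ₜ x ∧ f x = y.1 :=
    ⟨fun ⟨x, hx⟩ => ⟨x.1, x.2, congrArg Subtype.val hx⟩,
      fun ⟨x, hx, hxy⟩ => ⟨⟨x, hx⟩, Subtype.ext hxy⟩⟩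
  constructor
  · intro h y hy
    exact (map_eq_zero_iff ⟨y, hy⟩).symm.trans ((h ⟨y, hy⟩).trans (mem_range_map_iff _))
  · intro h y
    exact (map_eq_zero_iff y).trans ((h y.1 y.2).trans (mem_range_map_iff y).symm)

theorem hopfEmb_mapRight
    (z : BalancedTensor R (coinvariants δ) A (hopfCoinvariants hσ δ h₁)) :
    hopfEmb hσ δ h₂ (BalancedTensor.mapRight (R := R) A (hopfCoinvariantsMap hσ δ h₁ h₂ f hf) z) =
      (f.restrictScalars R).lTensor H (hopfEmb hσ δ h₁ z) := by
  refine Eq.trans ?_ (galoisMap_mapRight hσ δ f _)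
  rw [hopfEmb_apply, ← BalancedTensor.mapRight_comp_apply, ← BalancedTensor.mapRight_comp_apply]
  rfl

end Map

theorem galoisMap_mapRight_mkQ_one_tmul (hδ : IsRightCoaction δ.toLinearMap)
    [Module A ((H ⧸ Q.ideal) ⊗[R] M)] [IsScalarTower R A ((H ⧸ Q.ideal) ⊗[R] M)]
    (hact : Algebra.lsmul R R ((H ⧸ Q.ideal) ⊗[R] M) =
      diag hσ δ Q.isRightAction (Algebra.lsmul R R M))
    {v : M →ₗ[coinvariants δ] (H ⧸ Q.ideal) ⊗[R] M} (hv : ∀ m, v m = Q.ideal.mkQ 1 ⊗ₜ m)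
    (z : BalancedTensor R (coinvariants δ) A M) :
    galoisMap hσ δ _ (BalancedTensor.mapRight (R := R) A v z) =
      TensorProduct.assoc R H (H ⧸ Q.ideal) M
        ((Q.ideal.mkQ.lTensor H ∘ₗ Coalgebra.comul (R := R) (A := H)).rTensor M
          (galoisMap hσ δ M z)) := by
  induction z using BalancedTensor.induction_on with
  | zero => simp
  | add x y hx hy => simp only [map_add, hx, hy]
  | tmul a m =>
    have coassoc : TensorProduct.assoc R H H A ((Coalgebra.comul (R := R)).rTensor A
        (twist σ δ.toLinearMap a)) =
        (twist σ δ.toLinearMap).lTensor H (twist σ δ.toLinearMap a) :=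
      LinearMap.congr_fun (hδ.isLeftCoaction_twist hσ.toIsAntiCoalgHom).coassoc a
    rw [BalancedTensor.mapRight_tmul, galoisMap_tmul, galoisMap_tmul, diag_mul_flip_one_tmul,
      diag_mul_flip_one_tmul, hv, hact, lTensor_flip_diag_mkQ_one,
      assoc_rTensor_quotComul_lTensor, coassoc]

end Coinvariants

section Exactness

variable {R H A : Type u} [CommRing R] [Ring H] [Bialgebra R H] [Ring A] [Algebra R A]
  {σ : H →ₗ[R] H} (hσ : IsSkewAntipode σ) {δ : A →ₐ[R] A ⊗[R] H} {Q : GenQuot R H}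
  {M : Type u} [AddCommGroup M] [Module R M] [Module A M] [IsScalarTower R A M]

theorem hopfEmb_injective (hδ : IsRightCoaction δ.toLinearMap) (hG : IsHopfGalois δ)
    (hB : IsRightFaithfullyFlat R (coinvariants δ) A)
    {lam : M →ₗ[R] (H ⧸ Q.ideal) ⊗[R] M}
    (hlam : IsHopfModule hσ δ Q (Algebra.lsmul R R M) lam) :
    Function.Injective (hopfEmb hσ δ hlam) := by
  intro x y hxy
  rw [hopfEmb_apply, hopfEmb_apply] at hxy
  exact hB.mapRight_injective (X := hopfCoinvariants hσ δ hlam) (Y := M)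
    (f := (hopfCoinvariants hσ δ hlam).subtype) Subtype.val_injective
    (galoisMap_injective hσ δ hδ hG hxy)

theorem range_hopfEmb (hδ : IsRightCoaction δ.toLinearMap) (hG : IsHopfGalois δ)
    (hB : IsRightFaithfullyFlat R (coinvariants δ) A)
    {lam : M →ₗ[R] (H ⧸ Q.ideal) ⊗[R] M}
    (hlam : IsHopfModule hσ δ Q (Algebra.lsmul R R M) lam) :
    LinearMap.range (hopfEmb hσ δ hlam) = LinearMap.range (cotensor
      (Q.ideal.mkQ.lTensor H ∘ₗ Coalgebra.comul (R := R) (A := H)) lam).subtype := by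
  let _ : Module A ((H ⧸ Q.ideal) ⊗[R] M) :=
    Module.compHom _ (diag hσ δ Q.isRightAction (Algebra.lsmul R R M)).toRingHom
  have smul_eq (a : A) (n : (H ⧸ Q.ideal) ⊗[R] M) :
      a • n = diag hσ δ Q.isRightAction (Algebra.lsmul R R M) a n := rfl
  have : IsScalarTower R A ((H ⧸ Q.ideal) ⊗[R] M) := ⟨fun r a n => by
    rw [smul_eq, smul_eq, map_smul, LinearMap.smul_apply]⟩
  let lamA : M →ₗ[A] (H ⧸ Q.ideal) ⊗[R] M :=
    { toFun := lam, map_add' := map_add lam, map_smul' := hlam.map_act }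
  let v : M →ₗ[coinvariants δ] (H ⧸ Q.ideal) ⊗[R] M :=
    { toFun := fun m => Q.ideal.mkQ 1 ⊗ₜ m
      map_add' := fun m m' => TensorProduct.tmul_add _ _ _
      map_smul' := fun b m => (diag_of_mem_coinvariants hσ δ Q.isRightAction
        (Algebra.lsmul R R M) b.2 (Q.ideal.mkQ 1) m).symm }
  have exact_sub : Function.Exact (hopfCoinvariants hσ δ hlam).subtype
      (lamA.restrictScalars (coinvariants δ) - v) := by
    intro m
    rw [Submodule.coe_subtype, Subtype.range_coe]
    exact sub_eq_zero
  have exact_mapRight := (hB.exact_iff (X := hopfCoinvariants hσ δ hlam) _ _).1 exact_sub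
  have galoisMap_lamA (z : BalancedTensor R (coinvariants δ) A M) :
      galoisMap hσ δ _ (BalancedTensor.mapRight (R := R) A
        (lamA.restrictScalars (coinvariants δ)) z) = lam.lTensor H (galoisMap hσ δ M z) :=
    galoisMap_mapRight hσ δ lamA z
  have galoisMap_v := galoisMap_mapRight_mkQ_one_tmul hσ δ hδ (v := v) rfl (fun _ => rfl)
  ext w
  obtain ⟨z, rfl⟩ := galoisMap_surjective hσ δ hδ hG w
  have mem_range_iff : galoisMap hσ δ M z ∈ LinearMap.range (hopfEmb hσ δ hlam) ↔
      BalancedTensor.mapRight (R := R) A (lamA.restrictScalars (coinvariants δ) - v) z = 0 := by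
    refine Iff.trans (exists_congr fun y => ?_) (exact_mapRight z).symm
    rw [hopfEmb_apply]
    exact (galoisMap_injective hσ δ hδ hG).eq_iff
  rw [Submodule.range_subtype, mem_range_iff, BalancedTensor.mapRight_sub_apply, sub_eq_zero,
    ← (galoisMap_injective hσ δ hδ hG).eq_iff, galoisMap_lamA, galoisMap_v, eq_comm]
  rfl

theorem hopfModule_exact_iff (hδ : IsRightCoaction δ.toLinearMap) (hG : IsHopfGalois δ)
    (hB : IsRightFaithfullyFlat R (coinvariants δ) A)
    (hQ : IsRightFaithfullyCoflat
      (Q.ideal.mkQ.lTensor H ∘ₗ Coalgebra.comul (R := R) (A := H)))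
    {M₁ M₂ M₃ : Type u} [AddCommGroup M₁] [AddCommGroup M₂] [AddCommGroup M₃]
    [Module R M₁] [Module R M₂] [Module R M₃] [Module A M₁] [Module A M₂] [Module A M₃]
    [IsScalarTower R A M₁] [IsScalarTower R A M₂] [IsScalarTower R A M₃]
    {lam₁ : M₁ →ₗ[R] (H ⧸ Q.ideal) ⊗[R] M₁} {lam₂ : M₂ →ₗ[R] (H ⧸ Q.ideal) ⊗[R] M₂}
    {lam₃ : M₃ →ₗ[R] (H ⧸ Q.ideal) ⊗[R] M₃}
    (h₁ : IsHopfModule hσ δ Q (Algebra.lsmul R R M₁) lam₁)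
    (h₂ : IsHopfModule hσ δ Q (Algebra.lsmul R R M₂) lam₂)
    (h₃ : IsHopfModule hσ δ Q (Algebra.lsmul R R M₃) lam₃)
    (f : M₁ →ₗ[A] M₂) (g : M₂ →ₗ[A] M₃)
    (hf : ∀ m, lam₂ (f m) = (f.restrictScalars R).lTensor _ (lam₁ m))
    (hg : ∀ m, lam₃ (g m) = (g.restrictScalars R).lTensor _ (lam₂ m)) :
    Function.Exact f g ↔ ∀ y, lam₂ y = Q.ideal.mkQ 1 ⊗ₜ y →
      (g y = 0 ↔ ∃ x, lam₁ x = Q.ideal.mkQ 1 ⊗ₜ x ∧ f x = y) := by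
  let ρ := Q.ideal.mkQ.lTensor H ∘ₗ Coalgebra.comul (R := R) (A := H)
  have exact_iff_cotensor := hQ M₁ M₂ M₃ lam₁ lam₂ lam₃ h₁.coaction h₂.coaction h₃.coaction
    (f.restrictScalars R) (g.restrictScalars R) (LinearMap.ext hf) (LinearMap.ext hg)
  have exact_iff_mapRight := hB.exact_iff
    (hopfCoinvariantsMap hσ δ h₁ h₂ f hf) (hopfCoinvariantsMap hσ δ h₂ h₃ g hg)
  refine exact_iff_cotensor.trans (Iff.trans (Iff.symm ?_) (exact_iff_mapRight.symm.trans
    (exact_hopfCoinvariantsMap_iff hσ δ h₁ h₂ h₃ f g hf hg)))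
  exact exact_iff_of_range_eq
    ((f.restrictScalars R).lTensor H) ((g.restrictScalars R).lTensor H)
    (hopfEmb_injective hσ hδ hG hB h₂) (hopfEmb_injective hσ hδ hG hB h₃)
    (V₁ := cotensor ρ lam₁) (V₂ := cotensor ρ lam₂) (V₃ := cotensor ρ lam₃)
    (k₁ := (cotensor ρ lam₁).subtype) (k₂ := (cotensor ρ lam₂).subtype)
    (k₃ := (cotensor ρ lam₃).subtype)
    Subtype.val_injective Subtype.val_injective
    (range_hopfEmb hσ hδ hG hB h₁) (range_hopfEmb hσ hδ hG hB h₂)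
    (hopfEmb_mapRight hσ δ h₁ h₂ f hf) (hopfEmb_mapRight hσ δ h₂ h₃ g hg)
    (fun _ => rfl) (fun _ => rfl)

end Exactness

/-! ### The subalgebra of coinvariants of a generalised quotient -/

section PhiTwist

variable {R H A : Type*} [CommRing R] [Ring H] [Bialgebra R H] [Ring A] [Algebra R A]
  {σ : H →ₗ[R] H} (hσ : IsSkewAntipode σ) (δ : A →ₐ[R] A ⊗[R] H) (Q : GenQuot R H)

/-- `Q ⊗ A → A ⊗ Q`, `q ⊗ a ↦ a₍₀₎ ⊗ q a₍₁₎`. -/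
def quotFlip : (H ⧸ Q.ideal) ⊗[R] A →ₗ[R] A ⊗[R] (H ⧸ Q.ideal) :=
  TensorProduct.lift (LinearMap.lcomp R (A ⊗[R] (H ⧸ Q.ideal)) δ.toLinearMap ∘ₗ
    LinearMap.lTensorHom A ∘ₗ Q.act.flip)

theorem quotFlip_tmul (q : H ⧸ Q.ideal) (a : A) :
    quotFlip δ Q (q ⊗ₜ a) = (Q.act.flip q).lTensor A (δ a) := rfl

theorem quotFlip_one_tmul (a : A) :
    quotFlip δ Q (Q.ideal.mkQ 1 ⊗ₜ a) = quotCoaction δ Q a := by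
  rw [quotFlip_tmul]
  change _ = Q.ideal.mkQ.lTensor A (δ a)
  congr 2
  ext h
  change Q.ideal.mkQ (1 * h) = Q.ideal.mkQ h
  rw [one_mul]

/-- `H ⊗ A → A ⊗ H`, `h ⊗ a ↦ a₍₀₎ ⊗ h a₍₁₎`. -/
def mulCoaction : H ⊗[R] A →ₗ[R] A ⊗[R] H :=
  TensorProduct.lift (LinearMap.mk₂ R (fun h a => (1 ⊗ₜ h) * δ a)
    (fun _ _ _ => by rw [TensorProduct.tmul_add, add_mul])
    (fun _ _ _ => by rw [TensorProduct.tmul_smul, smul_mul_assoc])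
    (fun _ _ _ => by rw [map_add, mul_add])
    (fun _ _ _ => by rw [map_smul, mul_smul_comm]))

theorem mulCoaction_tmul (h : H) (a : A) : mulCoaction δ (h ⊗ₜ a) = (1 ⊗ₜ h) * δ a := by
  simp [mulCoaction]

theorem quotFlip_tensorAct (q : H ⧸ Q.ideal) (w : H ⊗[R] A) :
    quotFlip δ Q (tensorAct Q.act (Algebra.lsmul R R A) w (q ⊗ₜ 1)) =
      (Q.act.flip q).lTensor A (mulCoaction δ w) := by
  induction w with
  | zero => simp
  | add x y hx hy => simp only [map_add, LinearMap.add_apply, hx, hy]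
  | tmul h a =>
    have : (Algebra.lsmul R R A a) 1 = a := by simp
    rw [tensorAct_tmul_tmul, this, quotFlip_tmul, mulCoaction_tmul]
    generalize δ a = y
    induction y with
    | zero => simp
    | add x y hx hy => simp only [map_add, mul_add, hx, hy]
    | tmul b k =>
      simp only [Algebra.TensorProduct.tmul_mul_tmul, LinearMap.lTensor_tmul, one_mul,
        LinearMap.flip_apply, Q.isRightAction.map_mul, Module.End.mul_apply]

theorem quotFlip_diag (hδ : IsRightCoaction δ.toLinearMap) (a : A) (q : H ⧸ Q.ideal) :
    quotFlip δ Q (diag hσ δ Q.isRightAction (Algebra.lsmul R R A) a (q ⊗ₜ 1)) = a ⊗ₜ q := by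
  rw [diag_apply, quotFlip_tensorAct, twist_mul_coaction hσ hδ (mulCoaction_tmul δ),
    LinearMap.lTensor_tmul, LinearMap.flip_apply, Q.isRightAction.map_one]
  rfl

theorem diag_smul_tmul_flipTwist (x : A ⊗[R] H) :
    TensorProduct.lift ((LinearMap.mk₂ R (fun (a : A) (q : H ⧸ Q.ideal) =>
      tensorAct Q.act (Algebra.lsmul R R A) (twist σ δ.toLinearMap a) (q ⊗ₜ (1 : A)))
      (fun _ _ _ => by simp only [map_add, LinearMap.add_apply])
      (fun _ _ _ => by simp only [map_smul, LinearMap.smul_apply])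
      (fun _ _ _ => by simp only [map_add, TensorProduct.add_tmul])
      (fun _ _ _ => by simp only [map_smul, ← TensorProduct.smul_tmul'])))
      (Q.ideal.mkQ.lTensor A x) = Q.ideal.mkQ.rTensor A (flipTwist σ δ x) := by
  induction x with
  | zero => simp
  | add x y hx hy => simp only [map_add, hx, hy]
  | tmul a h =>
    rw [LinearMap.lTensor_tmul, TensorProduct.lift.tmul, LinearMap.mk₂_apply, flipTwist_tmul]
    generalize twist σ δ.toLinearMap a = w
    induction w with
    | zero => simp
    | add x y hx hy => simp only [map_add, LinearMap.add_apply, mul_add, hx, hy]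
    | tmul k b =>
      rw [tensorAct_tmul_tmul, Q.act_mkQ]
      simp

theorem diag_one_tmul_one (a : A) :
    diag hσ δ Q.isRightAction (Algebra.lsmul R R A) a (Q.ideal.mkQ 1 ⊗ₜ 1) =
      Q.ideal.mkQ.rTensor A (twist σ δ.toLinearMap a) := by
  rw [diag_mkQ_one_tmul]
  change TensorProduct.map _ _ _ = TensorProduct.map _ _ _
  congr 2
  ext b
  simp

include hσ in
theorem mem_phi_iff_twist (hδ : IsRightCoaction δ.toLinearMap) (a : A) :
    a ∈ phi δ Q ↔ Q.ideal.mkQ.rTensor A (twist σ δ.toLinearMap a) = Q.ideal.mkQ 1 ⊗ₜ a := by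
  constructor
  · intro ha
    have coaction_eq : Q.ideal.mkQ.lTensor A (δ a) = a ⊗ₜ Q.ideal.mkQ 1 := ha
    have flip_eq := diag_smul_tmul_flipTwist (σ := σ) δ Q (δ a)
    rw [coaction_eq, coaction_mul_twist hσ hδ (flipTwist_tmul δ), TensorProduct.lift.tmul,
      LinearMap.mk₂_apply, ← diag_apply hσ δ Q.isRightAction, diag_one_tmul_one] at flip_eq
    exact flip_eq
  · intro ha
    rw [← diag_one_tmul_one hσ] at ha
    have := congrArg (quotFlip δ Q) ha
    rw [quotFlip_diag hσ δ Q hδ, quotFlip_one_tmul] at this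
    exact this.symm

theorem diag_of_mem_phi (hδ : IsRightCoaction δ.toLinearMap) {M : Type*} [AddCommGroup M]
    [Module R M] (α : A →ₐ[R] Module.End R M) {s : A} (hs : s ∈ phi δ Q) (m : M) :
    diag hσ δ Q.isRightAction α s (Q.ideal.mkQ 1 ⊗ₜ m) = Q.ideal.mkQ 1 ⊗ₜ α s m := by
  rw [diag_mkQ_one_tmul, ← LinearMap.lTensor_comp_rTensor, LinearMap.comp_apply,
    (mem_phi_iff_twist hσ δ Q hδ s).1 hs]
  rfl

end PhiTwist

/-! ### Induced Hopf modules -/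

section Induced

variable {R H A : Type*} [CommRing R] [Ring H] [Bialgebra R H] [Ring A] [Algebra R A]
  {σ : H →ₗ[R] H} (hσ : IsSkewAntipode σ) {δ : A →ₐ[R] A ⊗[R] H}
  (hδ : IsRightCoaction δ.toLinearMap) (Q : GenQuot R H)
  (V : Type*) [AddCommGroup V] [Module R V] [Module (phi δ Q) V]

/-- The coaction `a ⊗ v ↦ π(σ(a₍₁₎)) ⊗ a₍₀₎ ⊗ v` on `A ⊗_S V`. -/
def inducedCoaction : BalancedTensor R (phi δ Q) A V →ₗ[R]
    (H ⧸ Q.ideal) ⊗[R] BalancedTensor R (phi δ Q) A V :=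
  BalancedTensor.lift
    (LinearMap.lcomp R _ (TensorProduct.mk R (H ⧸ Q.ideal) _ (Q.ideal.mkQ 1) ∘ₗ
        BalancedTensor.mkRight R (phi δ Q) V (1 : A)) ∘ₗ
      (diag hσ δ Q.isRightAction
        (Algebra.lsmul R R (BalancedTensor R (phi δ Q) A V))).toLinearMap)
    (fun a s v => by
      change diag hσ δ Q.isRightAction (Algebra.lsmul R R (BalancedTensor R (phi δ Q) A V))
          (a * (s : A)) (Q.ideal.mkQ 1 ⊗ₜ BalancedTensor.tmul R (phi δ Q) 1 v) =
        diag hσ δ Q.isRightAction (Algebra.lsmul R R (BalancedTensor R (phi δ Q) A V)) a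
          (Q.ideal.mkQ 1 ⊗ₜ BalancedTensor.tmul R (phi δ Q) 1 (s • v))
      rw [map_mul, Module.End.mul_apply, diag_of_mem_phi hσ δ Q hδ _ s.2,
        ← BalancedTensor.op_smul_tmul, op_smul_eq_mul, one_mul]
      change diag hσ δ Q.isRightAction _ a (_ ⊗ₜ ((s : A) • BalancedTensor.tmul R _ 1 v)) = _
      rw [BalancedTensor.smul_tmul, mul_one])

theorem inducedCoaction_tmul (a : A) (v : V) :
    inducedCoaction hσ hδ Q V (BalancedTensor.tmul R _ a v) =
      diag hσ δ Q.isRightAction (Algebra.lsmul R R _) a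
        (Q.ideal.mkQ 1 ⊗ₜ BalancedTensor.tmul R (phi δ Q) 1 v) :=
  BalancedTensor.lift_tmul _ _ _ _

theorem inducedCoaction_one_tmul (v : V) :
    inducedCoaction hσ hδ Q V (BalancedTensor.tmul R _ 1 v) =
      Q.ideal.mkQ 1 ⊗ₜ BalancedTensor.tmul R (phi δ Q) 1 v := by
  rw [inducedCoaction_tmul, map_one, Module.End.one_apply]

theorem eq_top_of_one_tmul_mem {R A : Type*} [CommRing R] [Ring A] [Algebra R A]
    {S : Subalgebra R A} {V : Type*} [AddCommGroup V] [Module R V] [Module S V]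
    (p : Submodule R (BalancedTensor R S A V)) (h : ∀ a : A, ∀ m ∈ p, a • m ∈ p)
    (h1 : ∀ v, BalancedTensor.tmul R S 1 v ∈ p) : p = ⊤ := by
  rw [eq_top_iff]
  rintro z -
  induction z using BalancedTensor.induction_on with
  | zero => exact p.zero_mem
  | add x y hx hy => exact p.add_mem hx hy
  | tmul a v => rw [BalancedTensor.tmul_eq_smul]; exact h a _ (h1 v)

theorem GenQuot.comul_one (Q : GenQuot R H) : Coalgebra.comul (R := R) (Q.ideal.mkQ (1 : H)) =
    Q.ideal.mkQ 1 ⊗ₜ Q.ideal.mkQ 1 := by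
  change TensorProduct.map Q.ideal.mkQ Q.ideal.mkQ (Coalgebra.comul (R := R) (1 : H)) = _
  rw [Bialgebra.comul_one, Algebra.TensorProduct.one_def, TensorProduct.map_tmul]

theorem GenQuot.counit_one (Q : GenQuot R H) :
    Coalgebra.counit (R := R) (Q.ideal.mkQ (1 : H)) = 1 :=
  Bialgebra.counit_one (R := R) (A := H)

theorem isHopfModule_induced : IsHopfModule hσ δ Q
    (Algebra.lsmul R R (BalancedTensor R (phi δ Q) A V)) (inducedCoaction hσ hδ Q V) := by
  refine isHopfModule_of_generators hσ δ Q _ hδ ?_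
    (Set.range (BalancedTensor.tmul R (phi δ Q) (1 : A)))
    (fun p hp hZ => eq_top_of_one_tmul_mem p hp fun v => hZ ⟨v, rfl⟩) ?_ ?_
  · intro a z
    change inducedCoaction hσ hδ Q V (a • z) = _
    induction z using BalancedTensor.induction_on with
    | zero => simp
    | add x y hx hy => simp only [smul_add, map_add, hx, hy]
    | tmul b v =>
      rw [BalancedTensor.smul_tmul, inducedCoaction_tmul, inducedCoaction_tmul, map_mul,
        Module.End.mul_apply]
  · rintro _ ⟨v, rfl⟩
    rw [inducedCoaction_one_tmul, LinearMap.rTensor_tmul, Q.comul_one, TensorProduct.assoc_tmul,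
      LinearMap.lTensor_tmul, inducedCoaction_one_tmul]
  · rintro _ ⟨v, rfl⟩
    rw [inducedCoaction_one_tmul, LinearMap.rTensor_tmul, Q.counit_one]

variable {V}

/-- `A ⊗_S f` as a map of `A`-modules. -/
def inducedMap [IsScalarTower R (phi δ Q) V] {V' : Type*} [AddCommGroup V'] [Module R V']
    [Module (phi δ Q) V'] [IsScalarTower R (phi δ Q) V'] (f : V →ₗ[phi δ Q] V') :
    BalancedTensor R (phi δ Q) A V →ₗ[A] BalancedTensor R (phi δ Q) A V' where
  toFun := BalancedTensor.mapRight (R := R) A f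
  map_add' := map_add _
  map_smul' a z := BalancedTensor.mapRight_smul f a z

theorem inducedMap_tmul [IsScalarTower R (phi δ Q) V] {V' : Type*} [AddCommGroup V'] [Module R V']
    [Module (phi δ Q) V'] [IsScalarTower R (phi δ Q) V'] (f : V →ₗ[phi δ Q] V') (a : A) (v : V) :
    inducedMap Q f (BalancedTensor.tmul R _ a v) = BalancedTensor.tmul R _ a (f v) := rfl

theorem inducedCoaction_colinear {N : Type*} [AddCommGroup N] [Module R N] [Module A N]
    [IsScalarTower R A N] {lam : N →ₗ[R] (H ⧸ Q.ideal) ⊗[R] N}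
    (hlam : ∀ a n, lam (a • n) = diag hσ δ Q.isRightAction (Algebra.lsmul R R N) a (lam n))
    (f : BalancedTensor R (phi δ Q) A V →ₗ[A] N)
    (hf : ∀ v, lam (f (BalancedTensor.tmul R _ 1 v)) =
      Q.ideal.mkQ 1 ⊗ₜ f (BalancedTensor.tmul R _ 1 v)) (z : BalancedTensor R (phi δ Q) A V) :
    lam (f z) = (f.restrictScalars R).lTensor _ (inducedCoaction hσ hδ Q V z) := by
  induction z using BalancedTensor.induction_on with
  | zero => simp
  | add x y hx hy => simp only [map_add, hx, hy]
  | tmul a v =>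
    rw [inducedCoaction_tmul, lTensor_diag hσ δ _ _ (Algebra.lsmul R R N) (f.restrictScalars R)
      (fun a m => by simp), BalancedTensor.tmul_eq_smul, map_smul, hlam, hf]
    rfl

theorem inducedMap_colinear [IsScalarTower R (phi δ Q) V] {V' : Type*} [AddCommGroup V']
    [Module R V'] [Module (phi δ Q) V'] [IsScalarTower R (phi δ Q) V'] (f : V →ₗ[phi δ Q] V')
    (z : BalancedTensor R (phi δ Q) A V) :
    inducedCoaction hσ hδ Q V' (inducedMap Q f z) =
      ((inducedMap Q f).restrictScalars R).lTensor _ (inducedCoaction hσ hδ Q V z) :=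
  inducedCoaction_colinear hσ hδ Q (isHopfModule_induced hσ hδ Q V').map_act (inducedMap Q f)
    (fun v => by rw [inducedMap_tmul, inducedCoaction_one_tmul]) z

end Induced

/-! ### The Hopf module `A ⊗ Q` -/

section Regular

variable {R H A : Type*} [CommRing R] [Ring H] [Bialgebra R H] [Ring A] [Algebra R A]
  {σ : H →ₗ[R] H} (hσ : IsSkewAntipode σ) {δ : A →ₐ[R] A ⊗[R] H}
  (hδ : IsRightCoaction δ.toLinearMap) (Q : GenQuot R H)

variable (R A) in
/-- `q ⊗ q' ↦ q ⊗ (1 ⊗ q')`. -/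
def insertOne : (H ⧸ Q.ideal) ⊗[R] (H ⧸ Q.ideal) →ₗ[R]
    (H ⧸ Q.ideal) ⊗[R] (A ⊗[R] (H ⧸ Q.ideal)) :=
  (TensorProduct.mk R A (H ⧸ Q.ideal) 1).lTensor (H ⧸ Q.ideal)

variable (δ) in
/-- The coaction `a ⊗ q ↦ q₍₁₎ σ(a₍₁₎) ⊗ a₍₀₎ ⊗ q₍₂₎` on `A ⊗ Q`. -/
def regularCoaction : A ⊗[R] (H ⧸ Q.ideal) →ₗ[R] (H ⧸ Q.ideal) ⊗[R] (A ⊗[R] (H ⧸ Q.ideal)) :=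
  TensorProduct.lift
    (LinearMap.lcomp R _ (insertOne R A Q ∘ₗ Coalgebra.comul (R := R)) ∘ₗ
      (diag hσ δ Q.isRightAction (Algebra.lsmul R R (A ⊗[R] (H ⧸ Q.ideal)))).toLinearMap)

theorem regularCoaction_tmul (a : A) (q : H ⧸ Q.ideal) :
    regularCoaction hσ δ Q (a ⊗ₜ q) =
      diag hσ δ Q.isRightAction (Algebra.lsmul R R (A ⊗[R] (H ⧸ Q.ideal))) a
        (insertOne R A Q (Coalgebra.comul (R := R) q)) := rfl

theorem regularCoaction_one_tmul (q : H ⧸ Q.ideal) :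
    regularCoaction hσ δ Q (1 ⊗ₜ q) = insertOne R A Q (Coalgebra.comul (R := R) q) := by
  rw [regularCoaction_tmul, map_one, Module.End.one_apply]

theorem regularCoaction_smul (a : A) (z : A ⊗[R] (H ⧸ Q.ideal)) :
    regularCoaction hσ δ Q (a • z) =
      diag hσ δ Q.isRightAction (Algebra.lsmul R R (A ⊗[R] (H ⧸ Q.ideal))) a
        (regularCoaction hσ δ Q z) := by
  induction z with
  | zero => simp
  | add x y hx hy => simp only [smul_add, map_add, hx, hy]
  | tmul b q =>
    rw [TensorProduct.smul_tmul', smul_eq_mul, regularCoaction_tmul, regularCoaction_tmul,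
      map_mul, Module.End.mul_apply]

theorem assoc_rTensor_comul_insertOne (y : (H ⧸ Q.ideal) ⊗[R] (H ⧸ Q.ideal)) :
    TensorProduct.assoc R _ _ _ ((Coalgebra.comul (R := R)).rTensor _ (insertOne R A Q y)) =
      (insertOne R A Q).lTensor _ (TensorProduct.assoc R _ _ _
        ((Coalgebra.comul (R := R)).rTensor _ y)) := by
  induction y with
  | zero => simp
  | add x y hx hy => simp only [map_add, hx, hy]
  | tmul q q' =>
    simp only [insertOne, LinearMap.lTensor_tmul, LinearMap.rTensor_tmul]
    generalize Coalgebra.comul (R := R) q = w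
    induction w with
    | zero => simp
    | add x y hx hy => simp only [map_add, TensorProduct.add_tmul, hx, hy]
    | tmul k k' => simp

theorem lTensor_regularCoaction_insertOne (y : (H ⧸ Q.ideal) ⊗[R] (H ⧸ Q.ideal)) :
    (regularCoaction hσ δ Q).lTensor _ (insertOne R A Q y) =
      (insertOne R A Q).lTensor _ ((Coalgebra.comul (R := R)).lTensor _ y) := by
  induction y with
  | zero => simp
  | add x y hx hy => simp only [map_add, hx, hy]
  | tmul q q' =>
    rw [LinearMap.lTensor_tmul, LinearMap.lTensor_tmul, ← regularCoaction_one_tmul]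
    rfl

include hδ in
theorem isHopfModule_regular : IsHopfModule hσ δ Q
    (Algebra.lsmul R R (A ⊗[R] (H ⧸ Q.ideal))) (regularCoaction hσ δ Q) := by
  refine isHopfModule_of_generators hσ δ Q _ hδ (regularCoaction_smul hσ Q)
    (Set.range fun q : H ⧸ Q.ideal => (1 : A) ⊗ₜ[R] q) ?_ ?_ ?_
  · intro p hp hZ
    rw [eq_top_iff]
    rintro z -
    induction z with
    | zero => exact p.zero_mem
    | add x y hx hy => exact p.add_mem hx hy
    | tmul a q => simpa [TensorProduct.smul_tmul'] using hp a _ (hZ ⟨q, rfl⟩)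
  · rintro _ ⟨q, rfl⟩
    dsimp only
    rw [regularCoaction_one_tmul, assoc_rTensor_comul_insertOne,
      lTensor_regularCoaction_insertOne, Coalgebra.coassoc_apply]
  · rintro _ ⟨q, rfl⟩
    dsimp only
    rw [regularCoaction_one_tmul, insertOne, ← LinearMap.comp_apply,
      LinearMap.rTensor_comp_lTensor, ← LinearMap.lTensor_comp_rTensor, LinearMap.comp_apply,
      Coalgebra.rTensor_counit_comul]
    rfl

variable (R A) in
/-- `(h ⊗ a) ⊗ k ↦ π(h) ⊗ (a ⊗ π(k))`. -/
def quotOuter : (H ⊗[R] A) ⊗[R] H →ₗ[R] (H ⧸ Q.ideal) ⊗[R] (A ⊗[R] (H ⧸ Q.ideal)) :=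
  TensorProduct.map Q.ideal.mkQ (Q.ideal.mkQ.lTensor A) ∘ₗ
    (TensorProduct.assoc R H A H).toLinearMap

theorem quotOuter_tmul (h k : H) (a : A) :
    quotOuter R A Q ((h ⊗ₜ a) ⊗ₜ k) = Q.ideal.mkQ h ⊗ₜ (a ⊗ₜ Q.ideal.mkQ k) := rfl

theorem diag_insertOne_mkQ_tmul (a : A) (h k : H) :
    diag hσ δ Q.isRightAction (Algebra.lsmul R R (A ⊗[R] (H ⧸ Q.ideal))) a
      (insertOne R A Q (Q.ideal.mkQ h ⊗ₜ Q.ideal.mkQ k)) =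
        quotOuter R A Q (flipTwist σ δ (a ⊗ₜ h) ⊗ₜ k) := by
  rw [flipTwist_tmul, diag_apply]
  generalize twist σ δ.toLinearMap a = w
  induction w with
  | zero => simp
  | add x y hx hy =>
    simp only [map_add, LinearMap.add_apply, mul_add, TensorProduct.add_tmul, hx, hy]
  | tmul g c =>
    rw [insertOne, LinearMap.lTensor_tmul, TensorProduct.mk_apply, tensorAct_tmul_tmul, Q.act_mkQ]
    simp [quotOuter_tmul, TensorProduct.smul_tmul']

theorem regularCoaction_lTensor_mkQ (x : A ⊗[R] H) :
    regularCoaction hσ δ Q (Q.ideal.mkQ.lTensor A x) =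
      quotOuter R A Q ((flipTwist σ δ).rTensor H ((TensorProduct.assoc R A H H).symm
        ((Coalgebra.comul (R := R)).lTensor A x))) := by
  induction x with
  | zero => simp
  | add x y hx hy => simp only [map_add, hx, hy]
  | tmul a h =>
    rw [LinearMap.lTensor_tmul, regularCoaction_tmul, LinearMap.lTensor_tmul]
    change diag hσ δ _ _ a (insertOne R A Q (TensorProduct.map Q.ideal.mkQ Q.ideal.mkQ
      (Coalgebra.comul (R := R) h))) = _
    generalize Coalgebra.comul (R := R) h = y
    induction y with
    | zero => simp
    | add x y hx hy => simp only [map_add, TensorProduct.tmul_add, hx, hy]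
    | tmul h k =>
      rw [TensorProduct.assoc_symm_tmul, LinearMap.rTensor_tmul, TensorProduct.map_tmul,
        diag_insertOne_mkQ_tmul]

include hσ hδ in
theorem quotOuter_flipTwist_coaction (x : A ⊗[R] H) :
    quotOuter R A Q ((flipTwist σ δ).rTensor H (δ.toLinearMap.rTensor H x)) =
      Q.ideal.mkQ 1 ⊗ₜ Q.ideal.mkQ.lTensor A x := by
  induction x with
  | zero => simp
  | add x y hx hy => simp only [map_add, TensorProduct.tmul_add, hx, hy]
  | tmul a h =>
    rw [LinearMap.rTensor_tmul, LinearMap.rTensor_tmul, AlgHom.toLinearMap_apply,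
      coaction_mul_twist hσ hδ (flipTwist_tmul δ), quotOuter_tmul, LinearMap.lTensor_tmul]

include hδ in
theorem regularCoaction_quotCoaction (b : A) :
    regularCoaction hσ δ Q (quotCoaction δ Q b) = Q.ideal.mkQ 1 ⊗ₜ quotCoaction δ Q b := by
  change regularCoaction hσ δ Q (Q.ideal.mkQ.lTensor A (δ.toLinearMap b)) =
    Q.ideal.mkQ 1 ⊗ₜ Q.ideal.mkQ.lTensor A (δ.toLinearMap b)
  rw [regularCoaction_lTensor_mkQ, ← hδ.rTensor_apply, quotOuter_flipTwist_coaction hσ hδ]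

variable (R A) in
/-- `a ⊗ q ↦ a ε(q)`. -/
def regularCounit : A ⊗[R] (H ⧸ Q.ideal) →ₗ[R] A :=
  (TensorProduct.rid R A).toLinearMap ∘ₗ (Coalgebra.counit (R := R)).lTensor A

theorem regularCounit_smul (a : A) (z : A ⊗[R] (H ⧸ Q.ideal)) :
    regularCounit R A Q (a • z) = a • regularCounit R A Q z := by
  induction z with
  | zero => simp
  | add x y hx hy => simp only [map_add, smul_add, hx, hy]
  | tmul b q => simp [regularCounit, TensorProduct.smul_tmul']

theorem lTensor_regularCounit_insertOne_comul (q : H ⧸ Q.ideal) :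
    (regularCounit R A Q).lTensor _ (insertOne R A Q (Coalgebra.comul (R := R) q)) =
      q ⊗ₜ 1 := by
  have counit_one_tmul : regularCounit R A Q ∘ₗ TensorProduct.mk R A (H ⧸ Q.ideal) 1 =
      LinearMap.toSpanSingleton R A 1 ∘ₗ Coalgebra.counit (R := R) := by
    ext h
    simp [regularCounit]
  rw [insertOne, ← LinearMap.lTensor_comp_apply, counit_one_tmul, LinearMap.lTensor_comp_apply,
    Coalgebra.lTensor_counit_comul]
  simp

include hδ in
theorem quotFlip_lTensor_regularCounit (z : A ⊗[R] (H ⧸ Q.ideal)) :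
    quotFlip δ Q ((regularCounit R A Q).lTensor _ (regularCoaction hσ δ Q z)) = z := by
  induction z with
  | zero => simp
  | add x y hx hy => simp only [map_add, hx, hy]
  | tmul a q =>
    rw [regularCoaction_tmul, lTensor_diag hσ δ _ _ (Algebra.lsmul R R A) _
      (regularCounit_smul Q), lTensor_regularCounit_insertOne_comul, quotFlip_diag hσ δ Q hδ]

include hδ in
theorem eq_quotCoaction_of_regularCoaction {z : A ⊗[R] (H ⧸ Q.ideal)}
    (hz : regularCoaction hσ δ Q z = Q.ideal.mkQ 1 ⊗ₜ z) : ∃ b, quotCoaction δ Q b = z := by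
  refine ⟨regularCounit R A Q z, ?_⟩
  rw [← quotFlip_one_tmul, ← LinearMap.lTensor_tmul, ← hz,
    quotFlip_lTensor_regularCounit hσ hδ]

end Regular

/-! ### Descent for coinvariants under faithful coflatness -/

section Zero

variable {R H A : Type u} [CommRing R] [Ring H] [Bialgebra R H] [Ring A] [Algebra R A]
  {σ : H →ₗ[R] H} (hσ : IsSkewAntipode σ) {δ : A →ₐ[R] A ⊗[R] H} {Q : GenQuot R H}

theorem isHopfModule_punit : IsHopfModule hσ δ Q (Algebra.lsmul R R (PUnit : Type u)) 0 where
  coaction :=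
    { coassoc := LinearMap.ext fun x => by rw [Subsingleton.elim x 0, map_zero, map_zero]
      counit := LinearMap.ext fun x => by rw [Subsingleton.elim x 0, map_zero, map_zero] }
  map_act a m := by simp

variable (hδ : IsRightCoaction δ.toLinearMap) (hG : IsHopfGalois δ)
  (hB : IsRightFaithfullyFlat R (coinvariants δ) A)
  (hQ : IsRightFaithfullyCoflat (Q.ideal.mkQ.lTensor H ∘ₗ Coalgebra.comul (R := R) (A := H)))
  {M₁ M₂ : Type u} [AddCommGroup M₁] [AddCommGroup M₂] [Module R M₁] [Module R M₂]
  [Module A M₁] [Module A M₂] [IsScalarTower R A M₁] [IsScalarTower R A M₂]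
  {lam₁ : M₁ →ₗ[R] (H ⧸ Q.ideal) ⊗[R] M₁} {lam₂ : M₂ →ₗ[R] (H ⧸ Q.ideal) ⊗[R] M₂}
  (h₁ : IsHopfModule hσ δ Q (Algebra.lsmul R R M₁) lam₁)
  (h₂ : IsHopfModule hσ δ Q (Algebra.lsmul R R M₂) lam₂) (f : M₁ →ₗ[A] M₂)
  (hf : ∀ m, lam₂ (f m) = (f.restrictScalars R).lTensor _ (lam₁ m))

include hδ hG hB hQ h₁ h₂ hf

theorem hopfModule_surjective_iff : Function.Surjective f ↔
    ∀ y, lam₂ y = Q.ideal.mkQ 1 ⊗ₜ y → ∃ x, lam₁ x = Q.ideal.mkQ 1 ⊗ₜ x ∧ f x = y := by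
  have h := hopfModule_exact_iff hσ hδ hG hB hQ h₁ h₂ (isHopfModule_punit hσ) f
    (0 : M₂ →ₗ[A] (PUnit : Type u)) hf (fun m => by simp)
  have exact_zero_iff : Function.Exact f (0 : M₂ →ₗ[A] (PUnit : Type u)) ↔
      Function.Surjective f :=
    ⟨fun h y => (h y).1 rfl, fun h y => ⟨fun _ => h y, fun _ => rfl⟩⟩
  rw [← exact_zero_iff, h]
  exact forall₂_congr fun _ _ => ⟨fun h => h.1 rfl, fun h => ⟨fun _ => h, fun _ => rfl⟩⟩

theorem hopfModule_injective_iff : Function.Injective f ↔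
    ∀ x, lam₁ x = Q.ideal.mkQ 1 ⊗ₜ x → f x = 0 → x = 0 := by
  have h := hopfModule_exact_iff hσ hδ hG hB hQ (isHopfModule_punit hσ) h₁ h₂
    (0 : (PUnit : Type u) →ₗ[A] M₁) f (fun m => by simp) hf
  have exact_zero_iff : Function.Exact (0 : (PUnit : Type u) →ₗ[A] M₁) f ↔
      Function.Injective f := by
    rw [injective_iff_map_eq_zero]
    constructor
    · intro h x hx
      obtain ⟨y, rfl⟩ := (h x).1 hx
      rfl
    · intro h x
      refine ⟨fun hx => ⟨0, (h x hx).symm⟩, ?_⟩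
      rintro ⟨y, rfl⟩
      exact map_zero f
  rw [← exact_zero_iff, h]
  refine forall₂_congr fun x hx => ⟨fun h h0 => ?_, fun h => ⟨fun h0 => ⟨0, ?_, (h h0).symm⟩, ?_⟩⟩
  · obtain ⟨y, -, hy⟩ := h.1 h0
    exact hy.symm
  · rw [LinearMap.zero_apply, TensorProduct.tmul_zero]
  · rintro ⟨y, -, rfl⟩
    exact map_zero f

end Zero

section Descent

variable {R H A : Type u} [CommRing R] [Ring H] [Bialgebra R H] [Ring A] [Algebra R A]
  {σ : H →ₗ[R] H} (hσ : IsSkewAntipode σ) {δ : A →ₐ[R] A ⊗[R] H} {Q : GenQuot R H}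
  (hδ : IsRightCoaction δ.toLinearMap)

/-- The coordinates of an element of `A ⊗_S S^{(ι)}`. -/
def coord (S : Subalgebra R A) {ι : Type*} (i : ι) :
    BalancedTensor R S A (ι →₀ S) →ₗ[A] A where
  toFun := BalancedTensor.lift (LinearMap.mk₂ R (fun a p => a * (p i : A))
    (fun _ _ _ => add_mul _ _ _) (fun _ _ _ => smul_mul_assoc _ _ _)
    (fun _ _ _ => by simp [mul_add]) (fun _ _ _ => by simp))
    (fun a s p => by simp [op_smul_eq_mul, mul_assoc])
  map_add' := map_add _
  map_smul' a z := by
    induction z using BalancedTensor.induction_on with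
    | zero => simp
    | add x y hx hy => simp only [smul_add, map_add, hx, hy]
    | tmul b p => exact mul_assoc a b (p i : A)

theorem coord_tmul {S : Subalgebra R A} {ι : Type*} (i : ι) (a : A) (p : ι →₀ S) :
    coord S i (BalancedTensor.tmul R S a p) = a * (p i : A) := rfl

theorem exists_sum_coord {S : Subalgebra R A} {ι : Type*} (z : BalancedTensor R S A (ι →₀ S)) :
    ∃ t : Finset ι, ∀ t', t ⊆ t' → z = ∑ i ∈ t',
      BalancedTensor.tmul R S (coord S i z) (Finsupp.single i (1 : S)) := by
  classical
  induction z using BalancedTensor.induction_on with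
  | zero => exact ⟨∅, fun t' _ => by simp [BalancedTensor.tmul]⟩
  | add x y hx hy =>
    obtain ⟨t, ht⟩ := hx
    obtain ⟨u, hu⟩ := hy
    refine ⟨t ∪ u, fun t' h => ?_⟩
    conv_lhs => rw [ht t' (Finset.union_subset_left h), hu t' (Finset.union_subset_right h)]
    simp only [map_add, BalancedTensor.add_tmul, Finset.sum_add_distrib]
  | tmul a p =>
    refine ⟨p.support, fun t' h => ?_⟩
    have hp : p = ∑ i ∈ t', p i • Finsupp.single i (1 : S) := by
      conv_lhs => rw [← Finsupp.sum_single p]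
      rw [Finsupp.sum_of_support_subset p h _ (fun i _ => Finsupp.single_zero i)]
      simp
    conv_lhs => rw [hp, ← BalancedTensor.mkRight_apply, map_sum]
    refine Finset.sum_congr rfl fun i _ => ?_
    rw [BalancedTensor.mkRight_apply, ← BalancedTensor.op_smul_tmul, op_smul_eq_mul, coord_tmul]

theorem coord_mem_phi {ι : Type u} {z : BalancedTensor R (phi δ Q) A (ι →₀ phi δ Q)}
    (hz : inducedCoaction hσ hδ Q _ z = Q.ideal.mkQ 1 ⊗ₜ z) (i : ι) :
    coord (phi δ Q) i z ∈ phi δ Q := by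
  have h := inducedCoaction_colinear hσ hδ Q
    (lam := Q.ideal.mkQ.rTensor A ∘ₗ twist σ δ.toLinearMap) (N := A)
    (fun a n => by
      simp only [LinearMap.comp_apply, ← diag_one_tmul_one hσ, smul_eq_mul, map_mul]
      rfl) (coord (phi δ Q) i) (fun p => by
        rw [coord_tmul, one_mul]
        exact (mem_phi_iff_twist hσ δ Q hδ _).1 (p i).2) z
  rw [hz] at h
  exact (mem_phi_iff_twist hσ δ Q hδ _).2 h

theorem exists_one_tmul_of_free {ι : Type u}
    {z : BalancedTensor R (phi δ Q) A (ι →₀ phi δ Q)}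
    (hz : inducedCoaction hσ hδ Q _ z = Q.ideal.mkQ 1 ⊗ₜ z) :
    ∃ p, BalancedTensor.tmul R _ 1 p = z := by
  obtain ⟨t, ht⟩ := exists_sum_coord z
  refine ⟨∑ i ∈ t, (⟨coord (phi δ Q) i z, coord_mem_phi hσ hδ hz i⟩ : phi δ Q) •
    Finsupp.single i (1 : phi δ Q), ?_⟩
  conv_rhs => rw [ht t subset_rfl]
  rw [← BalancedTensor.mkRight_apply, map_sum]
  refine Finset.sum_congr rfl fun i _ => ?_
  rw [BalancedTensor.mkRight_apply, ← BalancedTensor.op_smul_tmul, op_smul_eq_mul, one_mul]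

theorem eq_zero_of_free {S : Subalgebra R A} {ι : Type*} {p : ι →₀ S}
    (hp : BalancedTensor.tmul R S (1 : A) p = 0) : p = 0 := by
  ext i
  have := congrArg (coord S i) hp
  rw [coord_tmul, one_mul, map_zero] at this
  exact this

variable (hG : IsHopfGalois δ) (hB : IsRightFaithfullyFlat R (coinvariants δ) A)
  (hQ : IsRightFaithfullyCoflat (Q.ideal.mkQ.lTensor H ∘ₗ Coalgebra.comul (R := R) (A := H)))

include hG hB hQ

theorem exists_one_tmul {V : Type u} [AddCommGroup V] [Module R V] [Module (phi δ Q) V]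
    [IsScalarTower R (phi δ Q) V] {z : BalancedTensor R (phi δ Q) A V}
    (hz : inducedCoaction hσ hδ Q _ z = Q.ideal.mkQ 1 ⊗ₜ z) :
    ∃ v, BalancedTensor.tmul R _ 1 v = z := by
  let p : (V →₀ phi δ Q) →ₗ[phi δ Q] V := Finsupp.linearCombination (phi δ Q) id
  have hp : Function.Surjective p := Finsupp.linearCombination_id_surjective _ _
  obtain ⟨x, hx, rfl⟩ := (hopfModule_surjective_iff hσ hδ hG hB hQ
    (isHopfModule_induced hσ hδ Q _) (isHopfModule_induced hσ hδ Q _) (inducedMap Q p)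
    (inducedMap_colinear hσ hδ Q p)).1 (BalancedTensor.mapRight_surjective hp) z hz
  obtain ⟨q, rfl⟩ := exists_one_tmul_of_free hσ hδ hx
  exact ⟨p q, (inducedMap_tmul Q p 1 q).symm⟩

include hσ hδ in
theorem eq_zero_of_one_tmul_of_exact {K V ι : Type u} [AddCommGroup K] [Module R K]
    [Module (phi δ Q) K] [IsScalarTower R (phi δ Q) K] [AddCommGroup V] [Module R V]
    [Module (phi δ Q) V] [IsScalarTower R (phi δ Q) V] {i : K →ₗ[phi δ Q] (ι →₀ phi δ Q)}
    {p : (ι →₀ phi δ Q) →ₗ[phi δ Q] V} (hip : Function.Exact i p) (hp : Function.Surjective p)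
    {v : V} (hv : BalancedTensor.tmul R (phi δ Q) (1 : A) v = 0) : v = 0 := by
  have hex : Function.Exact (inducedMap (δ := δ) Q i) (inducedMap (δ := δ) Q p) :=
    BalancedTensor.mapRight_exact hip hp
  have h := (hopfModule_exact_iff hσ hδ hG hB hQ (isHopfModule_induced hσ hδ Q K)
    (isHopfModule_induced hσ hδ Q _) (isHopfModule_induced hσ hδ Q V) (inducedMap Q i)
    (inducedMap Q p) (inducedMap_colinear hσ hδ Q i) (inducedMap_colinear hσ hδ Q p)).1 hex
  obtain ⟨q, rfl⟩ := hp v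
  obtain ⟨x, hx, hxq⟩ := (h _ (inducedCoaction_one_tmul hσ hδ Q _ q)).1
    ((inducedMap_tmul Q p 1 q).trans hv)
  obtain ⟨k, rfl⟩ := exists_one_tmul hσ hδ hG hB hQ hx
  rw [inducedMap_tmul] at hxq
  have hk : i k - q = 0 := by
    apply eq_zero_of_free (R := R)
    rw [← BalancedTensor.mkRight_apply, map_sub, BalancedTensor.mkRight_apply,
      BalancedTensor.mkRight_apply, hxq, sub_self]
  rw [← sub_eq_zero.1 hk]
  exact (hip _).2 ⟨k, rfl⟩

include hσ hδ in
theorem eq_zero_of_one_tmul {V : Type u} [AddCommGroup V] [Module R V] [Module (phi δ Q) V]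
    [IsScalarTower R (phi δ Q) V] {v : V}
    (hv : BalancedTensor.tmul R (phi δ Q) (1 : A) v = 0) : v = 0 :=
  eq_zero_of_one_tmul_of_exact
    (K := LinearMap.ker (Finsupp.linearCombination (phi δ Q) (id : V → V))) hσ hδ hG hB hQ
    (LinearMap.exact_subtype_ker_map (Finsupp.linearCombination (phi δ Q) (id : V → V)))
    (Finsupp.linearCombination_id_surjective _ _) hv

include hσ hδ in
theorem one_tmul_injective (V : Type u) [AddCommGroup V] [Module R V] [Module (phi δ Q) V]
    [IsScalarTower R (phi δ Q) V] :
    Function.Injective (BalancedTensor.tmul R (phi δ Q) (1 : A) : V → _) := by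
  intro v v' hv
  refine sub_eq_zero.1 (eq_zero_of_one_tmul hσ hδ hG hB hQ ?_)
  rw [← BalancedTensor.mkRight_apply, map_sub, BalancedTensor.mkRight_apply,
    BalancedTensor.mkRight_apply, hv, sub_self]

include hσ hδ in
theorem isRightFaithfullyFlat_phi : IsRightFaithfullyFlat R (phi δ Q) A := by
  intro X Y Z _ _ _ _ _ _ _ _ _ _ _ _ f g
  refine Iff.trans ?_ (hopfModule_exact_iff hσ hδ hG hB hQ (isHopfModule_induced hσ hδ Q X)
    (isHopfModule_induced hσ hδ Q Y) (isHopfModule_induced hσ hδ Q Z) (inducedMap Q f)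
    (inducedMap Q g) (inducedMap_colinear hσ hδ Q f) (inducedMap_colinear hσ hδ Q g)).symm
  have map_one_tmul_eq_zero_iff (y : Y) :
      inducedMap Q g (BalancedTensor.tmul R _ 1 y) = 0 ↔ g y = 0 := by
    rw [inducedMap_tmul]
    refine ⟨eq_zero_of_one_tmul hσ hδ hG hB hQ, fun h => ?_⟩
    rw [h, BalancedTensor.tmul_zero]
  have coinvariant_preimage_iff (y : Y) :
      (∃ x, inducedCoaction hσ hδ Q X x = Q.ideal.mkQ 1 ⊗ₜ x ∧
        inducedMap Q f x = BalancedTensor.tmul R _ 1 y) ↔ y ∈ Set.range f := by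
    constructor
    · rintro ⟨x, hx, hxy⟩
      obtain ⟨x, rfl⟩ := exists_one_tmul hσ hδ hG hB hQ hx
      rw [inducedMap_tmul] at hxy
      exact ⟨x, one_tmul_injective hσ hδ hG hB hQ Y hxy⟩
    · rintro ⟨x, rfl⟩
      exact ⟨_, inducedCoaction_one_tmul hσ hδ Q X x, inducedMap_tmul Q f 1 x⟩
  constructor
  · intro hfg z hz
    obtain ⟨y, rfl⟩ := exists_one_tmul hσ hδ hG hB hQ hz
    rw [map_one_tmul_eq_zero_iff, coinvariant_preimage_iff]
    exact hfg y
  · intro H y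
    rw [← map_one_tmul_eq_zero_iff, ← coinvariant_preimage_iff]
    exact H _ (inducedCoaction_one_tmul hσ hδ Q Y y)

omit hG hB hQ

theorem canonicalMap_smul {C : Type*} [AddCommGroup C] [Module R C] (d : A →ₗ[R] A ⊗[R] C)
    (S : Subalgebra R A) (hd : ∀ s ∈ S, ∀ b, d (s * b) = s • d b) (a : A)
    (z : BalancedTensor R S A A) :
    canonicalMap d S hd (a • z) = a • canonicalMap d S hd z := by
  induction z using BalancedTensor.induction_on with
  | zero => simp
  | add x y hx hy => simp only [smul_add, map_add, hx, hy]
  | tmul b c => rw [BalancedTensor.smul_tmul, canonicalMap_tmul, canonicalMap_tmul, mul_smul]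

include hδ in
theorem quotCoaction_injective (Q : GenQuot R H) : Function.Injective (quotCoaction δ Q) := by
  have lTensor_counit (b : A) :
      (Coalgebra.counit (R := R) (A := H ⧸ Q.ideal)).lTensor A (quotCoaction δ Q b) =
        b ⊗ₜ 1 := by
    rw [quotCoaction, LinearMap.comp_apply, ← LinearMap.lTensor_comp_apply]
    exact hδ.lTensor_counit_apply b
  intro b c hbc
  have := congrArg (TensorProduct.rid R A)
    ((lTensor_counit b).symm.trans ((congrArg _ hbc).trans (lTensor_counit c)))
  simpa using this

include hσ hδ hG hB hQ in
theorem canonicalMap_phi_bijective : Function.Bijective (canonicalMap (quotCoaction δ Q) (phi δ Q)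
    (quotCoaction_mul_of_mem δ Q le_rfl)) := by
  let κ : BalancedTensor R (phi δ Q) A A →ₗ[A] A ⊗[R] (H ⧸ Q.ideal) :=
    { toFun := canonicalMap (quotCoaction δ Q) (phi δ Q) (quotCoaction_mul_of_mem δ Q le_rfl)
      map_add' := map_add _
      map_smul' := canonicalMap_smul _ _ (quotCoaction_mul_of_mem δ Q le_rfl) }
  have κ_one_tmul (b : A) : κ (BalancedTensor.tmul R _ 1 b) = quotCoaction δ Q b :=
    (canonicalMap_tmul (quotCoaction δ Q) (phi δ Q)
      (quotCoaction_mul_of_mem δ Q le_rfl) 1 b).trans (one_smul _ _)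
  have regular := isHopfModule_regular hσ hδ Q
  have κ_colinear := inducedCoaction_colinear hσ hδ Q regular.map_act κ (fun b => by
    rw [κ_one_tmul, regularCoaction_quotCoaction hσ hδ])
  constructor
  · refine (hopfModule_injective_iff hσ hδ hG hB hQ (isHopfModule_induced hσ hδ Q A) regular κ
      κ_colinear).2 fun x hx hx0 => ?_
    obtain ⟨b, rfl⟩ := exists_one_tmul hσ hδ hG hB hQ hx
    rw [κ_one_tmul] at hx0
    rw [quotCoaction_injective hδ Q (hx0.trans (map_zero _).symm), BalancedTensor.tmul_zero]
  · refine (hopfModule_surjective_iff hσ hδ hG hB hQ (isHopfModule_induced hσ hδ Q A) regular κ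
      κ_colinear).2 fun y hy => ?_
    obtain ⟨b, rfl⟩ := eq_quotCoaction_of_regularCoaction hσ hδ Q hy
    exact ⟨_, inducedCoaction_one_tmul hσ hδ Q A b, κ_one_tmul b⟩

end Descent

/-! ### The Galois correspondence for right admissible objects -/

section Connection

variable {R H A : Type*} [CommRing R] [Ring H] [Algebra R H] [Ring A] [Algebra R A]
  [Coalgebra R H] {δ : A →ₐ[R] A ⊗[R] H}

theorem le_psi {S : Subalgebra R A} {Q : GenQuot R H} (h : S ≤ phi δ Q) : Q ≤ psi δ S :=
  (GenQuot.isLUB_sSup _).1 h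

theorem coinvariants_le_phi (Q : GenQuot R H) : coinvariants δ ≤ phi δ Q := by
  intro a ha
  have coaction_eq : δ a = a ⊗ₜ[R] 1 := ha
  change Q.ideal.mkQ.lTensor A (δ a) = _
  rw [coaction_eq, LinearMap.lTensor_tmul]

theorem quotCoaction_one (Q : GenQuot R H) : quotCoaction δ Q 1 = 1 ⊗ₜ Q.ideal.mkQ 1 := by
  change Q.ideal.mkQ.lTensor A (δ 1) = _
  rw [map_one, Algebra.TensorProduct.one_def, LinearMap.lTensor_tmul]

omit [Coalgebra R H] in
theorem assoc_rTensor_lTensor_coaction {Q' Q'' : Type*} [AddCommGroup Q'] [Module R Q']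
    [AddCommGroup Q''] [Module R Q''] (q : H →ₗ[R] Q') (q' : H →ₗ[R] Q'') (x : A ⊗[R] H) :
    TensorProduct.assoc R A Q' Q''
      ((q.lTensor A ∘ₗ δ.toLinearMap).rTensor Q'' (q'.lTensor A x)) =
      (TensorProduct.map q q').lTensor A
        (TensorProduct.assoc R A H H (δ.toLinearMap.rTensor H x)) := by
  induction x with
  | zero => simp
  | add x y hx hy => simp only [map_add, hx, hy]
  | tmul a h =>
    simp only [LinearMap.lTensor_tmul, LinearMap.rTensor_tmul, LinearMap.comp_apply]
    generalize δ.toLinearMap a = y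
    induction y with
    | zero => simp
    | add x y hx hy => simp only [map_add, TensorProduct.add_tmul, hx, hy]
    | tmul b k => simp

theorem assoc_rTensor_quotCoaction {Q' : Type*} [AddCommGroup Q'] [Module R Q']
    (q : H →ₗ[R] Q') (Q : GenQuot R H) (hδ : IsRightCoaction δ.toLinearMap) :
    (TensorProduct.assoc R A Q' (H ⧸ Q.ideal)).toLinearMap ∘ₗ
      (q.lTensor A ∘ₗ δ.toLinearMap).rTensor (H ⧸ Q.ideal) ∘ₗ quotCoaction δ Q =
      (TensorProduct.map q Q.ideal.mkQ ∘ₗ Coalgebra.comul (R := R) (A := H)).lTensor A ∘ₗ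
        δ.toLinearMap := by
  ext a
  have coassoc := LinearMap.congr_fun hδ.coassoc a
  simp only [LinearMap.comp_apply, LinearEquiv.coe_coe] at coassoc
  simp only [LinearMap.comp_apply, LinearEquiv.coe_coe, quotCoaction,
    assoc_rTensor_lTensor_coaction, coassoc, LinearMap.lTensor_comp]

theorem restrictsToBijection_of_forall {R H A : Type u} [CommRing R] [Ring H] [Algebra R H]
    [Coalgebra R H] [Ring A] [Algebra R A] {δ : A →ₐ[R] A ⊗[R] H} {s : Set (Subalgebra R A)}
    {t : Set (GenQuot R H)} (hs : ∀ S ∈ s, psi δ S ∈ t ∧ phi δ (psi δ S) = S)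
    (ht : ∀ Q ∈ t, phi δ Q ∈ s ∧ psi δ (phi δ Q) = Q) : RestrictsToBijection δ s t := by
  have invOn : Set.InvOn (phi δ) (psi δ) s t :=
    ⟨fun S hS => (hs S hS).2, fun Q hQ => (ht Q hQ).2⟩
  have mapsTo_psi : Set.MapsTo (psi δ) s t := fun S hS => (hs S hS).1
  have mapsTo_phi : Set.MapsTo (phi δ) t s := fun Q hQ => (ht Q hQ).1
  exact ⟨invOn.bijOn mapsTo_psi mapsTo_phi, invOn.symm.bijOn mapsTo_phi mapsTo_psi, invOn⟩

end Connection

section Regular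

variable {R C : Type*} [CommRing R] [AddCommGroup C] [Module R C] [Coalgebra R C]

variable (C) in
/-- `c ⊗ x ↦ ε(c) x`. -/
def counitLeft (X : Type*) [AddCommGroup X] [Module R X] : C ⊗[R] X →ₗ[R] X :=
  (TensorProduct.lid R X).toLinearMap ∘ₗ (Coalgebra.counit (R := R)).rTensor X

variable {X : Type*} [AddCommGroup X] [Module R X]

theorem counitLeft_tmul (c : C) (x : X) :
    counitLeft C X (c ⊗ₜ[R] x) = Coalgebra.counit (R := R) c • x := by
  simp [counitLeft]

theorem counitLeft_lTensor {Y : Type*} [AddCommGroup Y] [Module R Y] (f : X →ₗ[R] Y)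
    (z : C ⊗[R] X) : counitLeft C Y (f.lTensor C z) = f (counitLeft C X z) := by
  induction z with
  | zero => simp
  | add x y hx hy => simp only [map_add, hx, hy]
  | tmul c x => simp [counitLeft_tmul]

theorem counitLeft_coaction {ρ : X →ₗ[R] C ⊗[R] X} (hρ : IsLeftCoaction ρ) (x : X) :
    counitLeft C X (ρ x) = x := by
  have := congrArg (TensorProduct.lid R X) (LinearMap.congr_fun hρ.counit x)
  simpa [counitLeft] using this

theorem counitLeft_assoc (y : (C ⊗[R] C) ⊗[R] X) :
    counitLeft C (C ⊗[R] X) (TensorProduct.assoc R C C X y) = (counitLeft C C).rTensor X y := by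
  induction y with
  | zero => simp
  | add x y hx hy => simp only [map_add, hx, hy]
  | tmul c x =>
    induction c with
    | zero => simp
    | add x y hx hy => simp only [map_add, TensorProduct.add_tmul, hx, hy]
    | tmul c d => simp [counitLeft_tmul, TensorProduct.smul_tmul']

theorem isLeftCoaction_comul : IsLeftCoaction (Coalgebra.comul (R := R) (A := C)) :=
  ⟨Coalgebra.coassoc, Coalgebra.rTensor_counit_comp_comul⟩

theorem counitLeft_assoc_rTensor_comul (z : C ⊗[R] X) :
    counitLeft C (C ⊗[R] X)
      (TensorProduct.assoc R C C X ((Coalgebra.comul (R := R)).rTensor X z)) = z := by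
  have counitLeft_comul : counitLeft C C ∘ₗ Coalgebra.comul (R := R) = LinearMap.id :=
    LinearMap.ext (counitLeft_coaction isLeftCoaction_comul)
  rw [counitLeft_assoc, ← LinearMap.rTensor_comp_apply, counitLeft_comul, LinearMap.rTensor_id,
    LinearMap.id_apply]

/-- `X ≅ C □_C X`, with inverse `counitLeft`. -/
def regularCotensorEquiv {ρ : X →ₗ[R] C ⊗[R] X} (hρ : IsLeftCoaction ρ) :
    X ≃ₗ[R] cotensor (Coalgebra.comul (R := R) (A := C)) ρ where
  __ := ρ.codRestrict _ fun x => LinearMap.congr_fun hρ.coassoc x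
  invFun z := counitLeft C X z.1
  left_inv := counitLeft_coaction hρ
  right_inv z := Subtype.ext <| by
    change ρ (counitLeft C X z.1) = z.1
    have mem_cotensor : TensorProduct.assoc R C C X ((Coalgebra.comul (R := R)).rTensor X z.1) =
        ρ.lTensor C z.1 := z.2
    rw [← counitLeft_lTensor, ← mem_cotensor, counitLeft_assoc_rTensor_comul]

theorem regularCotensor_exact_iff {X Y Z : Type*} [AddCommGroup X] [AddCommGroup Y]
    [AddCommGroup Z] [Module R X] [Module R Y] [Module R Z]
    {ρX : X →ₗ[R] C ⊗[R] X} {ρY : Y →ₗ[R] C ⊗[R] Y} {ρZ : Z →ₗ[R] C ⊗[R] Z}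
    (hX : IsLeftCoaction ρX) (hY : IsLeftCoaction ρY) (hZ : IsLeftCoaction ρZ)
    (f : X →ₗ[R] Y) (g : Y →ₗ[R] Z)
    (hf : ρY ∘ₗ f = f.lTensor C ∘ₗ ρX) (hg : ρZ ∘ₗ g = g.lTensor C ∘ₗ ρY) :
    Function.Exact (cotensorMapRight (Coalgebra.comul (R := R) (A := C)) f hf)
      (cotensorMapRight (Coalgebra.comul (R := R) (A := C)) g hg) ↔ Function.Exact f g :=
  Function.Exact.iff_of_ladder_linearEquiv (e₁ := regularCotensorEquiv hX)
    (e₂ := regularCotensorEquiv hY) (e₃ := regularCotensorEquiv hZ)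
    (LinearMap.ext fun x => Subtype.ext (LinearMap.congr_fun hf x).symm)
    (LinearMap.ext fun x => Subtype.ext (LinearMap.congr_fun hg x).symm)

end Regular

section Correspondence

variable {R H A : Type u} [CommRing R] [Ring H] [Bialgebra R H] [Ring A] [Algebra R A]
  {δ : A →ₐ[R] A ⊗[R] H}

theorem phi_psi_of_isRightAdmissible {S : Subalgebra R A} (hS : IsRightAdmissible δ S) :
    phi δ (psi δ S) = S := by
  obtain ⟨hle, hbij⟩ := hS.can_bijective
  refine le_antisymm (fun a ha => hS.faithfullyFlat.mem_of_one_tmul_eq_tmul_one (hbij.1 ?_)) hle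
  have coaction_eq : quotCoaction δ (psi δ S) a = a ⊗ₜ[R] (psi δ S).ideal.mkQ 1 := ha
  rw [canonicalMap_tmul, canonicalMap_tmul, coaction_eq, quotCoaction_one, one_smul,
    TensorProduct.smul_tmul', smul_eq_mul, mul_one]

theorem isRightAdmissible_psi [Module.FaithfullyFlat R A] (hδ : IsRightCoaction δ.toLinearMap)
    (hG : IsHopfGalois δ) (hB : IsRightFaithfullyFlat R (coinvariants δ) A)
    {S : Subalgebra R A} (hS : IsRightAdmissible δ S) : (psi δ S).IsRightAdmissible := by
  refine ⟨hS.flat, ?_⟩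
  obtain ⟨hle, hbij⟩ := hS.can_bijective
  intro X Y Z _ _ _ _ _ _ ρX ρY ρZ hX hY hZ f g hf hg
  have exact_iff_overA := cotensor_exact_iff (coaction_mul_of_mem δ)
    (quotCoaction_mul_of_mem δ (psi δ S) (coinvariants_le_phi _))
    (ρC := (psi δ S).ideal.mkQ.lTensor H ∘ₗ Coalgebra.comul (R := R) (A := H)) (by
      have := assoc_rTensor_quotCoaction LinearMap.id (psi δ S) hδ
      rwa [LinearMap.lTensor_id, LinearMap.id_comp] at this) hB hG f g hf hg
  have exact_iff_overQuot := cotensor_exact_iff (quotCoaction_mul_of_mem δ (psi δ S) hle)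
    (quotCoaction_mul_of_mem δ (psi δ S) hle)
    (ρC := Coalgebra.comul (R := R) (A := H ⧸ (psi δ S).ideal)) (by
      refine (assoc_rTensor_quotCoaction (psi δ S).ideal.mkQ (psi δ S) hδ).trans ?_
      rw [quotCoaction, ← LinearMap.comp_assoc, ← LinearMap.lTensor_comp]
      rfl) hS.faithfullyFlat hbij f g hf hg
  exact (regularCotensor_exact_iff hX hY hZ f g hf hg).symm.trans
    (exact_iff_overQuot.symm.trans exact_iff_overA)

omit [Ring H] [Bialgebra R H] in
theorem canonicalMap_lTensor_comp_mkQ {C C' : Type*} [AddCommGroup C] [Module R C]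
    [AddCommGroup C'] [Module R C'] (q : C →ₗ[R] C') {d : A →ₗ[R] A ⊗[R] C}
    {S S' : Subalgebra R A} (hd : ∀ s ∈ S, ∀ b, d (s * b) = s • d b)
    (hd' : ∀ s ∈ S', ∀ b, (q.lTensor A ∘ₗ d) (s * b) = s • (q.lTensor A ∘ₗ d) b)
    (w : A ⊗[R] A) :
    canonicalMap (q.lTensor A ∘ₗ d) S' hd' ((balancedRel R S' A A).mkQ w) =
      q.lTensor A (canonicalMap d S hd ((balancedRel R S A A).mkQ w)) := by
  induction w with
  | zero => simp
  | add x y hx hy => simp only [map_add, hx, hy]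
  | tmul a b =>
    rw [BalancedTensor.mkQ_tmul, BalancedTensor.mkQ_tmul, canonicalMap_tmul, canonicalMap_tmul,
      LinearMap.comp_apply]
    exact ((q.baseChange A).map_smul a (d b)).symm

variable {σ : H →ₗ[R] H}

theorem le_of_phi_le_phi [Module.FaithfullyFlat R A] (hσ : IsSkewAntipode σ)
    (hδ : IsRightCoaction δ.toLinearMap) (hG : IsHopfGalois δ)
    (hB : IsRightFaithfullyFlat R (coinvariants δ) A) {P Q : GenQuot R H}
    (hQ : Q.IsRightAdmissible) (hle : phi δ Q ≤ phi δ P) : P ≤ Q := by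
  intro x hx
  obtain ⟨z, hz⟩ := hG.2 (1 ⊗ₜ[R] x)
  obtain ⟨w, rfl⟩ := Submodule.mkQ_surjective _ z
  have canonicalMap_Q_eq_zero : canonicalMap (quotCoaction δ Q) (phi δ Q)
      (quotCoaction_mul_of_mem δ Q le_rfl) ((balancedRel R (phi δ Q) A A).mkQ w) = 0 := by
    refine (canonicalMap_lTensor_comp_mkQ _ (coaction_mul_of_mem δ) _ w).trans ?_
    rw [hz, LinearMap.lTensor_tmul, Submodule.mkQ_apply, (Submodule.Quotient.mk_eq_zero _).2 hx,
      TensorProduct.tmul_zero]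
  have mkQ_eq_zero : (balancedRel R (phi δ Q) A A).mkQ w = 0 :=
    (canonicalMap_phi_bijective hσ hδ hG hB hQ.2).1
      (canonicalMap_Q_eq_zero.trans (map_zero _).symm)
  have one_tmul_eq_zero : (1 : A) ⊗ₜ[R] P.ideal.mkQ x = 0 := by
    rw [← LinearMap.lTensor_tmul, ← hz, ← canonicalMap_lTensor_comp_mkQ P.ideal.mkQ _
      (quotCoaction_mul_of_mem δ P hle), mkQ_eq_zero, map_zero]
  exact (Submodule.Quotient.mk_eq_zero _).1
    ((Module.FaithfullyFlat.one_tmul_eq_zero_iff R _ _).1 one_tmul_eq_zero)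

theorem psi_phi_of_isRightAdmissible [Module.FaithfullyFlat R A] (hσ : IsSkewAntipode σ)
    (hδ : IsRightCoaction δ.toLinearMap) (hG : IsHopfGalois δ)
    (hB : IsRightFaithfullyFlat R (coinvariants δ) A) {Q : GenQuot R H}
    (hQ : Q.IsRightAdmissible) : psi δ (phi δ Q) = Q :=
  le_antisymm ((GenQuot.isLUB_sSup _).2 fun _ => le_of_phi_le_phi hσ hδ hG hB hQ) (le_psi le_rfl)

theorem restrictsToBijection_right [Module.FaithfullyFlat R A] (hσ : IsSkewAntipode σ)
    (hδ : IsRightCoaction δ.toLinearMap) (hG : IsHopfGalois δ)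
    (hB : IsRightFaithfullyFlat R (coinvariants δ) A) :
    RestrictsToBijection δ {S | IsRightAdmissible δ S} {Q | Q.IsRightAdmissible} := by
  refine restrictsToBijection_of_forall (fun S hS =>
    ⟨isRightAdmissible_psi hδ hG hB hS, phi_psi_of_isRightAdmissible hS⟩) fun Q hQ => ?_
  have psi_phi := psi_phi_of_isRightAdmissible hσ hδ hG hB hQ
  refine ⟨⟨coinvariants_le_phi Q, isRightFaithfullyFlat_phi hσ hδ hG hB hQ.2, ?_, ?_⟩, psi_phi⟩
  · have bijective_of_eq : ∀ P, P = Q → ∃ hS : phi δ Q ≤ phi δ P, Function.Bijective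
        (canonicalMap (quotCoaction δ P) (phi δ Q) (quotCoaction_mul_of_mem δ P hS)) := by
      rintro P rfl
      exact ⟨le_rfl, canonicalMap_phi_bijective hσ hδ hG hB hQ.2⟩
    exact bijective_of_eq _ psi_phi
  · rw [psi_phi]
    exact hQ.1

end Correspondence

/-! ### The antipode and the opposite bialgebra -/

section Antipode

open HopfAlgebra Coalgebra

variable {R H : Type*} [CommRing R] [Ring H] [HopfAlgebra R H]

theorem algHom_comp_antipode_convMul {A : Type*} [Ring A] [Algebra R A] (φ : H →ₐ[R] A) :
    WithConv.toConv (φ.toLinearMap ∘ₗ antipode R) * WithConv.toConv φ.toLinearMap = 1 := by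
  refine WithConv.ofConv_injective
    ((LinearMap.algHom_comp_convMul_distrib φ _ (WithConv.toConv LinearMap.id)).symm.trans ?_)
  rw [LinearMap.antipode_mul_id]
  ext h
  simp

theorem includeLeft_convMul_includeRight :
    WithConv.toConv (Algebra.TensorProduct.includeLeft : H →ₐ[R] H ⊗[R] H).toLinearMap *
      WithConv.toConv (Algebra.TensorProduct.includeRight : H →ₐ[R] H ⊗[R] H).toLinearMap =
      WithConv.toConv (comul (R := R)) := by
  ext h
  rw [LinearMap.convMul_apply]
  change _ = comul (R := R) h
  generalize comul (R := R) h = y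
  induction y with
  | zero => simp
  | add x y hx hy => simp only [map_add, hx, hy]
  | tmul a b => simp

/-- Both sides are convolution inverses of `Δ`: since `Δ` is the convolution product of
`h ↦ h ⊗ 1` and `h ↦ 1 ⊗ h`, its inverse is the product of `h ↦ 1 ⊗ S h` and `h ↦ S h ⊗ 1`. -/
theorem comul_antipode (h : H) : comul (R := R) (antipode R h) =
    TensorProduct.comm R H H (TensorProduct.map (antipode R) (antipode R) (comul h)) := by
  let ι₁ : H →ₐ[R] H ⊗[R] H := Algebra.TensorProduct.includeLeft
  let ι₂ : H →ₐ[R] H ⊗[R] H := Algebra.TensorProduct.includeRight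
  have left_inv : (WithConv.toConv (ι₂.toLinearMap ∘ₗ antipode R) *
      WithConv.toConv (ι₁.toLinearMap ∘ₗ antipode R)) * WithConv.toConv (comul (R := R)) = 1 := by
    rw [← includeLeft_convMul_includeRight, mul_assoc,
      ← mul_assoc (WithConv.toConv (ι₁.toLinearMap ∘ₗ antipode R)), algHom_comp_antipode_convMul,
      one_mul, algHom_comp_antipode_convMul]
  have inv_eq := left_inv_eq_right_inv left_inv LinearMap.comul_right_inv
  refine (congrArg (fun f => f.ofConv h) inv_eq).symm.trans ?_
  change LinearMap.mul' R (H ⊗[R] H) (TensorProduct.map _ _ (comul (R := R) h)) = _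
  generalize comul (R := R) h = y
  induction y with
  | zero => simp
  | add x y hx hy => simp only [map_add, hx, hy]
  | tmul a b => simp [ι₁, ι₂]

/-- The inverse of a bijective antipode. -/
def antipodeInv (h : Function.Bijective (antipode R : H → H)) : H →ₗ[R] H :=
  (LinearEquiv.ofBijective (antipode R) h).symm.toLinearMap

theorem antipode_antipodeInv (hS : Function.Bijective (antipode R : H → H)) (h : H) :
    antipode R (antipodeInv hS h) = h :=
  (LinearEquiv.ofBijective (antipode R) hS).apply_symm_apply h

theorem antipodeInv_antipode (hS : Function.Bijective (antipode R : H → H)) (h : H) :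
    antipodeInv hS (antipode R h) = h :=
  hS.1 (antipode_antipodeInv hS _)

theorem antipode_mul'_antipodeInv_rTensor (hS : Function.Bijective (antipode R : H → H))
    (y : H ⊗[R] H) : antipode R (LinearMap.mul' R H ((antipodeInv hS).rTensor H
      (TensorProduct.comm R H H y))) = LinearMap.mul' R H ((antipode R).rTensor H y) := by
  induction y with
  | zero => simp
  | add x y hx hy => simp only [map_add, hx, hy]
  | tmul a b => simp [antipode_mul_antidistrib, antipode_antipodeInv]

theorem antipode_mul'_antipodeInv_lTensor (hS : Function.Bijective (antipode R : H → H))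
    (y : H ⊗[R] H) : antipode R (LinearMap.mul' R H ((antipodeInv hS).lTensor H
      (TensorProduct.comm R H H y))) = LinearMap.mul' R H ((antipode R).lTensor H y) := by
  induction y with
  | zero => simp
  | add x y hx hy => simp only [map_add, hx, hy]
  | tmul a b => simp [antipode_mul_antidistrib, antipode_antipodeInv]

theorem antipode_algebraMap (r : R) : antipode R (algebraMap R H r) = algebraMap R H r := by
  rw [Algebra.algebraMap_eq_smul_one, map_smul, antipode_one]

theorem isSkewAntipode_antipodeInv (hS : Function.Bijective (antipode R : H → H)) :
    IsSkewAntipode (antipodeInv hS) where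
  map_one := hS.1 (by rw [antipode_antipodeInv, antipode_one])
  map_mul g h := hS.1 (by rw [antipode_mul_antidistrib]; simp only [antipode_antipodeInv])
  counit h := by rw [← counit_antipode, antipode_antipodeInv]
  comul h := by
    conv_rhs => rw [← antipode_antipodeInv hS h, comul_antipode]
    generalize comul (R := R) (antipodeInv hS h) = y
    induction y with
    | zero => simp
    | add x y hx hy => simp only [map_add, ← hx, ← hy]
    | tmul a b => simp [antipodeInv_antipode]
  mul_rTensor_comm h := hS.1 (by
    rw [antipode_mul'_antipodeInv_rTensor, mul_antipode_rTensor_comul_apply, antipode_algebraMap])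
  mul_lTensor_comm h := hS.1 (by
    rw [antipode_mul'_antipodeInv_lTensor, mul_antipode_lTensor_comul_apply, antipode_algebraMap])

end Antipode

section Opposite

open HopfAlgebra Coalgebra

variable {R H : Type*} [CommRing R] [Ring H]

/-- The opposite bialgebra: opposite product, same comultiplication. -/
instance bialgebraMulOpposite [Bialgebra R H] : Bialgebra R Hᵐᵒᵖ :=
  Bialgebra.mk' R Hᵐᵒᵖ (Bialgebra.counit_one (R := R) (A := H))
    (fun {a b} => by
      simp [MulOpposite.counit_def, mul_comm])
    (by simp [MulOpposite.comul_def, Algebra.TensorProduct.one_def])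
    (fun {a b} => by
      change TensorProduct.map (opLinearEquiv R).toLinearMap (opLinearEquiv R).toLinearMap
        (comul (R := R) (unop b * unop a)) = TensorProduct.map (opLinearEquiv R).toLinearMap
        (opLinearEquiv R).toLinearMap (comul (R := R) (unop a)) * TensorProduct.map
        (opLinearEquiv R).toLinearMap (opLinearEquiv R).toLinearMap (comul (R := R) (unop b))
      rw [Bialgebra.comul_mul]
      generalize comul (R := R) (unop a) = x
      generalize comul (R := R) (unop b) = y
      induction x with
      | zero => simp
      | add x x' hx hy => simp only [map_add, mul_add, add_mul, hx, hy]
      | tmul p q =>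
        induction y with
        | zero => simp
        | add x x' hx hy => simp only [map_add, mul_add, add_mul, hx, hy]
        | tmul r s => simp)

variable [HopfAlgebra R H]

variable (R H) in
/-- The antipode, as an endomorphism of `Hᵐᵒᵖ`. -/
def antipodeOp : Hᵐᵒᵖ →ₗ[R] Hᵐᵒᵖ :=
  (opLinearEquiv R).toLinearMap ∘ₗ antipode R ∘ₗ (opLinearEquiv R).symm.toLinearMap

theorem antipodeOp_op (h : H) : antipodeOp R H (op h) = op (antipode R h) := rfl

theorem comul_op (h : H) : comul (R := R) (op h) = TensorProduct.map
    (opLinearEquiv R).toLinearMap (opLinearEquiv R).toLinearMap (comul (R := R) h) := rfl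

theorem isSkewAntipode_antipodeOp : IsSkewAntipode (antipodeOp R H) where
  map_one := congrArg op antipode_one
  map_mul g h := congrArg op (antipode_mul_antidistrib (unop h) (unop g))
  counit h := counit_antipode (R := R) (unop h)
  comul h := by
    induction h using MulOpposite.rec' with | h h => ?_
    rw [antipodeOp_op, comul_op, comul_op, comul_antipode]
    generalize comul (R := R) h = y
    induction y with
    | zero => simp
    | add x y hx hy => simp only [map_add, hx, hy]
    | tmul a b => simp [antipodeOp_op]
  mul_rTensor_comm h := by
    induction h using MulOpposite.rec' with | h h => ?_
    refine Eq.trans ?_ (congrArg op (mul_antipode_lTensor_comul_apply (R := R) h))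
    rw [comul_op]
    generalize comul (R := R) h = y
    induction y with
    | zero => simp
    | add x y hx hy => simp only [map_add, op_add, hx, hy]
    | tmul a b => simp [antipodeOp_op]
  mul_lTensor_comm h := by
    induction h using MulOpposite.rec' with | h h => ?_
    refine Eq.trans ?_ (congrArg op (mul_antipode_rTensor_comul_apply (R := R) h))
    rw [comul_op]
    generalize comul (R := R) h = y
    induction y with
    | zero => simp
    | add x y hx hy => simp only [map_add, op_add, hx, hy]
    | tmul a b => simp [antipodeOp_op]

end Opposite

/-! ### Faithful flatness and the opposite algebra -/

section FlatOp

variable {R A : Type*} [CommRing R] [Ring A] [Algebra R A] (S : Subalgebra R A)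

/-- `op a ⊗ x ↦ x ⊗ a` as an isomorphism `Aᵒᵖ ⊗_{Sᵒᵖ} X ≅ X ⊗_S A`. -/
def BalancedTensor.opEquiv {X : Type*} [AddCommGroup X] [Module R X] [Module (↥S)ᵐᵒᵖ X]
    [Module S.op X] (hX : ∀ (s : S) (x : X), S.linearEquivOp s • x = op s • x) :
    BalancedTensor R S.op Aᵐᵒᵖ X ≃ₗ[R] BalancedTensor R S X A :=
  Submodule.Quotient.equiv _ _ (TensorProduct.congr (opLinearEquiv R).symm (LinearEquiv.refl R X)
      ≪≫ₗ TensorProduct.comm R A X) (by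
    apply le_antisymm
    · rw [balancedRel, Submodule.map_span, Submodule.span_le]
      rintro _ ⟨_, ⟨m, s, x, rfl⟩, rfl⟩
      refine (Submodule.neg_mem_iff _).1 (Submodule.subset_span
        ⟨x, S.linearEquivOp.symm s, unop m, ?_⟩)
      rw [← hX, LinearEquiv.apply_symm_apply, map_sub, neg_sub]
      rfl
    · rw [balancedRel, Submodule.span_le]
      rintro _ ⟨x, s, a, rfl⟩
      refine ⟨-((op (S.linearEquivOp s) • op a) ⊗ₜ x - op a ⊗ₜ (S.linearEquivOp s • x)),
        neg_mem (Submodule.subset_span ⟨_, _, _, rfl⟩), ?_⟩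
      rw [neg_sub, hX, map_sub]
      rfl)

theorem mapRight_op_exact_iff {X Y Z : Type*} [AddCommGroup X] [AddCommGroup Y] [AddCommGroup Z]
    [Module R X] [Module R Y] [Module R Z]
    [Module (↥S)ᵐᵒᵖ X] [Module (↥S)ᵐᵒᵖ Y] [Module (↥S)ᵐᵒᵖ Z]
    [IsScalarTower R (↥S)ᵐᵒᵖ X] [IsScalarTower R (↥S)ᵐᵒᵖ Y] [IsScalarTower R (↥S)ᵐᵒᵖ Z]
    [Module S.op X] [Module S.op Y] [Module S.op Z]
    [IsScalarTower R S.op X] [IsScalarTower R S.op Y] [IsScalarTower R S.op Z]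
    (hX : ∀ (s : S) (x : X), S.linearEquivOp s • x = op s • x)
    (hY : ∀ (s : S) (x : Y), S.linearEquivOp s • x = op s • x)
    (hZ : ∀ (s : S) (x : Z), S.linearEquivOp s • x = op s • x)
    {f : X →ₗ[(↥S)ᵐᵒᵖ] Y} {g : Y →ₗ[(↥S)ᵐᵒᵖ] Z} {f' : X →ₗ[S.op] Y} {g' : Y →ₗ[S.op] Z}
    (hf : ∀ x, f' x = f x) (hg : ∀ y, g' y = g y) :
    Function.Exact (BalancedTensor.mapLeft (R := R) A f) (BalancedTensor.mapLeft (R := R) A g) ↔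
      Function.Exact (BalancedTensor.mapRight (R := R) Aᵐᵒᵖ f')
        (BalancedTensor.mapRight (R := R) Aᵐᵒᵖ g') :=
  Function.Exact.iff_of_ladder_linearEquiv (e₁ := BalancedTensor.opEquiv S hX)
    (e₂ := BalancedTensor.opEquiv S hY) (e₃ := BalancedTensor.opEquiv S hZ)
    (BalancedTensor.linearMap_ext fun m x =>
      congrArg (fun y => BalancedTensor.tmul R S y (unop m)) (hf x).symm)
    (BalancedTensor.linearMap_ext fun m x =>
      congrArg (fun y => BalancedTensor.tmul R S y (unop m)) (hg x).symm)

theorem isRightFaithfullyFlat_op_iff {R A : Type u} [CommRing R] [Ring A] [Algebra R A]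
    (S : Subalgebra R A) :
    IsRightFaithfullyFlat R S.op Aᵐᵒᵖ ↔ IsLeftFaithfullyFlat R S A := by
  constructor
  · intro h X Y Z _ _ _ _ _ _ _ _ _ _ _ _ f g
    let φ : S.op →+* (↥S)ᵐᵒᵖ := S.mopAlgEquivOp.symm.toRingEquiv.toRingHom
    let _ : Module S.op X := Module.compHom X φ
    let _ : Module S.op Y := Module.compHom Y φ
    let _ : Module S.op Z := Module.compHom Z φ
    have : IsScalarTower R S.op X := ⟨fun r s x => smul_assoc r (φ s) x⟩
    have : IsScalarTower R S.op Y := ⟨fun r s x => smul_assoc r (φ s) x⟩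
    have : IsScalarTower R S.op Z := ⟨fun r s x => smul_assoc r (φ s) x⟩
    let f' : X →ₗ[S.op] Y :=
      { toFun := f, map_add' := f.map_add, map_smul' := fun s x => f.map_smul (φ s) x }
    let g' : Y →ₗ[S.op] Z :=
      { toFun := g, map_add' := g.map_add, map_smul' := fun s x => g.map_smul (φ s) x }
    exact (h X Y Z f' g').trans (mapRight_op_exact_iff S (fun _ _ => rfl) (fun _ _ => rfl)
      (fun _ _ => rfl) (fun _ => rfl) (fun _ => rfl)).symm
  · intro h X Y Z _ _ _ _ _ _ _ _ _ _ _ _ f g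
    let φ : (↥S)ᵐᵒᵖ →+* S.op := S.mopAlgEquivOp.toRingEquiv.toRingHom
    let _ : Module (↥S)ᵐᵒᵖ X := Module.compHom X φ
    let _ : Module (↥S)ᵐᵒᵖ Y := Module.compHom Y φ
    let _ : Module (↥S)ᵐᵒᵖ Z := Module.compHom Z φ
    have : IsScalarTower R (↥S)ᵐᵒᵖ X := ⟨fun r s x => smul_assoc r (φ s) x⟩
    have : IsScalarTower R (↥S)ᵐᵒᵖ Y := ⟨fun r s x => smul_assoc r (φ s) x⟩
    have : IsScalarTower R (↥S)ᵐᵒᵖ Z := ⟨fun r s x => smul_assoc r (φ s) x⟩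
    let f' : X →ₗ[(↥S)ᵐᵒᵖ] Y :=
      { toFun := f, map_add' := f.map_add, map_smul' := fun s x => f.map_smul (φ s) x }
    let g' : Y →ₗ[(↥S)ᵐᵒᵖ] Z :=
      { toFun := g, map_add' := g.map_add, map_smul' := fun s x => g.map_smul (φ s) x }
    exact (h X Y Z f' g').trans (mapRight_op_exact_iff S (fun _ _ => rfl) (fun _ _ => rfl)
      (fun _ _ => rfl) (fun _ => rfl) (fun _ => rfl))

end FlatOp

/-! ### Faithful coflatness and anti-isomorphisms of coalgebras -/

section Swap

variable {R C C' X Y Z M M' : Type*} [CommRing R] [AddCommGroup C] [Module R C]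
  [AddCommGroup C'] [Module R C'] [AddCommGroup X] [Module R X] [AddCommGroup Y] [Module R Y]
  [AddCommGroup Z] [Module R Z] [AddCommGroup M] [Module R M] [AddCommGroup M'] [Module R M']

theorem exists_twist_eq (e : C ≃ₗ[R] C') (ρ : X →ₗ[R] C' ⊗[R] X) :
    ∃ d, twist e.toLinearMap d = ρ :=
  ⟨(flipEquiv X e).symm.toLinearMap ∘ₗ ρ,
    LinearMap.ext fun x => (flipEquiv X e).apply_symm_apply (ρ x)⟩

theorem twist_colinear_iff (e : C ≃ₗ[R] C') {dX : X →ₗ[R] X ⊗[R] C} {dY : Y →ₗ[R] Y ⊗[R] C}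
    {f : X →ₗ[R] Y} :
    twist e.toLinearMap dY ∘ₗ f = f.lTensor C' ∘ₗ twist e.toLinearMap dX ↔
      dY ∘ₗ f = f.rTensor C ∘ₗ dX := by
  simp only [LinearMap.ext_iff, LinearMap.comp_apply, twist_apply, lTensor_flipMap,
    (flipMap_injective e).eq_iff]

variable {e : C ≃ₗ[R] C'} {w : M ≃ₗ[R] M'} {r : M →ₗ[R] C ⊗[R] M} {d' : M' →ₗ[R] M' ⊗[R] C'}
  (hw : ∀ m, d' (w m) = TensorProduct.comm R C' M'
    (TensorProduct.map e.toLinearMap w.toLinearMap (r m)))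

include hw in
theorem flipMap_mem_cotensor_iff (d : X →ₗ[R] X ⊗[R] C) (z : X ⊗[R] M) :
    flipMap X w.toLinearMap z ∈ cotensor d' (twist e.toLinearMap d) ↔ z ∈ cotensor d r := by
  change TensorProduct.assoc R M' C' X (d'.rTensor X (flipMap X w.toLinearMap z)) =
      (twist e.toLinearMap d).lTensor M' (flipMap X w.toLinearMap z) ↔
    TensorProduct.assoc R X C M (d.rTensor M z) = r.lTensor X z
  rw [assoc_rTensor_flipMap hw, lTensor_twist_flipMap, (reverseMap_injective e w).eq_iff, eq_comm]

/-- `X □_C M ≅ M' □_{C'} X`, where `C'` and `M'` are mirror images of `C` and `M`. -/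
def cotensorSwapEquiv (d : X →ₗ[R] X ⊗[R] C) :
    cotensor d r ≃ₗ[R] cotensor d' (twist e.toLinearMap d) :=
  (flipEquiv X w).ofSubmodules _ _ (by
    ext y
    rw [Submodule.mem_map_equiv, ← flipMap_mem_cotensor_iff hw]
    exact iff_of_eq (congrArg _ ((flipEquiv X w).apply_symm_apply y)))

include hw in
theorem cotensor_swap_exact_iff {dX : X →ₗ[R] X ⊗[R] C} {dY : Y →ₗ[R] Y ⊗[R] C}
    {dZ : Z →ₗ[R] Z ⊗[R] C} {f : X →ₗ[R] Y} {g : Y →ₗ[R] Z} (hf : dY ∘ₗ f = f.rTensor C ∘ₗ dX)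
    (hg : dZ ∘ₗ g = g.rTensor C ∘ₗ dY)
    (hf' : twist e.toLinearMap dY ∘ₗ f = f.lTensor C' ∘ₗ twist e.toLinearMap dX)
    (hg' : twist e.toLinearMap dZ ∘ₗ g = g.lTensor C' ∘ₗ twist e.toLinearMap dY) :
    Function.Exact (cotensorMapRight d' f hf') (cotensorMapRight d' g hg') ↔
      Function.Exact (cotensorMapLeft r f hf) (cotensorMapLeft r g hg) :=
  Function.Exact.iff_of_ladder_linearEquiv (e₁ := cotensorSwapEquiv hw dX)
    (e₂ := cotensorSwapEquiv hw dY) (e₃ := cotensorSwapEquiv hw dZ)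
    (LinearMap.ext fun x => Subtype.ext (lTensor_flipMap w.toLinearMap f x.1))
    (LinearMap.ext fun x => Subtype.ext (lTensor_flipMap w.toLinearMap g x.1))

end Swap

theorem isRightFaithfullyCoflat_swap_iff {R C C' M M' : Type u} [CommRing R] [AddCommGroup C]
    [Module R C] [Coalgebra R C] [AddCommGroup C'] [Module R C'] [Coalgebra R C']
    [AddCommGroup M] [Module R M] [AddCommGroup M'] [Module R M']
    {e : C ≃ₗ[R] C'} (he : IsAntiCoalgHom e.toLinearMap) {w : M ≃ₗ[R] M'}
    {r : M →ₗ[R] C ⊗[R] M} {d' : M' →ₗ[R] M' ⊗[R] C'}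
    (hw : ∀ m, d' (w m) = TensorProduct.comm R C' M'
      (TensorProduct.map e.toLinearMap w.toLinearMap (r m))) :
    IsRightFaithfullyCoflat d' ↔ IsLeftFaithfullyCoflat r := by
  constructor
  · intro h X Y Z _ _ _ _ _ _ dX dY dZ hX hY hZ f g hf hg
    rw [← isLeftCoaction_twist_iff he] at hX hY hZ
    have hf' := (twist_colinear_iff e).2 hf
    have hg' := (twist_colinear_iff e).2 hg
    exact (h X Y Z _ _ _ hX hY hZ f g hf' hg').trans (cotensor_swap_exact_iff hw hf hg hf' hg')
  · intro h X Y Z _ _ _ _ _ _ ρX ρY ρZ hX hY hZ f g hf' hg'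
    obtain ⟨dX, rfl⟩ := exists_twist_eq e ρX
    obtain ⟨dY, rfl⟩ := exists_twist_eq e ρY
    obtain ⟨dZ, rfl⟩ := exists_twist_eq e ρZ
    rw [isLeftCoaction_twist_iff he] at hX hY hZ
    have hf := (twist_colinear_iff e).1 hf'
    have hg := (twist_colinear_iff e).1 hg'
    exact (h X Y Z _ _ _ hX hY hZ f g hf hg).trans
      (cotensor_swap_exact_iff hw hf hg hf' hg').symm

section Transport

theorem map_mkQ_comm_map {R H K : Type*} [CommRing R] [AddCommGroup H] [Module R H]
    [AddCommGroup K] [Module R K] (e : H ≃ₗ[R] K) {I : Submodule R H} {J : Submodule R K}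
    (hIJ : I.map e.toLinearMap = J) (y : H ⊗[R] H) :
    TensorProduct.map J.mkQ J.mkQ (TensorProduct.comm R K K
        (TensorProduct.map e.toLinearMap e.toLinearMap y)) =
      TensorProduct.comm R _ _ (TensorProduct.map (Submodule.Quotient.equiv I J e hIJ).toLinearMap
        (Submodule.Quotient.equiv I J e hIJ).toLinearMap (TensorProduct.map I.mkQ I.mkQ y)) := by
  induction y with
  | zero => simp
  | add x y hx hy => simp only [map_add, hx, hy]
  | tmul a b => rfl

variable {R H K : Type*} [CommRing R] [Ring H] [Algebra R H] [Coalgebra R H]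
  [Ring K] [Algebra R K] [Coalgebra R K]
  (E : H ≃ₐ[R] K) (hE : IsAntiCoalgHom E.toLinearEquiv.toLinearMap)

/-- The image of a generalised quotient under an isomorphism of algebras which is an
anti-isomorphism of coalgebras. -/
def GenQuot.transport (Q : GenQuot R H) : GenQuot R K where
  ideal := Q.ideal.map E.toLinearEquiv.toLinearMap
  isCoideal := by
    constructor
    · rintro _ ⟨x, hx, rfl⟩
      exact (hE.counit x).trans (Submodule.IsCoideal.counit_eq_zero hx)
    · rintro _ ⟨x, hx, rfl⟩
      rw [hE.comul, map_mkQ_comm_map E.toLinearEquiv rfl,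
        Submodule.IsCoideal.map_mkQ_comul_eq_zero hx, map_zero, map_zero]
  mul_mem := by
    rintro _ ⟨x, hx, rfl⟩ h
    exact ⟨x * E.symm h, Q.mul_mem x hx _, by simp⟩

/-- The isomorphism of quotients induced by `E`. -/
def GenQuot.transportEquiv (Q : GenQuot R H) :
    (H ⧸ Q.ideal) ≃ₗ[R] (K ⧸ (Q.transport E hE).ideal) :=
  Submodule.Quotient.equiv _ _ E.toLinearEquiv rfl

theorem GenQuot.isAntiCoalgHom_transportEquiv (Q : GenQuot R H) :
    IsAntiCoalgHom (Q.transportEquiv E hE).toLinearMap where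
  counit c := by
    obtain ⟨h, rfl⟩ := Q.ideal.mkQ_surjective c
    exact hE.counit h
  comul c := by
    obtain ⟨h, rfl⟩ := Q.ideal.mkQ_surjective c
    change TensorProduct.map (Q.transport E hE).ideal.mkQ (Q.transport E hE).ideal.mkQ
      (Coalgebra.comul (R := R) (E.toLinearEquiv.toLinearMap h)) = _
    rw [hE.comul]
    exact map_mkQ_comm_map E.toLinearEquiv rfl (Coalgebra.comul h)

/-- `GenQuot.transport` as an isomorphism of ordered sets. -/
def GenQuot.transportIso : GenQuot R H ≃o GenQuot R K where
  toFun := GenQuot.transport E hE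
  invFun := GenQuot.transport E.symm hE.symm
  left_inv Q := GenQuot.ext (Submodule.ext fun x =>
    ⟨by rintro ⟨_, ⟨y, hy, rfl⟩, rfl⟩; simpa using hy, fun hx => ⟨E x, ⟨x, hx, rfl⟩, by simp⟩⟩)
  right_inv Q := GenQuot.ext (Submodule.ext fun x =>
    ⟨by rintro ⟨_, ⟨y, hy, rfl⟩, rfl⟩; simpa using hy, fun hx => ⟨E.symm x, ⟨x, hx, rfl⟩, by simp⟩⟩)
  map_rel_iff' {Q₁ Q₂} := Submodule.map_le_map_iff_of_injective E.injective Q₂.ideal Q₁.ideal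

theorem GenQuot.isRightAdmissible_transport_iff {R H K : Type u} [CommRing R] [Ring H]
    [Algebra R H] [Coalgebra R H] [Ring K] [Algebra R K] [Coalgebra R K] (E : H ≃ₐ[R] K)
    (hE : IsAntiCoalgHom E.toLinearEquiv.toLinearMap) (Q : GenQuot R H) :
    (Q.transport E hE).IsRightAdmissible ↔ Q.IsLeftAdmissible := by
  refine and_congr (Module.Flat.equiv_iff (Q.transportEquiv E hE)).symm
    (isRightFaithfullyCoflat_swap_iff (Q.isAntiCoalgHom_transportEquiv E hE)
      (w := E.toLinearEquiv) fun m => ?_)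
  rw [LinearMap.comp_apply, LinearMap.comp_apply, ← LinearEquiv.coe_coe, hE.comul]
  generalize Coalgebra.comul (R := R) m = y
  induction y with
  | zero => simp
  | add x y hx hy => simp only [map_add, hx, hy]
  | tmul a b => rfl

end Transport

/-! ### The opposite comodule algebra -/

theorem IsRightCoaction.of_surjective {R X X' C C' : Type*} [CommRing R] [AddCommGroup X]
    [Module R X] [AddCommGroup X'] [Module R X'] [AddCommGroup C] [Module R C] [Coalgebra R C]
    [AddCommGroup C'] [Module R C'] [Coalgebra R C'] {d : X →ₗ[R] X ⊗[R] C}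
    (hd : IsRightCoaction d) {f : X →ₗ[R] X'} (hf : Function.Surjective f) {g : C →ₗc[R] C'}
    {d' : X' →ₗ[R] X' ⊗[R] C'} (hd' : d' ∘ₗ f = TensorProduct.map f g.toLinearMap ∘ₗ d) :
    IsRightCoaction d' where
  coassoc := by
    rw [← LinearMap.cancel_right hf]
    calc
      _ = (TensorProduct.assoc R X' C' C').toLinearMap ∘ₗ
          TensorProduct.map (TensorProduct.map f g.toLinearMap) g.toLinearMap ∘ₗ
            d.rTensor C ∘ₗ d := by
        simp only [LinearMap.comp_assoc, hd']
        rw [← LinearMap.comp_assoc d, LinearMap.rTensor_comp_map, hd', ← LinearMap.map_comp_rTensor,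
          LinearMap.comp_assoc]
      _ = TensorProduct.map f (TensorProduct.map g.toLinearMap g.toLinearMap) ∘ₗ
          (Coalgebra.comul (R := R)).lTensor X ∘ₗ d := by
        rw [← LinearMap.comp_assoc, ← TensorProduct.map_map_comp_assoc_eq, LinearMap.comp_assoc,
          hd.coassoc]
      _ = _ := by
        rw [LinearMap.comp_assoc, hd', ← LinearMap.comp_assoc, ← LinearMap.comp_assoc,
          LinearMap.lTensor_comp_map, LinearMap.map_comp_lTensor, g.map_comp_comul]
  counit := by
    rw [← LinearMap.cancel_right hf]
    calc
      _ = TensorProduct.map f LinearMap.id ∘ₗ (Coalgebra.counit (R := R)).lTensor X ∘ₗ d := by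
        rw [LinearMap.comp_assoc, hd', ← LinearMap.comp_assoc, ← LinearMap.comp_assoc,
          LinearMap.lTensor_comp_map, LinearMap.map_comp_lTensor, g.counit_comp,
          LinearMap.id_comp]
      _ = _ := by
        rw [hd.counit]
        rfl

section OpCoaction

variable {R H A : Type*} [CommRing R] [Ring H] [Ring A] [Algebra R A]

theorem opCoaction_op [Algebra R H] (δ : A →ₐ[R] A ⊗[R] H) (a : A) : opCoaction δ (op a) =
    TensorProduct.map (opLinearEquiv R).toLinearMap (opLinearEquiv R).toLinearMap (δ a) := by
  change (Algebra.TensorProduct.opAlgEquiv R R A H).symm (op (δ a)) = _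
  generalize δ a = y
  induction y with
  | zero => simp
  | add x y hx hy => simp only [map_add, op_add, hx, hy]
  | tmul b h => simp

theorem coinvariants_opCoaction [Algebra R H] (δ : A →ₐ[R] A ⊗[R] H) :
    coinvariants (opCoaction δ) = (coinvariants δ).op := by
  ext a
  induction a using MulOpposite.rec' with | h a => ?_
  change opCoaction δ (op a) = op a ⊗ₜ 1 ↔ δ a = a ⊗ₜ 1
  rw [opCoaction_op]
  exact (TensorProduct.congr (opLinearEquiv R) (opLinearEquiv R) :
    A ⊗[R] H ≃ₗ[R] Aᵐᵒᵖ ⊗[R] Hᵐᵒᵖ).injective.eq_iff (a := δ a) (b := a ⊗ₜ 1)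

theorem isRightCoaction_opCoaction [Bialgebra R H] {δ : A →ₐ[R] A ⊗[R] H}
    (hδ : IsRightCoaction δ.toLinearMap) : IsRightCoaction (opCoaction δ).toLinearMap :=
  hδ.of_surjective (opLinearEquiv R).surjective
    (g := { (opLinearEquiv R : H ≃ₗ[R] Hᵐᵒᵖ).toLinearMap with
      counit_comp := rfl
      map_comp_comul := rfl })
    (LinearMap.ext (opCoaction_op δ))

variable [HopfAlgebra R H] (hS : Function.Bijective (HopfAlgebra.antipode R : H → H))

/-- A bijective antipode, as an isomorphism of algebras `H ≅ Hᵒᵖ`. -/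
def antipodeEquivOp : H ≃ₐ[R] Hᵐᵒᵖ :=
  AlgEquiv.ofBijective (HopfAlgebra.antipodeAlgHomOp R H) (op_bijective.comp hS)

theorem isAntiCoalgHom_antipodeEquivOp :
    IsAntiCoalgHom (antipodeEquivOp hS).toLinearEquiv.toLinearMap where
  counit h := HopfAlgebra.counit_antipode (R := R) h
  comul h := by
    change Coalgebra.comul (R := R) (op (HopfAlgebra.antipode R h)) = _
    rw [comul_op, comul_antipode]
    generalize Coalgebra.comul (R := R) h = y
    induction y with
    | zero => simp
    | add x y hx hy => simp only [map_add, hx, hy]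
    | tmul a b => rfl

/-- The generalised quotient of `Hᵒᵖ` by the image of the kernel of `Q` under the antipode. -/
def opQuot : GenQuot R H ≃o GenQuot R Hᵐᵒᵖ :=
  GenQuot.transportIso (antipodeEquivOp hS) (isAntiCoalgHom_antipodeEquivOp hS)

/-- The isomorphism `H ⧸ I ≃ Hᵒᵖ ⧸ S(I)` induced by the antipode `S`. -/
def opQuotEquiv (Q : GenQuot R H) : (H ⧸ Q.ideal) ≃ₗ[R] (Hᵐᵒᵖ ⧸ (opQuot hS Q).ideal) :=
  Q.transportEquiv (antipodeEquivOp hS) (isAntiCoalgHom_antipodeEquivOp hS)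

theorem opQuotEquiv_mkQ_one (Q : GenQuot R H) :
    opQuotEquiv hS Q (Q.ideal.mkQ 1) = (opQuot hS Q).ideal.mkQ 1 :=
  congrArg (opQuot hS Q).ideal.mkQ (map_one (antipodeEquivOp hS))

theorem mkQ_rTensor_flipMap_antipodeOp (Q : GenQuot R H) (y : A ⊗[R] H) :
    (opQuot hS Q).ideal.mkQ.rTensor Aᵐᵒᵖ (flipMap Aᵐᵒᵖ (antipodeOp R H)
      (TensorProduct.map (opLinearEquiv R).toLinearMap (opLinearEquiv R).toLinearMap y)) =
    TensorProduct.comm R _ _ (TensorProduct.congr (opLinearEquiv R) (opQuotEquiv hS Q)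
      (Q.ideal.mkQ.lTensor A y)) := by
  induction y with
  | zero => simp
  | add x y hx hy => simp only [map_add, hx, hy]
  | tmul b h => rfl

variable {δ : A →ₐ[R] A ⊗[R] H} (hδ : IsRightCoaction δ.toLinearMap)

include hδ

theorem phi_opCoaction (Q : GenQuot R H) :
    phi (opCoaction δ) (opQuot hS Q) = (phi δ Q).op := by
  ext a
  induction a using MulOpposite.rec' with | h a => ?_
  have one_tmul_op : (opQuot hS Q).ideal.mkQ 1 ⊗ₜ[R] op a = TensorProduct.comm R _ _
      (TensorProduct.congr (opLinearEquiv R) (opQuotEquiv hS Q) (a ⊗ₜ[R] Q.ideal.mkQ 1)) := by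
    rw [TensorProduct.congr_tmul, opQuotEquiv_mkQ_one]
    rfl
  rw [mem_phi_iff_twist isSkewAntipode_antipodeOp (opCoaction δ) _ (isRightCoaction_opCoaction hδ),
    twist_apply, AlgHom.toLinearMap_apply, opCoaction_op, mkQ_rTensor_flipMap_antipodeOp,
    one_tmul_op, EmbeddingLike.apply_eq_iff_eq, EmbeddingLike.apply_eq_iff_eq]
  rfl

theorem psi_opCoaction (S : Subalgebra R A) :
    psi (opCoaction δ) S.op = opQuot hS (psi δ S) := by
  have image_opQuot : {P | S.op ≤ phi (opCoaction δ) P} = opQuot hS '' {Q | S ≤ phi δ Q} := by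
    ext P
    obtain ⟨Q, rfl⟩ := (opQuot hS).surjective P
    rw [(opQuot hS).injective.mem_set_image, Set.mem_ofPred_eq, Set.mem_ofPred_eq,
      phi_opCoaction hS hδ, Subalgebra.op_le_op_iff]
  refine (GenQuot.isLUB_sSup _).unique ?_
  rw [image_opQuot, (opQuot hS).isLUB_image']
  exact GenQuot.isLUB_sSup _

end OpCoaction

section LeftAdmissible

variable {R H A : Type u} [CommRing R] [Ring H] [Ring A] [Algebra R A] [HopfAlgebra R H]
  (hS : Function.Bijective (HopfAlgebra.antipode R : H → H)) {δ : A →ₐ[R] A ⊗[R] H}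
  (hδ : IsRightCoaction δ.toLinearMap)

theorem isRightAdmissible_opQuot_iff (Q : GenQuot R H) :
    (opQuot hS Q).IsRightAdmissible ↔ Q.IsLeftAdmissible :=
  GenQuot.isRightAdmissible_transport_iff (antipodeEquivOp hS)
    (isAntiCoalgHom_antipodeEquivOp hS) Q

include hS hδ

theorem isRightAdmissible_op_iff (S : Subalgebra R A) :
    IsRightAdmissible (opCoaction δ) S.op ↔ IsLeftAdmissible δ S := by
  have coinvariants_le_iff : coinvariants (opCoaction δ) ≤ S.op ↔ coinvariants δ ≤ S := by
    rw [coinvariants_opCoaction, Subalgebra.op_le_op_iff]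
  have flat_iff : Module.Flat R (Hᵐᵒᵖ ⧸ (psi (opCoaction δ) S.op).ideal) ↔
      Module.Flat R (H ⧸ (psi δ S).ideal) := by
    rw [psi_opCoaction hS hδ]
    exact (Module.Flat.equiv_iff (opQuotEquiv hS (psi δ S))).symm
  exact ⟨fun h => ⟨coinvariants_le_iff.1 h.1, (isRightFaithfullyFlat_op_iff S).1 h.2, h.3,
      flat_iff.1 h.4⟩,
    fun h => ⟨coinvariants_le_iff.2 h.1, (isRightFaithfullyFlat_op_iff S).2 h.2, h.3,
      flat_iff.2 h.4⟩⟩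

theorem restrictsToBijection_left [Module.FaithfullyFlat R A] (hG : IsHopfGalois (opCoaction δ))
    (hB : IsLeftFaithfullyFlat R (coinvariants δ) A) :
    RestrictsToBijection δ {S | IsLeftAdmissible δ S} {Q | Q.IsLeftAdmissible} := by
  have hB_op : IsRightFaithfullyFlat R (coinvariants (opCoaction δ)) Aᵐᵒᵖ := by
    rw [coinvariants_opCoaction]
    exact (isRightFaithfullyFlat_op_iff _).2 hB
  have : Module.FaithfullyFlat R Aᵐᵒᵖ :=
    Module.FaithfullyFlat.of_linearEquiv R A (opLinearEquiv R).symm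
  have bij_op := restrictsToBijection_right isSkewAntipode_antipodeOp
    (isRightCoaction_opCoaction hδ) hG hB_op
  refine restrictsToBijection_of_forall (fun S hSadm => ?_) fun Q hQ => ?_
  · have op_mem : S.op ∈ {T | IsRightAdmissible (opCoaction δ) T} :=
      (isRightAdmissible_op_iff hS hδ S).2 hSadm
    have psi_mem := bij_op.1.mapsTo op_mem
    have phi_psi := bij_op.2.2.1 op_mem
    rw [psi_opCoaction hS hδ] at psi_mem phi_psi
    rw [phi_opCoaction hS hδ] at phi_psi
    exact ⟨(isRightAdmissible_opQuot_iff hS _).1 psi_mem, Subalgebra.opEquiv.injective phi_psi⟩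
  · have opQuot_mem : opQuot hS Q ∈ {P | GenQuot.IsRightAdmissible P} :=
      (isRightAdmissible_opQuot_iff hS Q).2 hQ
    have phi_mem := bij_op.2.1.mapsTo opQuot_mem
    have psi_phi := bij_op.2.2.2 opQuot_mem
    rw [phi_opCoaction hS hδ] at phi_mem psi_phi
    rw [psi_opCoaction hS hδ] at psi_phi
    exact ⟨(isRightAdmissible_op_iff hS hδ _).1 phi_mem, (opQuot hS).injective psi_phi⟩

end LeftAdmissible

end HopfGalois

end

theorem mainTheorem3_general {R H A : Type u} [CommRing R] [Ring H] [HopfAlgebra R H]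
    [Ring A] [Algebra R A]
    (hantipode : Function.Bijective (HopfAlgebra.antipode R : H → H))
    (δ : A →ₐ[R] A ⊗[R] H) (hδ : IsRightCoaction δ.toLinearMap)
    (hGalois : IsHopfGalois δ) (hGalois_op : IsHopfGalois (opCoaction δ))
    (hleft : IsLeftFaithfullyFlat R (coinvariants δ) A)
    (hright : IsRightFaithfullyFlat R (coinvariants δ) A)
    (hflat : Module.FaithfullyFlat R A) :
    RestrictsToBijection δ {S | IsLeftAdmissible δ S} {Q | Q.IsLeftAdmissible} ∧
    RestrictsToBijection δ {S | IsRightAdmissible δ S} {Q | Q.IsRightAdmissible} ∧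
    RestrictsToBijection δ {S | IsLeftAdmissible δ S ∧ IsRightAdmissible δ S}
      {Q | Q.IsLeftAdmissible ∧ Q.IsRightAdmissible} := by
  have left := restrictsToBijection_left hantipode hδ hGalois_op hleft
  have right := restrictsToBijection_right (isSkewAntipode_antipodeInv hantipode) hδ hGalois hright
  exact ⟨left, right, restrictsToBijection_of_forall
    (fun S hS => ⟨⟨left.1.mapsTo hS.1, right.1.mapsTo hS.2⟩, left.2.2.1 hS.1⟩)
    fun Q hQ => ⟨⟨left.2.1.mapsTo hQ.1, right.2.1.mapsTo hQ.2⟩, left.2.2.2 hQ.1⟩⟩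

theorem mainTheorem3 {R H A : Type u} [CommRing R] [Ring H] [HopfAlgebra R H]
    [Ring A] [Algebra R A]
    (hantipode : Function.Bijective (HopfAlgebra.antipode R : H → H))
    (δ : A →ₐ[R] A ⊗[R] H) (hδ : IsRightCoaction δ.toLinearMap)
    (hGalois : IsHopfGalois δ) (hGalois_op : IsHopfGalois (opCoaction δ))
    (hleft : IsLeftFaithfullyFlat R (coinvariants δ) A)
    (hright : IsRightFaithfullyFlat R (coinvariants δ) A)
    (hconn : GaloisConnectionExists δ)
    (hflat : Module.FaithfullyFlat R A) :
    RestrictsToBijection δ {S | IsLeftAdmissible δ S} {Q | Q.IsLeftAdmissible} ∧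
    RestrictsToBijection δ {S | IsRightAdmissible δ S} {Q | Q.IsRightAdmissible} ∧
    RestrictsToBijection δ {S | IsLeftAdmissible δ S ∧ IsRightAdmissible δ S}
      {Q | Q.IsLeftAdmissible ∧ Q.IsRightAdmissible} := by
  exact mainTheorem3_general hantipode δ hδ hGalois hGalois_op hleft hright hflat
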